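/- **Setting.** Let $\mathbb U$ be a real Hilbert space, $M\ge 0$, $N\ge1$, and let $\mathfrak L_{\mathbf k}$, $\mathbf k\in\mathbb N_0^M$, be linear operators on $\mathbb U$ with common domain $D$, zero for $|\mathbf k|>K$, each bounded relative to $\mathfrak L_{\mathbf 0}$: $\|\mathfrak L_{\mathbf k}v\|\le C_{\mathbf k}(\|v\|+\|\mathfrak L_{\mathbf 0}v\|)$ for $v\in D$. Let $\alpha\ge0$ and $\beta>N\alpha$. Assume: 1. $\mathfrak L_{\mathbf 0}$ generates a strongly continuous semigroup $e^{\mathfrak L_{\mathbf 0}t}$ on $\mathbb U$. Every (complex) eigenvalue $\lambda$ of $\mathfrak L_{\mathbf 0}$ satisfies $|\Re\lambda|\le\alpha$ or $\Re\lambda\le-\beta$. With $\mathbb E_c^0$ the real span of the real and imaginary parts of the generalised eigenvectors for the eigenvalues with $|\Re\lambda|\le\alpha$, and $\mathbb E_s^0$ the closed real span of those for the eigenvalues with $\Re\lambda\le-\beta$, one has $\dim\mathbb E^0_c=m<\infty$, $\mathbb U=\mathbb E_c^0\oplus\mathbb E_s^0$, and both subspaces are invariant under the semigroup. 2. If $\mathbb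 U$ is infinite-dimensional, then $\|e^{\mathfrak L_{\mathbf 0}t}v\|\le Ce^{-\gamma_0t}\|v\|$ for $v\in\mathbb E_s^0$, $t\ge0$, with some constants $C$ and $\gamma_0>\alpha$. (In finite dimensions this follows from 1.) 3. Let $\mathbb U_N$ be the space of multinomials $\tilde f=\sum_{|\mathbf n|\le N}\tilde f_{\mathbf n}\boldsymbol\xi^{\mathbf n}/\mathbf n!$ of degree $\le N$ in $\boldsymbol\xi\in\mathbb R^M$ with coefficients $\tilde f_{\mathbf n}\in\mathbb U$, and let $\tilde{\mathcal L}=\sum_{|\mathbf k|\le N}\mathfrak L_{\mathbf k}\partial_{\boldsymbol\xi}^{\mathbf k}$ on the multinomials with coefficients in $D$. If some $\mathfrak L_{\mathbf k}$, $\mathbf k\ne\mathbf 0$, is unbounded, then $\tilde{\mathcal L}$ generates a strongly continuous semigroup on $\mathbb U_N$. (If all of them are bounded this follows from 1.) Let $V^{\mathbf 0}=(V^{\mathbf 0}_1,\dots,V^{\mathbf 0}_m)$ be a basis of $\mathbb E_c^0$, and $Z^{\mathbf 0}$ a basis of the centre subspace (eigenvalues with $|\Re\lambda|\le\alpha$)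 of the adjoint of $\mathfrak L_{\mathbf 0}$, with $\langle Z^{\mathbf 0},V^{\mathbf 0}\rangle=I_m$. Let $A_{\mathbf 0}\in\mathbb R^{m\times m}$ satisfy $\mathfrak L_{\mathbf 0}V^{\mathbf 0}=V^{\mathbf 0}A_{\mathbf 0}$, and consider, for $0<|\mathbf n|\le N$, the recursion for $A_{\mathbf n}\in\mathbb R^{m\times m}$ and $V^{\mathbf n}\in D^{1\times m}$ $$A_{\mathbf n}=\sum_{\mathbf 0\ne\mathbf k\le\mathbf n}\langle Z^{\mathbf 0},\mathfrak L_{\mathbf k}V^{\mathbf n-\mathbf k}\rangle,\qquad \mathfrak L_{\mathbf 0}V^{\mathbf n}-V^{\mathbf n}A_{\mathbf 0}=-\sum_{\mathbf 0\ne\mathbf k\le\mathbf n}\mathfrak L_{\mathbf k}V^{\mathbf n-\mathbf k}+\sum_{\mathbf 0\ne\mathbf k\le\mathbf n}V^{\mathbf n-\mathbf k}A_{\mathbf k},\qquad \langle Z^{\mathbf 0},V^{\mathbf n}\rangle=0 .$$ Put $\tilde{\mathcal V}^{\mathbf n}=\sum_{\mathbf k\le\mathbf n}V^{\mathbf n-\mathbf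 k}\boldsymbol\xi^{\mathbf k}/\mathbf k!$ and let $\mathbb E_c^N$ be the span of all columns of the $\tilde{\mathcal V}^{\mathbf n}$, $|\mathbf n|\le N$. **Claim.** The recursion is solvable, $\tilde{\mathcal L}$ generates a strongly continuous semigroup $e^{\tilde{\mathcal L}t}$ on $\mathbb U_N$, and the stable subspace $\mathbb E_s^N$ of all $\tilde f\in\mathbb U_N$ with $e^{\tilde{\mathcal L}t}\tilde f=O(e^{-\gamma' t})$ for some $\gamma'>\alpha$ is closed. A complex generalised eigenvector of $\tilde{\mathcal L}$ has its real and imaginary parts in $\mathbb E_s^N$ exactly if its eigenvalue satisfies $\Re\lambda\le-\beta$. There is $\gamma\in(\alpha,\beta)$ with $\|e^{\tilde{\mathcal L}t}\tilde f\|\le Ce^{-\gamma t}\|\tilde f\|$ for all $\tilde f\in\mathbb E_s^N$, $t\ge0$, such that for every solution $(A_{\mathbf n},V^{\mathbf n})$ of the recursion $\mathbb U_N=\mathbb E_c^N\oplus\mathbb E_s^N$ and the following holds. Let $\mathbb X\subseteq\mathbb R^M$ be open, $t_0<0$, and let $u(\mathbf x,t)\in D$, $\mathbf x\in\mathbb X$,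 $t>t_0$, be a solution of $$\partial_tu=\sum_{|\mathbf k|\le K}\mathfrak L_{\mathbf k}\,\partial_{\mathbf x}^{\mathbf k}u$$ such that $u$ and $\mathfrak L_{\mathbf 0}u$ are of class $C^{N+\max(K,1)}$ in $(\mathbf x,t)$ with values in $\mathbb U$. Let $U=\langle Z^{\mathbf 0},u\rangle\in\mathbb R^m$ be the macroscale field. For $\mathbf X\in\mathbb X$ put, for $|\boldsymbol\ell|=N$, $u^{(\boldsymbol\ell)}(\mathbf X,\mathbf x,t)=N\int_0^1(1-s)^{N-1}\,\partial_{\mathbf x}^{\boldsymbol\ell}u\big|_{\mathbf X+s(\mathbf x-\mathbf X)}\,ds$, and let $$\tilde r=\sum_{|\mathbf n|\le N}\frac{\boldsymbol\xi^{\mathbf n}}{\mathbf n!}\,r_{\mathbf n},\qquad r_{\mathbf n}=\sum_{|\mathbf k|\ge1}\ \sum_{|\boldsymbol\ell|=N,\ \boldsymbol\ell<\mathbf n+\mathbf k}\mathfrak L_{\mathbf k}\binom{\mathbf n+\mathbf k}{\boldsymbol\ell}\Big[\partial_{\mathbf x}^{\mathbf n+\mathbf k-\boldsymbol\ell}u^{(\boldsymbol\ell)}(\mathbf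 X,\mathbf x,t)\Big]_{\mathbf x=\mathbf X}$$ be the coupling to the neighbouring stations. Write $\tilde r=\tilde{\mathcal V}\tilde r_c+\tilde r_s$ with $\tilde{\mathcal V}\tilde r_c=\sum_{|\mathbf n|\le N}\tilde{\mathcal V}^{\mathbf n}\tilde r_{c,\mathbf n}\in\mathbb E_c^N$, $\tilde r_s\in\mathbb E_s^N$, let $\mathcal B$ be the restriction of $\tilde{\mathcal L}$ to $\mathbb E^N_s$, and $(e^{\mathcal Bt}\star\tilde r_s)(t)=\int_0^te^{\mathcal B(t-\tau)}\tilde r_s(\tau)\,d\tau$. For all $t\ge0$ this integral exists and lies in the domain of $\tilde{\mathcal L}$, and for every $\mathbf X\in\mathbb X$ $$\partial_tU(\mathbf X,t)=\sum_{|\mathbf n|\le N}A_{\mathbf n}\,\partial_{\mathbf x}^{\mathbf n}U(\mathbf X,t)+\rho(\mathbf X,t)+O(e^{-\gamma t})\qquad(t\to\infty),$$ with the closure remainder $$\rho=\langle Z^{\mathbf 0},\tilde{\mathcal V}\tilde r_c\rangle_{\boldsymbol\xi=\mathbf 0}+\langle Z^{\mathbf 0},\mathcal B\,(e^{\mathcal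 Bt}\star\tilde r_s)\rangle_{\boldsymbol\xi=\mathbf 0}+\langle Z^{\mathbf 0},\tilde r_s\rangle_{\boldsymbol\xi=\mathbf 0}-\sum_{|\mathbf n|\le N}A_{\mathbf n}\langle Z^{\mathbf 0},\partial_{\boldsymbol\xi}^{\mathbf n}(e^{\mathcal Bt}\star\tilde r_s)\rangle_{\boldsymbol\xi=\mathbf 0}.$$ -/

import Mathlib

open Filter Topology Asymptotics
open scoped Matrix InnerProductSpace LinearPMap

noncomputable section

namespace SlowlyVarying

/-! ### Unbounded operators, real parts of complex generalised eigenvectors, semigroups -/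

section Operators

variable {E : Type*} [NormedAddCommGroup E] [NormedSpace ℝ E]

open Classical in
/-- Application of a partially defined operator, extended by `0` off its domain. -/
def opApply {F : Type*} [NormedAddCommGroup F] [NormedSpace ℝ F]
    (A : E →ₗ.[ℝ] F) (x : E) : F :=
  if h : x ∈ A.domain then A ⟨x, h⟩ else 0

/-- A pair `(a, b)` stands for the element `a + i b` of the complexification of `E`;
this is `(A - lam)(a + i b)` for the complex number `lam`. -/
def complexShift (A : E →ₗ.[ℝ] E) (lam : ℂ) (w : E × E) : E × E :=
  (opApply A w.1 - lam.re • w.1 + lam.im • w.2, opApply A w.2 - lam.re • w.2 - lam.im • w.1)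

/-- `w = a + i b ≠ 0` is a (complex) generalised eigenvector of the real operator `A` for the
eigenvalue `lam`: `(A - lam)^k w = 0` for some `k`, every power being defined. -/
def IsGenEigenvector (A : E →ₗ.[ℝ] E) (lam : ℂ) (w : E × E) : Prop :=
  w ≠ 0 ∧ ∃ k : ℕ,
    (∀ i < k, ((complexShift A lam)^[i] w).1 ∈ A.domain ∧
      ((complexShift A lam)^[i] w).2 ∈ A.domain) ∧
    (complexShift A lam)^[k] w = 0

/-- The real span of the real and imaginary parts of all generalised eigenvectors of `A` whose
eigenvalue satisfies `P`. -/
def genEigenspan (A : E →ₗ.[ℝ] E) (P : ℂ → Prop) : Submodule ℝ E :=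
  Submodule.span ℝ {x | ∃ (lam : ℂ) (w : E × E), P lam ∧ IsGenEigenvector A lam w ∧
    (x = w.1 ∨ x = w.2)}

/-- The centre subspace: eigenvalues with `|Re lam| ≤ α`. -/
def centreSubspace (A : E →ₗ.[ℝ] E) (α : ℝ) : Submodule ℝ E :=
  genEigenspan A (fun lam => |lam.re| ≤ α)

/-- The (spectral) stable subspace: closed span for the eigenvalues with `Re lam ≤ -β`. -/
def stableSubspace (A : E →ₗ.[ℝ] E) (β : ℝ) : Submodule ℝ E :=
  (genEigenspan A (fun lam => lam.re ≤ -β)).topologicalClosure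

/-- `S` (only `S t` for `t ≥ 0` matters) is a strongly continuous semigroup of bounded operators
whose infinitesimal generator is exactly the operator `A`; one writes `S t = exp (A t)`. -/
structure GeneratesSemigroup (A : E →ₗ.[ℝ] E) (S : ℝ → E →L[ℝ] E) : Prop where
  zero : S 0 = ContinuousLinearMap.id ℝ E
  add : ∀ s t : ℝ, 0 ≤ s → 0 ≤ t → S (s + t) = (S s).comp (S t)
  continuous : ∀ x : E, ContinuousOn (fun t => S t x) (Set.Ici 0)
  generator : ∀ x y : E,
    (x, y) ∈ A.graph ↔ Tendsto (fun h : ℝ => h⁻¹ • (S h x - x)) (𝓝[>] 0) (𝓝 y)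

/-- The states whose evolution decays exponentially, strictly faster than `exp (-α t)`. -/
def decayingSubspace (S : ℝ → E →L[ℝ] E) (α : ℝ) : Submodule ℝ E where
  carrier := {f | ∃ γ : ℝ, α < γ ∧
    (fun t : ℝ => S t f) =O[atTop] (fun t : ℝ => Real.exp (-γ * t))}
  zero_mem' := ⟨α + 1, by linarith, by simpa using isBigO_zero _ _⟩
  add_mem' := by
    rintro f g ⟨γ₁, h₁, hf⟩ ⟨γ₂, h₂, hg⟩
    have key : ∀ γ : ℝ, min γ₁ γ₂ ≤ γ → (fun t : ℝ => Real.exp (-γ * t)) =O[atTop]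
        (fun t : ℝ => Real.exp (-(min γ₁ γ₂) * t)) := by
      intro γ hγ
      refine IsBigO.of_bound 1 ?_
      filter_upwards [eventually_ge_atTop (0 : ℝ)] with t ht
      rw [Real.norm_eq_abs, Real.norm_eq_abs, abs_of_pos (Real.exp_pos _),
        abs_of_pos (Real.exp_pos _), one_mul]
      apply Real.exp_le_exp.mpr
      nlinarith
    refine ⟨min γ₁ γ₂, lt_min h₁ h₂, ?_⟩
    simp only [map_add]
    exact (hf.trans (key γ₁ (min_le_left _ _))).add (hg.trans (key γ₂ (min_le_right _ _)))
  smul_mem' := by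
    rintro c f ⟨γ, h, hf⟩
    refine ⟨γ, h, ?_⟩
    simp only [map_smul]
    exact hf.const_smul_left c

end Operators

/-! ### Multi-indices and mixed partial derivatives -/

/-- The order `|n| = n₁ + ⋯ + n_M` of a multi-index. -/
def order {M : ℕ} (n : Fin M → ℕ) : ℕ := ∑ i, n i

/-- The multi-indices of order at most `N`. -/
def multiIndices (M N : ℕ) : Finset (Fin M → ℕ) :=
  (Finset.Iic (fun _ => N)).filter (fun n => order n ≤ N)

/-- The multi-index binomial coefficient. -/
def multiChoose {M : ℕ} (n k : Fin M → ℕ) : ℕ := ∏ i, (n i).choose (k i)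

/-- The mixed partial derivative `∂₁^{n₁} ⋯ ∂_M^{n_M} f`. -/
def mixedDeriv {M : ℕ} {F : Type*} [NormedAddCommGroup F] [NormedSpace ℝ F] (n : Fin M → ℕ)
    (f : EuclideanSpace ℝ (Fin M) → F) : EuclideanSpace ℝ (Fin M) → F :=
  (List.finRange M).foldr
    (fun i g => (fun (h : EuclideanSpace ℝ (Fin M) → F) (x : EuclideanSpace ℝ (Fin M)) =>
      lineDeriv ℝ h x (EuclideanSpace.single i (1 : ℝ)))^[n i] g) f

/-- The `|l| = N` coefficient `N ∫₀¹ (1-s)^{N-1} ∂^l f (X + s (x - X)) ds` of the Taylor multinomial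
with remainder of `f` about `X`, as a function of `x`. -/
def taylorCoeff {M : ℕ} {F : Type*} [NormedAddCommGroup F] [NormedSpace ℝ F] (N : ℕ)
    (l : Fin M → ℕ) (f : EuclideanSpace ℝ (Fin M) → F) (X x : EuclideanSpace ℝ (Fin M)) : F :=
  (N : ℝ) • ∫ s in (0 : ℝ)..1, (1 - s) ^ (N - 1) • mixedDeriv l f (X + s • (x - X))

/-! ### The system -/

section System

variable {H : Type*} [NormedAddCommGroup H] [InnerProductSpace ℝ H]
  {M : ℕ} {D : Submodule ℝ H}

/-- The operator `L_k` as a partially defined operator on `H` with domain `D`. -/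
def op (L : (Fin M → ℕ) → D →ₗ[ℝ] H) (k : Fin M → ℕ) : H →ₗ.[ℝ] H := ⟨D, L k⟩

/-- Multinomials of degree at most `N` in an indeterminate `ξ ∈ ℝ^M` with coefficients in `H`:
the family `f` stands for `∑_{|n| ≤ N} f n ξ^n / n!`. Thus `∂_ξ^k` is the index shift
`(∂_ξ^k f) n = f (n + k)`, and `f n = ∂_ξ^n f` at `ξ = 0`. -/
abbrev Jet (M N : ℕ) (H : Type*) : Type _ := multiIndices M N → H

/-- The zero multi-index as index of a jet. -/
def jetZero (M N : ℕ) : multiIndices M N :=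
  ⟨0, Finset.mem_filter.mpr ⟨Finset.mem_Iic.mpr fun _ => Nat.zero_le _, by simp [order]⟩⟩

/-- The operator `∑_{|k| ≤ N} L_k ∂_ξ^k` on multinomials; its domain consists of the multinomials
all of whose coefficients lie in `D`. -/
def jetOperator (N : ℕ) (L : (Fin M → ℕ) → D →ₗ[ℝ] H) :
    Jet M N H →ₗ.[ℝ] Jet M N H where
  domain := Submodule.pi Set.univ (fun _ => D)
  toFun := LinearMap.pi fun n => ∑ k ∈ multiIndices M N,
    if h : n.1 + k ∈ multiIndices M N then
      (L k).comp (LinearMap.codRestrict D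
        ((LinearMap.proj (R := ℝ) (φ := fun _ : multiIndices M N => H) ⟨n.1 + k, h⟩).comp
          (Submodule.subtype (Submodule.pi Set.univ (fun _ => D))))
        (fun f => f.2 _ (Set.mem_univ _)))
    else 0

/-- Standing conventions on the operators: only those with `|k| ≤ K` are non-zero, and (automatic
if `H` is finite-dimensional) each is bounded relative to `L_0`, whose domain is `D`. -/
structure IsOperatorFamily (K : ℕ) (L : (Fin M → ℕ) → D →ₗ[ℝ] H) : Prop where
  eq_zero : ∀ k, K < order k → L k = 0
  relBounded : ∀ k, ∃ C : ℝ, ∀ v : D, ‖L k v‖ ≤ C * (‖(v : H)‖ + ‖L 0 v‖)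

/-- The spectral splitting of `L_0`, the generator of the semigroup `T`: the space is the direct sum
of the centre subspace (eigenvalues `|Re lam| ≤ α`) and of the closed stable subspace (closed
span for the eigenvalues `Re lam ≤ -β`), there are no other eigenvalues, both subspaces are
invariant, and the restricted semigroup decays on the stable one.
In finite dimensions the decay follows from the eigenvalues and is not assumed. -/
structure SpectralSplitting (L₀ : H →ₗ.[ℝ] H) (T : ℝ → H →L[ℝ] H) (α β : ℝ) : Prop where
  semigroup : GeneratesSemigroup L₀ T
  isCompl : IsCompl (centreSubspace L₀ α) (stableSubspace L₀ β)
  eigenvalues : ∀ lam w, IsGenEigenvector L₀ lam w → |lam.re| ≤ α ∨ lam.re ≤ -β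
  centre_invariant : ∀ t, 0 ≤ t → ∀ v ∈ centreSubspace L₀ α, T t v ∈ centreSubspace L₀ α
  stable_invariant : ∀ t, 0 ≤ t → ∀ v ∈ stableSubspace L₀ β, T t v ∈ stableSubspace L₀ β
  stable_decay : FiniteDimensional ℝ H ∨ ∃ γ C : ℝ, α < γ ∧
    ∀ t, 0 ≤ t → ∀ v ∈ stableSubspace L₀ β, ‖T t v‖ ≤ C * Real.exp (-γ * t) * ‖v‖

/-- `V₀` is a basis of the centre subspace of `L₀`, and `Z₀` is the dual basis, for the
inner product, of the centre subspace of the adjoint of `L₀`. -/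
structure CentreBases [CompleteSpace H] {m : ℕ} (L₀ : H →ₗ.[ℝ] H) (α : ℝ)
    (V₀ Z₀ : Fin m → H) : Prop where
  indep_V : LinearIndependent ℝ V₀
  span_V : Submodule.span ℝ (Set.range V₀) = centreSubspace L₀ α
  indep_Z : LinearIndependent ℝ Z₀
  span_Z : Submodule.span ℝ (Set.range Z₀) = centreSubspace (L₀†) α
  dual : ∀ i j, ⟪Z₀ i, V₀ j⟫_ℝ = if i = j then 1 else 0

/-- The recursion for the matrices `A_n` and the rows `V^n = (V^n_1, …, V^n_m)` of elements of `H`,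
`|n| ≤ N`, starting from the bases `V₀`, `Z₀`. -/
structure CentreRecursion {m : ℕ} (N : ℕ) (L : (Fin M → ℕ) → D →ₗ[ℝ] H)
    (V₀ Z₀ : Fin m → H) (A : (Fin M → ℕ) → Matrix (Fin m) (Fin m) ℝ)
    (V : (Fin M → ℕ) → Fin m → H) : Prop where
  V_zero : V 0 = V₀
  V_mem : ∀ n ∈ multiIndices M N, ∀ j, V n j ∈ D
  A_zero : ∀ j, opApply (op L 0) (V₀ j) = ∑ i, A 0 i j • V₀ i
  A_eq : ∀ n ∈ multiIndices M N, n ≠ 0 → ∀ i j,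
    A n i j = ∑ k ∈ (Finset.Iic n).erase 0, ⟪Z₀ i, opApply (op L k) (V (n - k) j)⟫_ℝ
  V_eq : ∀ n ∈ multiIndices M N, n ≠ 0 → ∀ j,
    opApply (op L 0) (V n j) - ∑ i, A 0 i j • V n i =
      - ∑ k ∈ (Finset.Iic n).erase 0, opApply (op L k) (V (n - k) j)
      + ∑ k ∈ (Finset.Iic n).erase 0, ∑ i, A k i j • V (n - k) i
  V_orth : ∀ n ∈ multiIndices M N, n ≠ 0 → ∀ i j, ⟪Z₀ i, V n j⟫_ℝ = 0

open Classical in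
/-- The column `j` of the multinomial `∑_{k ≤ n} V^{n-k} ξ^k / k!`. -/
def centreVector {m : ℕ} (N : ℕ) (V : (Fin M → ℕ) → Fin m → H) (n : Fin M → ℕ) (j : Fin m) :
    Jet M N H :=
  fun k => if k.1 ≤ n then V (n - k.1) j else 0

/-- The multinomial centre subspace, spanned by the vectors `centreVector N V n j`. -/
def jetCentreSubspace {m : ℕ} (N : ℕ) (V : (Fin M → ℕ) → Fin m → H) :
    Submodule ℝ (Jet M N H) :=
  Submodule.span ℝ (Set.range fun q : multiIndices M N × Fin m => centreVector N V q.1.1 q.2)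

/-- The linear combination of the centre vectors with coefficients `c n ∈ ℝ^m`. -/
def centreCombination {m : ℕ} (N : ℕ) (V : (Fin M → ℕ) → Fin m → H)
    (c : multiIndices M N → Fin m → ℝ) : Jet M N H :=
  ∑ n : multiIndices M N, ∑ j, c n j • centreVector N V n.1 j

/-- `u` is a classical solution, on the open set `Ω ⊆ ℝ^M` and for times `t > t₀`, of the equation
`∂_t u = ∑_{|k| ≤ K} L_k ∂_x^k u`; `u` is of class `C^p` into the domain `D` of `L_0`,
that is, `u` and `L_0 u` are of class `C^p`. -/
structure IsSolution (K p : ℕ) (L : (Fin M → ℕ) → D →ₗ[ℝ] H)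
    (Ω : Set (EuclideanSpace ℝ (Fin M))) (t₀ : ℝ)
    (u : EuclideanSpace ℝ (Fin M) → ℝ → H) : Prop where
  mem : ∀ x ∈ Ω, ∀ t, t₀ < t → u x t ∈ D
  smooth : ContDiffOn ℝ p (fun q : EuclideanSpace ℝ (Fin M) × ℝ => u q.1 q.2)
    (Ω ×ˢ Set.Ioi t₀)
  smooth_op : ContDiffOn ℝ p
    (fun q : EuclideanSpace ℝ (Fin M) × ℝ => opApply (op L 0) (u q.1 q.2)) (Ω ×ˢ Set.Ioi t₀)
  pde : ∀ x ∈ Ω, ∀ t, t₀ < t → deriv (fun s => u x s) t =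
    ∑ k ∈ multiIndices M K, opApply (op L k) (mixedDeriv k (fun x' => u x' t) x)

/-- The macroscale field `⟨Z₀, u⟩`. -/
def macroField {m : ℕ} (Z₀ : Fin m → H) (u : EuclideanSpace ℝ (Fin M) → ℝ → H)
    (x : EuclideanSpace ℝ (Fin M)) (t : ℝ) : Fin m → ℝ :=
  fun i => ⟪Z₀ i, u x t⟫_ℝ

open Classical in
/-- The coupling `r̃[u]` at the station `X` and time `t`: the multinomial with coefficients
`r_n = ∑_{|k| ≥ 1} ∑_{|l| = N, l < n + k} (n + k choose l) L_k [∂_x^{n+k-l} u^{(l)}(X, x, t)]`,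
evaluated at `x = X`, where `u^{(l)}` is the Taylor coefficient in integral form. -/
def coupling (K N : ℕ) (L : (Fin M → ℕ) → D →ₗ[ℝ] H)
    (u : EuclideanSpace ℝ (Fin M) → ℝ → H) (X : EuclideanSpace ℝ (Fin M)) (t : ℝ) :
    Jet M N H :=
  fun n => ∑ k ∈ (multiIndices M K).erase 0,
    ∑ l ∈ (multiIndices M N).filter (fun l => order l = N ∧ l < n.1 + k),
      opApply (op L k) ((multiChoose (n.1 + k) l : ℝ) •
        mixedDeriv (n.1 + k - l) (taylorCoeff N l (fun x' => u x' t) X) X)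

/-- The history convolution `(S ⋆ r)(t) = ∫₀ᵗ S (t - τ) r(τ) dτ`. -/
def convolution {E : Type*} [NormedAddCommGroup E] [NormedSpace ℝ E]
    (S : ℝ → E →L[ℝ] E) (r : ℝ → E) (t : ℝ) : E :=
  ∫ τ in (0 : ℝ)..t, S (t - τ) (r τ)

/-- The closure remainder
`ρ = ⟨Z, 𝒱 r_c⟩ + ⟨Z, 𝒲 B (e^{Bt} ⋆ r_s)⟩ + ⟨Z, 𝒲 r_s⟩ - ∑_{|n| ≤ N} A_n ⟨Z, ∂_ξ^n 𝒲 (e^{Bt} ⋆ r_s)⟩`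
at `ξ = 0`. Here `𝒲` is the inclusion of the stable subspace, `B` the restriction to it of
`jetOperator N L`, and `e^{Bt}` that of the semigroup `S t`. -/
def closureRemainder {m : ℕ} (N : ℕ) (L : (Fin M → ℕ) → D →ₗ[ℝ] H)
    (S : ℝ → Jet M N H →L[ℝ] Jet M N H) (Z₀ : Fin m → H)
    (A : (Fin M → ℕ) → Matrix (Fin m) (Fin m) ℝ) (V : (Fin M → ℕ) → Fin m → H)
    (rc : ℝ → multiIndices M N → Fin m → ℝ) (rs : ℝ → Jet M N H) (t : ℝ) : Fin m → ℝ :=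
  (fun i => ⟪Z₀ i, centreCombination N V (rc t) (jetZero M N)⟫_ℝ)
  + (fun i => ⟪Z₀ i, opApply (jetOperator N L) (convolution S rs t) (jetZero M N)⟫_ℝ)
  + (fun i => ⟪Z₀ i, rs t (jetZero M N)⟫_ℝ)
  - ∑ n : multiIndices M N, A n.1 *ᵥ (fun i => ⟪Z₀ i, convolution S rs t n⟫_ℝ)

end System

end SlowlyVarying

end

/-! On multinomials the operator `jetOperator N L` is block triangular for the degree: every
diagonal block is L_0, and the terms L_k ∂_ξ^k with k ≠ 0 lower the degree. Hence its semigroup is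
triangular with diagonal e^{L_0 t} (`GeneratesSemigroup.isTriangular`), the leading coefficient of a
generalised eigenvector is one of L_0 for the same eigenvalue, and powers of a triangular operator
grow like those of its diagonal, up to an arbitrarily small loss in the rate
(`IsTriangular.exists_norm_pow_le`). If all L_k with k ≠ 0 are bounded, the semigroup is a
Dyson–Phillips series that stops because degrees run out.

The recursion says L̃𝒱 = 𝒱𝒜, where 𝒜 = ∑ A_n ∂_ξ^n acts on multinomials with coefficients in ℝ^m
(`CentreRecursion.opApply_centreMap`); its normalisation makes the coefficientwise product with Z⁰ a
left inverse of 𝒱. It is solvable because A_n is precisely what makes the right-hand side G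
orthogonal to Z⁰, that is, stable for L_0 (`CentreBases.mem_stableSubspace_iff`). On the stable
subspace e^{L_0 t} decays faster than e^{-A_0 t} can grow, so V = -∫_0^∞ e^{L_0 t} G e^{-A_0 t} dt
converges and solves the Sylvester equation (`exists_sylvester`).

The range of 𝒱 is invariant; an invariant complement is found without spectral calculus, from the
time-one map S = e^{L̃}. With G = e^𝒜 and P₀ = ⟨Z⁰, ·⟩, the map W = (1 - 𝒱P₀)S is triangular, and
its diagonal decays at the stable rate of L_0, while G⁻¹ is triangular with diagonal e^{-A_0}, whose
powers grow at most at a rate close to α. So the limit of G⁻ⁿP₀Sⁿ exists as a telescoping series,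
intertwines S with G and is a left inverse of 𝒱 (`exists_invariant_projection`). Its kernel is
exactly the decaying subspace (`CentreBases.exists_jet_projection`), which gives closedness, the
uniform rate and the direct sum.

For the closure, the Taylor multinomial g of a solution at a station satisfies g' = L̃g + r̃
exactly: the spatial derivatives of order above N occurring in the equation are the coupling, once
the Taylor integrals are evaluated by a Beta integral and the Vandermonde identity
(`IsSolution.coupling_apply`). Derivatives commute with the unbounded L_k because (u, L_0 u) takes
values in the closed graph of L_0, on which each L_k is bounded. The projection Q = 1 - 𝒱P onto the
stable subspace commutes with the semigroup, so variation of constants gives Qg(t) = e^{L̃t}Qg(0) +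
(e^{𝓑t} ⋆ r̃_s)(t). Taking ⟨Z⁰, ·⟩, the centre part of g cancels against ∑ A_n ∂^n U, the
convolution yields ρ, and the transient e^{L̃t}Qg(0) is the only error (`closure_error_eq`). -/

noncomputable section

namespace SlowlyVarying

/-! ### Strongly continuous semigroups and their generators -/

section Semigroups

open MeasureTheory Set

variable {E F : Type*} [NormedAddCommGroup E] [NormedSpace ℝ E]
  [NormedAddCommGroup F] [NormedSpace ℝ F]

/-- Strong continuity on `[0, ∞)` of a family of bounded operators. -/
def StronglyContinuous (R : ℝ → E →L[ℝ] F) : Prop :=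
  ∀ x : E, ContinuousOn (fun t => R t x) (Ici 0)

theorem StronglyContinuous.exists_bound [CompleteSpace E] {R : ℝ → E →L[ℝ] F}
    (hR : StronglyContinuous R) (b : ℝ) : ∃ C : ℝ, 0 ≤ C ∧ ∀ t ∈ Icc 0 b, ‖R t‖ ≤ C := by
  obtain ⟨C, hC⟩ := banach_steinhaus (g := fun t : Icc (0 : ℝ) b => R t) (fun x => by
    obtain ⟨C, hC⟩ := isCompact_Icc.exists_bound_of_continuousOn
      ((hR x).mono (fun t (ht : t ∈ Icc 0 b) => ht.1))
    exact ⟨C, fun t => hC t t.2⟩)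
  exact ⟨max C 0, le_max_right _ _, fun t ht => (hC ⟨t, ht⟩).trans (le_max_left _ _)⟩

/-- Norms are bounded locally uniformly in time by Banach–Steinhaus, which upgrades strong to joint
continuity. -/
theorem StronglyContinuous.continuousOn_prod [CompleteSpace E] {R : ℝ → E →L[ℝ] F}
    (hR : StronglyContinuous R) : ContinuousOn (fun p : ℝ × E => R p.1 p.2) (Ici 0 ×ˢ univ) := by
  rintro ⟨t₀, x₀⟩ ⟨ht₀, -⟩
  obtain ⟨C, hC0, hC⟩ := hR.exists_bound (t₀ + 1)
  have h1 : Tendsto (fun p : ℝ × E => R p.1 x₀) (𝓝[Ici 0 ×ˢ univ] (t₀, x₀)) (𝓝 (R t₀ x₀)) := by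
    refine (hR x₀ t₀ ht₀).tendsto.comp ?_
    refine tendsto_nhdsWithin_iff.2 ⟨?_, ?_⟩
    · exact (continuous_fst.tendsto (t₀, x₀)).mono_left nhdsWithin_le_nhds
    · filter_upwards [self_mem_nhdsWithin] with p hp using hp.1
  have h2 : Tendsto (fun p : ℝ × E => R p.1 (p.2 - x₀)) (𝓝[Ici 0 ×ˢ univ] (t₀, x₀)) (𝓝 0) := by
    have h3 : Tendsto (fun p : ℝ × E => C * ‖p.2 - x₀‖) (𝓝[Ici 0 ×ˢ univ] (t₀, x₀)) (𝓝 0) := by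
      have : Continuous (fun p : ℝ × E => C * ‖p.2 - x₀‖) := by fun_prop
      have := (this.tendsto (t₀, x₀)).mono_left (nhdsWithin_le_nhds (s := Ici 0 ×ˢ univ))
      simpa using this
    refine squeeze_zero_norm' ?_ h3
    have h4 : ∀ᶠ p : ℝ × E in 𝓝[Ici 0 ×ˢ univ] (t₀, x₀), p.1 < t₀ + 1 :=
      nhdsWithin_le_nhds ((continuous_fst.tendsto (t₀, x₀)).eventually_lt_const (by simp))
    filter_upwards [self_mem_nhdsWithin, h4] with p hp hp'
    exact ((R p.1).le_opNorm _).trans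
      (mul_le_mul_of_nonneg_right (hC _ ⟨hp.1, hp'.le⟩) (norm_nonneg _))
  have := h2.add h1
  simpa [ContinuousWithinAt] using this

theorem StronglyContinuous.comp [CompleteSpace E] {R : ℝ → E →L[ℝ] F}
    (hR : StronglyContinuous R) {X : Type*} [TopologicalSpace X] {s : Set X} {a : X → ℝ} {g : X → E}
    (ha : ContinuousOn a s) (ha0 : ∀ x ∈ s, 0 ≤ a x) (hg : ContinuousOn g s) :
    ContinuousOn (fun x => R (a x) (g x)) s :=
  hR.continuousOn_prod.comp (ha.prodMk hg) (fun x hx => ⟨ha0 x hx, mem_univ _⟩)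

theorem hasDerivWithinAt_Ioi_iff_tendsto {f : ℝ → E} {f' : E} {t : ℝ} :
    HasDerivWithinAt f f' (Ioi t) t ↔
      Tendsto (fun h : ℝ => h⁻¹ • (f (t + h) - f t)) (𝓝[>] 0) (𝓝 f') := by
  rw [hasDerivWithinAt_iff_tendsto_slope' (by simp)]
  have : 𝓝[>] t = map (fun h => t + h) (𝓝[>] 0) := by simp
  rw [this, tendsto_map'_iff]
  refine tendsto_congr fun h => ?_
  simp [slope_def_module]

/-- The integrand may depend on the length h of the interval. This is needed for the Duhamel and
Sylvester integrals, where h also enters through T (h - s) or exp (h a). -/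
theorem tendsto_average [CompleteSpace E] {f : ℝ → ℝ → E}
    (hf : ContinuousOn (fun p : ℝ × ℝ => f p.1 p.2) {p | 0 ≤ p.2 ∧ p.2 ≤ p.1}) :
    Tendsto (fun h : ℝ => h⁻¹ • ∫ t in (0 : ℝ)..h, f h t) (𝓝[>] 0) (𝓝 (f 0 0)) := by
  rw [Metric.tendsto_nhds]
  intro ε hε
  obtain ⟨δ, hδ, hδε⟩ := Metric.continuousWithinAt_iff.1
    (hf (0, 0) ⟨le_rfl, le_rfl⟩) (ε / 2) (half_pos hε)
  filter_upwards [Ioo_mem_nhdsGT hδ] with h hh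
  have hcont : ContinuousOn (fun t => f h t) (Icc 0 h) :=
    hf.comp (f := fun t : ℝ => (h, t)) (by fun_prop) (fun t ht => ht)
  have hint : IntervalIntegrable (fun t => f h t) volume 0 h :=
    (hcont.mono (by rw [uIcc_of_le hh.1.le])).intervalIntegrable
  have h1 : ‖∫ t in (0 : ℝ)..h, (f h t - f 0 0)‖ ≤ ε / 2 * |h - 0| := by
    refine intervalIntegral.norm_integral_le_of_norm_le_const fun t ht => ?_
    rw [uIoc_of_le hh.1.le] at ht
    rw [← dist_eq_norm]
    refine (hδε (x := (h, t)) ⟨ht.1.le, ht.2⟩ ?_).le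
    rw [Prod.dist_eq]
    simp only [Real.dist_eq, sub_zero]
    rw [abs_of_pos hh.1, abs_of_pos ht.1]
    exact max_lt hh.2 (ht.2.trans_lt hh.2)
  rw [intervalIntegral.integral_sub hint (by simp)] at h1
  simp only [intervalIntegral.integral_const, sub_zero, abs_of_pos hh.1] at h1
  have h2 : h⁻¹ • (∫ t in (0 : ℝ)..h, f h t) - f 0 0
      = h⁻¹ • ((∫ t in (0 : ℝ)..h, f h t) - h • f 0 0) := by
    rw [smul_sub, smul_smul, inv_mul_cancel₀ hh.1.ne', one_smul]
  rw [dist_eq_norm, h2, norm_smul, norm_inv, Real.norm_eq_abs, abs_of_pos hh.1]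
  calc h⁻¹ * _ ≤ h⁻¹ * (ε / 2 * h) := by gcongr; exact inv_nonneg.2 hh.1.le
    _ = ε / 2 := by field_simp [hh.1.ne']
    _ < ε := half_lt_self hε

variable {A : E →ₗ.[ℝ] E} {S : ℝ → E →L[ℝ] E}

theorem opApply_of_mem {A : E →ₗ.[ℝ] F} {x : E} (hx : x ∈ A.domain) :
    opApply A x = A ⟨x, hx⟩ := by
  simp [opApply, hx]

theorem mk_opApply_mem_graph {A : E →ₗ.[ℝ] F} {x : E} (hx : x ∈ A.domain) :
    (x, opApply A x) ∈ A.graph := by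
  rw [opApply_of_mem hx]
  exact A.mem_graph ⟨x, hx⟩

theorem opApply_eq_of_mem_graph {A : E →ₗ.[ℝ] F} {x : E} {y : F} (h : (x, y) ∈ A.graph) :
    x ∈ A.domain ∧ opApply A x = y := by
  have hx : x ∈ A.domain := A.mem_domain_of_mem_graph h
  exact ⟨hx, A.mem_graph_snd_inj (mk_opApply_mem_graph hx) h rfl⟩

theorem GeneratesSemigroup.stronglyContinuous (h : GeneratesSemigroup A S) :
    StronglyContinuous S := h.continuous

theorem GeneratesSemigroup.map_graph (h : GeneratesSemigroup A S) {x y : E}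
    (hxy : (x, y) ∈ A.graph) {t : ℝ} (ht : 0 ≤ t) : (S t x, S t y) ∈ A.graph := by
  rw [h.generator] at hxy ⊢
  refine (((S t).continuous.tendsto y).comp hxy).congr' ?_
  filter_upwards [self_mem_nhdsWithin] with s hs
  have e1 := DFunLike.congr_fun (h.add s t (le_of_lt hs) ht) x
  have e2 := DFunLike.congr_fun (h.add t s ht (le_of_lt hs)) x
  rw [add_comm t s, e1] at e2
  simp only [ContinuousLinearMap.comp_apply] at e2
  simp [e2]

theorem GeneratesSemigroup.hasDerivWithinAt (h : GeneratesSemigroup A S) {x y : E}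
    (hxy : (x, y) ∈ A.graph) {t : ℝ} (ht : 0 ≤ t) :
    HasDerivWithinAt (fun t => S t x) (S t y) (Ioi t) t := by
  rw [hasDerivWithinAt_Ioi_iff_tendsto]
  refine (((S t).continuous.tendsto y).comp ((h.generator x y).1 hxy)).congr' ?_
  filter_upwards [self_mem_nhdsWithin] with s hs
  simp [h.add t s ht (le_of_lt hs)]

theorem GeneratesSemigroup.integral_eq_sub [CompleteSpace E] (h : GeneratesSemigroup A S) {x y : E}
    (hxy : (x, y) ∈ A.graph) {t : ℝ} (ht : 0 ≤ t) :
    ∫ s in (0 : ℝ)..t, S s y = S t x - x := by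
  have := intervalIntegral.integral_eq_sub_of_hasDeriv_right_of_le ht
    ((h.continuous x).mono (fun s (hs : s ∈ Icc 0 t) => hs.1))
    (fun s hs => h.hasDerivWithinAt hxy hs.1.le)
    (((h.continuous y).mono (by rw [uIcc_of_le ht]; exact fun s hs => hs.1)).intervalIntegrable)
  rw [this, h.zero]
  rfl

theorem GeneratesSemigroup.tendsto_integral [CompleteSpace E] (h : GeneratesSemigroup A S) (x : E) :
    Tendsto (fun t : ℝ => t⁻¹ • ∫ s in (0 : ℝ)..t, S s x) (𝓝[>] 0) (𝓝 x) := by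
  have := tendsto_average (f := fun _ s => S s x)
    ((h.continuous x).comp continuousOn_snd (fun p hp => hp.1))
  simpa [h.zero] using this

/-- The integrated identity ∫_0^t S s y ds = S t x - x passes to limits of graph elements; dividing
by t and letting t → 0 recovers membership in the graph. -/
theorem GeneratesSemigroup.isClosed_graph [CompleteSpace E] (h : GeneratesSemigroup A S) :
    IsClosed (A.graph : Set (E × E)) := by
  refine isSeqClosed_iff_isClosed.1 fun p q hp hq => ?_
  obtain ⟨x, y⟩ := q
  have hx : Tendsto (fun n => (p n).1) atTop (𝓝 x) := (continuous_fst.tendsto _).comp hq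
  have hy : Tendsto (fun n => (p n).2) atTop (𝓝 y) := (continuous_snd.tendsto _).comp hq
  refine (h.generator x y).2 ?_
  refine (h.tendsto_integral y).congr' ?_
  filter_upwards [self_mem_nhdsWithin] with t ht
  have ht : 0 ≤ t := le_of_lt ht
  congr 1
  obtain ⟨C, hC0, hC⟩ := h.stronglyContinuous.exists_bound t
  have h1 : Tendsto (fun n => ∫ s in (0 : ℝ)..t, S s (p n).2) atTop
      (𝓝 (∫ s in (0 : ℝ)..t, S s y)) := by
    rw [tendsto_iff_norm_sub_tendsto_zero]
    have h2 : Tendsto (fun n => C * ‖(p n).2 - y‖ * |t - 0|) atTop (𝓝 0) := by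
      have := ((tendsto_iff_norm_sub_tendsto_zero.1 hy).const_mul C).mul_const |t - 0|
      simpa using this
    refine squeeze_zero (fun _ => norm_nonneg _) (fun n => ?_) h2
    have hint : ∀ z, IntervalIntegrable (fun s => S s z) volume 0 t := fun z =>
      ((h.continuous z).mono (by rw [uIcc_of_le ht]; exact fun s hs => hs.1)).intervalIntegrable
    rw [← intervalIntegral.integral_sub (hint _) (hint _)]
    refine intervalIntegral.norm_integral_le_of_norm_le_const fun s hs => ?_
    rw [uIoc_of_le ht] at hs
    rw [← map_sub]
    exact ((S s).le_opNorm _).trans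
      (mul_le_mul_of_nonneg_right (hC s ⟨hs.1.le, hs.2⟩) (norm_nonneg _))
  have h3 : Tendsto (fun n => S t (p n).1 - (p n).1) atTop (𝓝 (S t x - x)) :=
    (((S t).continuous.tendsto x).comp hx).sub hx
  refine tendsto_nhds_unique (h1.congr fun n => ?_) h3
  exact h.integral_eq_sub (hp n) ht

/-- By cancelling overlapping integrals, (S s - 1) ∫_0^t S r x dr = (S t - 1) ∫_0^s S r x dr, and
the right-hand side divided by s converges. -/
theorem GeneratesSemigroup.integral_mem_domain [CompleteSpace E] (h : GeneratesSemigroup A S)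
    (x : E) {t : ℝ} (ht : 0 ≤ t) : ∫ s in (0 : ℝ)..t, S s x ∈ A.domain := by
  refine A.mem_domain_of_mem_graph (y := S t x - x) ((h.generator _ _).2 ?_)
  have hint : ∀ a b : ℝ, 0 ≤ a → 0 ≤ b → IntervalIntegrable (fun s => S s x) volume a b :=
    fun a b ha hb => ((h.continuous x).mono fun s hs =>
      (le_min ha hb).trans hs.1).intervalIntegrable
  have h1 : Tendsto (fun s : ℝ => (S t - 1 : E →L[ℝ] E) (s⁻¹ • ∫ r in (0 : ℝ)..s, S r x)) (𝓝[>] 0)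
      (𝓝 ((S t - 1 : E →L[ℝ] E) x)) :=
    ((S t - 1 : E →L[ℝ] E).continuous.tendsto x).comp (h.tendsto_integral x)
  refine h1.congr' ?_
  filter_upwards [self_mem_nhdsWithin] with s hs
  have hs : 0 ≤ s := le_of_lt hs
  have key : ∀ a b : ℝ, 0 ≤ a → 0 ≤ b →
      S a (∫ r in (0 : ℝ)..b, S r x) = ∫ r in a..(a + b), S r x := by
    intro a b ha hb
    rw [← ContinuousLinearMap.intervalIntegral_comp_comm _ (hint _ _ le_rfl hb)]
    have : ∫ r in a..(a + b), S r x = ∫ r in (0 : ℝ)..b, S (a + r) x := by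
      rw [intervalIntegral.integral_comp_add_left (fun r => S r x) a]; simp
    rw [this]
    refine intervalIntegral.integral_congr fun r hr => ?_
    rw [uIcc_of_le hb] at hr
    simp [h.add a r ha hr.1]
  rw [map_smul]
  congr 1
  rw [sub_apply, key t s ht hs, key s t hs ht, one_apply_eq_self]
  have e1 := intervalIntegral.integral_add_adjacent_intervals (hint 0 t le_rfl ht)
    (hint t (t + s) ht (by positivity))
  have e2 := intervalIntegral.integral_add_adjacent_intervals (hint 0 s le_rfl hs)
    (hint s (s + t) hs (by positivity))
  rw [add_comm s t] at e2 ⊢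
  have e3 := e1.trans e2.symm
  rw [sub_eq_sub_iff_add_eq_add, add_comm, e3, add_comm]

theorem GeneratesSemigroup.dense_domain [CompleteSpace E] (h : GeneratesSemigroup A S) :
    Dense (A.domain : Set E) := by
  intro x
  refine mem_closure_of_tendsto (h.tendsto_integral x) ?_
  filter_upwards [self_mem_nhdsWithin] with t ht
  exact A.domain.smul_mem _ (h.integral_mem_domain x (le_of_lt ht))

/-- The function τ ↦ S (b - τ) (g τ) has right derivative S (b - τ) (r τ), because the generator
terms cancel. Right derivatives suffice, and they are what the one-sided definition of the generator
provides. -/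
theorem GeneratesSemigroup.variation_of_constants [CompleteSpace E] (h : GeneratesSemigroup A S)
    {b : ℝ} (hb : 0 ≤ b) {g g' r : ℝ → E} (hg : ContinuousOn g (Icc 0 b))
    (hr : ContinuousOn r (Icc 0 b))
    (hd : ∀ τ ∈ Ioo 0 b, HasDerivWithinAt g (g' τ) (Ioi τ) τ)
    (hA : ∀ τ ∈ Ioo 0 b, (g τ, g' τ - r τ) ∈ A.graph) :
    g b = S b (g 0) + ∫ τ in (0 : ℝ)..b, S (b - τ) (r τ) := by
  have hc : ContinuousOn (fun τ => S (b - τ) (g τ)) (Icc 0 b) :=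
    h.stronglyContinuous.comp (by fun_prop) (fun τ hτ => sub_nonneg.2 hτ.2) hg
  have hc' : ContinuousOn (fun τ => S (b - τ) (r τ)) (Icc 0 b) :=
    h.stronglyContinuous.comp (by fun_prop) (fun τ hτ => sub_nonneg.2 hτ.2) hr
  have := intervalIntegral.integral_eq_sub_of_hasDeriv_right_of_le hb hc
    (f' := fun τ => S (b - τ) (r τ)) ?_
    ((hc'.mono (by rw [uIcc_of_le hb])).intervalIntegrable)
  · rw [this]; simp [h.zero]
  intro τ hτ
  rw [hasDerivWithinAt_Ioi_iff_tendsto]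
  have h1 := hasDerivWithinAt_Ioi_iff_tendsto.1 (hd τ hτ)
  have h2 := (h.generator _ _).1 (hA τ hτ)
  have h3 := h1.sub h2
  rw [sub_sub_cancel] at h3
  have h4 : Tendsto (fun s : ℝ => (b - (τ + s), s⁻¹ • (g (τ + s) - g τ) - s⁻¹ • (S s (g τ) - g τ)))
      (𝓝[>] 0) (𝓝[Ici 0 ×ˢ univ] (b - τ, r τ)) := by
    refine tendsto_nhdsWithin_iff.2 ⟨?_, ?_⟩
    · refine Tendsto.prodMk_nhds ?_ h3
      have : Continuous fun s : ℝ => b - (τ + s) := by fun_prop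
      simpa using (this.tendsto 0).mono_left (nhdsWithin_le_nhds (s := Ioi 0))
    · filter_upwards [Ioo_mem_nhdsGT (sub_pos.2 hτ.2)] with s hs
      refine ⟨?_, mem_univ _⟩
      simp only [mem_Ici]
      linarith [hs.2]
  have h5 := (h.stronglyContinuous.continuousOn_prod (b - τ, r τ)
    ⟨sub_nonneg.2 hτ.2.le, mem_univ _⟩).tendsto.comp h4
  refine h5.congr' ?_
  filter_upwards [Ioo_mem_nhdsGT (sub_pos.2 hτ.2)] with s hs
  -- Through this factorisation the difference quotient is one semigroup operator applied to the
  -- difference of two quotients, with limits g' and g' - r; joint continuity then finishes.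
  have e : S (b - τ) (g τ) = S (b - (τ + s)) (S s (g τ)) := by
    have := h.add (b - (τ + s)) s (by linarith [hs.2]) hs.1.le
    rw [show b - (τ + s) + s = b - τ by ring] at this
    rw [this]; rfl
  simp only [Function.comp_apply]
  rw [e, ← smul_sub, map_smul, map_sub, map_sub, map_sub]
  congr 1
  abel

theorem GeneratesSemigroup.eq_of_hasDerivWithinAt [CompleteSpace E] (h : GeneratesSemigroup A S)
    {b : ℝ} (hb : 0 ≤ b) {g g' : ℝ → E} (hg : ContinuousOn g (Icc 0 b))
    (hd : ∀ τ ∈ Ioo 0 b, HasDerivWithinAt g (g' τ) (Ioi τ) τ)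
    (hA : ∀ τ ∈ Ioo 0 b, (g τ, g' τ) ∈ A.graph) : g b = S b (g 0) := by
  have := h.variation_of_constants hb (r := fun _ => 0) hg continuousOn_const hd
    (by simpa using hA)
  simpa using this

end Semigroups

/-! ### Operators on multinomials that are triangular for the degree -/

section Triangular

variable {M N : ℕ} {H H' H'' : Type*} [NormedAddCommGroup H] [NormedSpace ℝ H]
  [NormedAddCommGroup H'] [NormedSpace ℝ H'] [NormedAddCommGroup H''] [NormedSpace ℝ H'']

theorem order_le_of_mem {n : Fin M → ℕ} (hn : n ∈ multiIndices M N) : order n ≤ N :=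
  (Finset.mem_filter.1 hn).2

theorem mem_multiIndices {n : Fin M → ℕ} : n ∈ multiIndices M N ↔ order n ≤ N := by
  refine ⟨order_le_of_mem, fun h => Finset.mem_filter.2 ⟨Finset.mem_Iic.2 fun i => ?_, h⟩⟩
  exact (Finset.single_le_sum (f := n) (fun _ _ => Nat.zero_le _) (Finset.mem_univ i)).trans h

theorem order_add (n k : Fin M → ℕ) : order (n + k) = order n + order k := by
  simp [order, Finset.sum_add_distrib]

theorem order_eq_zero {n : Fin M → ℕ} : order n = 0 ↔ n = 0 := by
  simp [order, funext_iff]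

/-- All coefficients of `f` of order at least `j` vanish. -/
def VanishesFrom (j : ℕ) (f : Jet M N H) : Prop := ∀ k, j ≤ order k.1 → f k = 0

/-- An operator between spaces of multinomials that does not raise the degree and acts on the
coefficients of highest order by `X`. -/
def IsTriangular (W : Jet M N H →L[ℝ] Jet M N H') (X : H →L[ℝ] H') : Prop :=
  ∀ (f : Jet M N H) (n : multiIndices M N), VanishesFrom (order n.1 + 1) f → W f n = X (f n)

theorem IsTriangular.vanishesFrom {W : Jet M N H →L[ℝ] Jet M N H'} {X : H →L[ℝ] H'}
    (h : IsTriangular W X) {j : ℕ} {f : Jet M N H} (hf : VanishesFrom j f) :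
    VanishesFrom j (W f) := by
  intro k hk
  rw [h f k (fun l hl => hf l (by omega)), hf k hk, map_zero]

theorem IsTriangular.comp {W : Jet M N H →L[ℝ] Jet M N H'} {X : H →L[ℝ] H'}
    {W' : Jet M N H' →L[ℝ] Jet M N H''} {X' : H' →L[ℝ] H''}
    (h : IsTriangular W X) (h' : IsTriangular W' X') :
    IsTriangular (W'.comp W) (X'.comp X) := by
  intro f n hf
  rw [ContinuousLinearMap.comp_apply, h' _ n (h.vanishesFrom hf), h f n hf]
  rfl

theorem IsTriangular.one : IsTriangular (1 : Jet M N H →L[ℝ] Jet M N H) 1 := fun _ _ _ => rfl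

theorem IsTriangular.pow {W : Jet M N H →L[ℝ] Jet M N H} {X : H →L[ℝ] H}
    (h : IsTriangular W X) (i : ℕ) : IsTriangular (W ^ i) (X ^ i) := by
  induction i with
  | zero => exact IsTriangular.one
  | succ i ih => rw [pow_succ, pow_succ]; exact h.comp ih

theorem IsTriangular.sub {W W' : Jet M N H →L[ℝ] Jet M N H'} {X X' : H →L[ℝ] H'}
    (h : IsTriangular W X) (h' : IsTriangular W' X') : IsTriangular (W - W') (X - X') := by
  intro f n hf
  simp [h f n hf, h' f n hf]

theorem IsTriangular.neg {W : Jet M N H →L[ℝ] Jet M N H'} {X : H →L[ℝ] H'}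
    (h : IsTriangular W X) : IsTriangular (-W) (-X) := by
  intro f n hf
  simp [h f n hf]

theorem IsTriangular.exp [CompleteSpace H] {W : Jet M N H →L[ℝ] Jet M N H} {X : H →L[ℝ] H}
    (h : IsTriangular W X) : IsTriangular (NormedSpace.exp W) (NormedSpace.exp X) := by
  intro f n hf
  have h1 := NormedSpace.exp_series_hasSum_exp' (𝕂 := ℝ) W
  have h2 := NormedSpace.exp_series_hasSum_exp' (𝕂 := ℝ) X
  have h3 := h1.mapL (((ContinuousLinearMap.proj (R := ℝ) (φ := fun _ : multiIndices M N => H) n)).comp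
    (ContinuousLinearMap.apply ℝ (Jet M N H) f))
  have h4 := h2.mapL (ContinuousLinearMap.apply ℝ H (f n))
  refine h3.unique ?_
  convert h4 using 1
  · funext i
    exact congrArg (fun z => ((i.factorial : ℝ))⁻¹ • z) (h.pow i f n hf)
  · rfl

/-- The coefficientwise action of an operator. -/
def diagonal (M N : ℕ) (X : H →L[ℝ] H') : Jet M N H →L[ℝ] Jet M N H' :=
  ContinuousLinearMap.pi fun k => X.comp (ContinuousLinearMap.proj k)

@[simp] theorem diagonal_apply (X : H →L[ℝ] H') (f : Jet M N H) (k : multiIndices M N) :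
    diagonal M N X f k = X (f k) := rfl

theorem isTriangular_diagonal (X : H →L[ℝ] H') : IsTriangular (diagonal M N X) X :=
  fun _ _ _ => rfl

theorem diagonal_pow_apply (X : H →L[ℝ] H) (i : ℕ) (f : Jet M N H) (k : multiIndices M N) :
    (diagonal M N X ^ i) f k = (X ^ i) (f k) := by
  induction i generalizing f with
  | zero => rfl
  | succ i ih => rw [pow_succ, pow_succ]; simp [ih]

/-- Noncommutative telescoping; it serves as a discrete Duhamel formula. -/
theorem pow_sub_pow_eq_sum {R : Type*} [Ring R] (a b : R) (n : ℕ) :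
    a ^ n - b ^ n = ∑ i ∈ Finset.range n, a ^ (n - 1 - i) * ((a - b) * b ^ i) := by
  induction n with
  | zero => simp
  | succ n ih =>
    rw [Finset.sum_range_succ]
    have : ∑ i ∈ Finset.range n, a ^ (n + 1 - 1 - i) * ((a - b) * b ^ i)
        = a * (a ^ n - b ^ n) := by
      rw [ih, Finset.mul_sum]
      refine Finset.sum_congr rfl fun i hi => ?_
      have := Finset.mem_range.1 hi
      rw [← mul_assoc a, ← pow_succ', show n - 1 - i + 1 = n + 1 - 1 - i by omega]
    rw [this]
    simp [pow_succ', mul_sub, sub_mul]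

theorem exists_nat_mul_pow_le {q q' : ℝ} (hq : 0 < q) (hqq' : q < q') :
    ∃ C : ℝ, 0 ≤ C ∧ ∀ n : ℕ, n * q ^ (n - 1) ≤ C * q' ^ n := by
  have hq' : 0 < q' := hq.trans hqq'
  have h := tendsto_self_mul_const_pow_of_lt_one (r := q / q') (by positivity)
    ((div_lt_one hq').2 hqq')
  obtain ⟨C, hC⟩ := h.bddAbove_range
  refine ⟨max C 0 * q⁻¹, by positivity, fun n => ?_⟩
  rcases n with _ | n
  · simp; positivity
  have h1 : ((n + 1 : ℕ) : ℝ) * (q / q') ^ (n + 1) ≤ max C 0 :=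
    (hC ⟨n + 1, rfl⟩).trans (le_max_left _ _)
  rw [div_pow, mul_div_assoc', div_le_iff₀ (by positivity)] at h1
  calc ((n + 1 : ℕ) : ℝ) * q ^ (n + 1 - 1)
      = q⁻¹ * (((n + 1 : ℕ) : ℝ) * q ^ (n + 1)) := by
        rw [pow_succ q n]; simp; field_simp
    _ ≤ q⁻¹ * (max C 0 * q' ^ (n + 1)) := by gcongr
    _ = _ := by ring

/-- With D the diagonal part, Wⁿ = Dⁿ + ∑ W^{n-1-i} (W - D) Dⁱ, and W - D lowers the degree. By
induction on the degree the sum is of size n q₁^{n-1} for some q₁ < q', and the factor n is absorbed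
by passing from q₁ to q'. -/
theorem IsTriangular.exists_norm_pow_le {W : Jet M N H →L[ℝ] Jet M N H} {X : H →L[ℝ] H}
    (h : IsTriangular W X) {C q q' : ℝ} (hq : 0 < q) (hqq' : q < q')
    (hX : ∀ n : ℕ, ‖X ^ n‖ ≤ C * q ^ n) :
    ∃ C' : ℝ, 0 ≤ C' ∧ ∀ n : ℕ, ‖W ^ n‖ ≤ C' * q' ^ n := by
  have hC : 0 ≤ C := by simpa using (norm_nonneg _).trans (hX 0)
  have hdiag : ∀ (n : ℕ) (g : Jet M N H), ‖(diagonal M N X ^ n) g‖ ≤ C * q ^ n * ‖g‖ := by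
    intro n g
    refine (pi_norm_le_iff_of_nonneg (by positivity)).2 fun k => ?_
    rw [diagonal_pow_apply]
    exact ((X ^ n).le_opNorm _).trans
      (mul_le_mul (hX n) (norm_le_pi_norm g k) (norm_nonneg _) (by positivity))
  -- The rate stays quantified inside the induction, since every degree spends part of the gap
  -- between q and q'.
  have key : ∀ j : ℕ, ∀ q', q < q' → ∃ C' : ℝ, 0 ≤ C' ∧ ∀ (n : ℕ) (f : Jet M N H),
      VanishesFrom j f → ‖(W ^ n) f‖ ≤ C' * q' ^ n * ‖f‖ := by
    intro j
    induction j with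
    | zero =>
      intro q' hq'
      refine ⟨0, le_rfl, fun n f hf => ?_⟩
      have : f = 0 := funext fun k => hf k (Nat.zero_le _)
      simp [this]
    | succ j ih =>
      intro q' hq'
      obtain ⟨q₁, hq₁, hq₁'⟩ := exists_between hq'
      have hq₁0 : 0 < q₁ := hq.trans hq₁
      have hq'0 : 0 < q' := hq.trans hq'
      obtain ⟨C₁, hC₁, h₁⟩ := ih q₁ hq₁
      obtain ⟨C₂, hC₂, h₂⟩ := exists_nat_mul_pow_le hq₁0 hq₁'
      set B := ‖W - diagonal M N X‖
      refine ⟨C₁ + (C + C₁ * B * C * C₂), by positivity, fun n f hf => ?_⟩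
      -- The layer of top order j. The rest f - g has lower degree, as has (W - D) Dⁱ g, so the
      -- induction hypothesis applies to both.
      let g : Jet M N H := fun k => if order k.1 = j then f k else 0
      have hg : ‖g‖ ≤ ‖f‖ := (pi_norm_le_iff_of_nonneg (norm_nonneg _)).2 fun k => by
        by_cases hk : order k.1 = j <;> simp [g, hk, norm_le_pi_norm f k]
      have hfg' : ‖f - g‖ ≤ ‖f‖ := (pi_norm_le_iff_of_nonneg (norm_nonneg _)).2 fun k => by
        by_cases hk : order k.1 = j <;> simp [g, hk, norm_le_pi_norm f k]
      have hgj : VanishesFrom (j + 1) g := fun k hk => by simp [g, show order k.1 ≠ j by omega]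
      have hfg : VanishesFrom j (f - g) := fun k hk => by
        by_cases hk' : order k.1 = j
        · simp [g, hk']
        · simp [g, hk', hf k (by omega)]
      have hlow : ∀ i, VanishesFrom j ((W - diagonal M N X) ((diagonal M N X ^ i) g)) := by
        intro i k hk
        have h3 := (((isTriangular_diagonal X).pow i).comp (h.sub (isTriangular_diagonal X))) g k
          (fun l hl => hgj l (by omega))
        rw [ContinuousLinearMap.comp_apply] at h3
        rw [h3]
        simp
      have hsum : (W ^ n) g = (diagonal M N X ^ n) g + ∑ i ∈ Finset.range n,
          (W ^ (n - 1 - i)) ((W - diagonal M N X) ((diagonal M N X ^ i) g)) := by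
        have := congrArg (fun R : Jet M N H →L[ℝ] Jet M N H => R g)
          (pow_sub_pow_eq_sum W (diagonal M N X) n)
        simp only [sum_apply] at this
        rw [← sub_eq_iff_eq_add']
        exact this
      have hterm : ∀ i ∈ Finset.range n,
          ‖(W ^ (n - 1 - i)) ((W - diagonal M N X) ((diagonal M N X ^ i) g))‖
            ≤ C₁ * B * C * q₁ ^ (n - 1) * ‖f‖ := by
        intro i hi
        have hi := Finset.mem_range.1 hi
        calc _ ≤ C₁ * q₁ ^ (n - 1 - i) * ‖(W - diagonal M N X) ((diagonal M N X ^ i) g)‖ :=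
              h₁ _ _ (hlow i)
          _ ≤ C₁ * q₁ ^ (n - 1 - i) * (B * (C * q₁ ^ i * ‖f‖)) := by
              gcongr
              refine (ContinuousLinearMap.le_opNorm _ _).trans ?_
              gcongr
              refine (hdiag i g).trans ?_
              gcongr
          _ = C₁ * B * C * (q₁ ^ (n - 1 - i) * q₁ ^ i) * ‖f‖ := by ring
          _ = _ := by rw [← pow_add, show n - 1 - i + i = n - 1 by omega]
      have hW : (W ^ n) f = (W ^ n) (f - g) + (W ^ n) g := by rw [← map_add, sub_add_cancel]
      have hqn : q ^ n ≤ q' ^ n := by gcongr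
      have hqn1 : q₁ ^ n ≤ q' ^ n := by gcongr
      calc ‖(W ^ n) f‖ ≤ ‖(W ^ n) (f - g)‖ + (‖(diagonal M N X ^ n) g‖ + _) := by
            rw [hW, hsum]; exact (norm_add_le _ _).trans (by gcongr; exact norm_add_le _ _)
        _ ≤ C₁ * q₁ ^ n * ‖f - g‖ + (C * q ^ n * ‖g‖
              + ∑ i ∈ Finset.range n, C₁ * B * C * q₁ ^ (n - 1) * ‖f‖) := by
            gcongr
            · exact h₁ n _ hfg
            · exact hdiag n g
            · exact (norm_sum_le _ _).trans (Finset.sum_le_sum hterm)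
        _ ≤ C₁ * q' ^ n * ‖f‖ + (C * q' ^ n * ‖f‖ + C₁ * B * C * (C₂ * q' ^ n) * ‖f‖) := by
            gcongr
            rw [Finset.sum_const, Finset.card_range, nsmul_eq_mul]
            calc (n : ℝ) * (C₁ * B * C * q₁ ^ (n - 1) * ‖f‖)
                = C₁ * B * C * (n * q₁ ^ (n - 1)) * ‖f‖ := by ring
              _ ≤ _ := mul_le_mul_of_nonneg_right
                  (mul_le_mul_of_nonneg_left (h₂ n) (by positivity)) (norm_nonneg _)
        _ = _ := by ring
  obtain ⟨C', hC', hW⟩ := key (N + 1) q' hqq'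
  have hq' : 0 < q' := hq.trans hqq'
  refine ⟨C', hC', fun n => ContinuousLinearMap.opNorm_le_bound _ (by positivity) fun f => ?_⟩
  refine hW n f fun k hk => ?_
  have := order_le_of_mem k.2
  omega

end Triangular

/-! ### The semigroup on multinomials is triangular -/

section JetSemigroup

open MeasureTheory Set

variable {H : Type*} [NormedAddCommGroup H] [InnerProductSpace ℝ H]
  {M N : ℕ} {D : Submodule ℝ H} {L : (Fin M → ℕ) → D →ₗ[ℝ] H} {T : ℝ → H →L[ℝ] H}

@[simp] theorem opApply_zero {E F : Type*} [NormedAddCommGroup E] [NormedSpace ℝ E]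
    [NormedAddCommGroup F] [NormedSpace ℝ F] (A : E →ₗ.[ℝ] F) : opApply A 0 = 0 := by
  rw [opApply_of_mem A.domain.zero_mem]
  exact A.map_zero

theorem opApply_op {k : Fin M → ℕ} {x : H} (hx : x ∈ D) : opApply (op L k) x = L k ⟨x, hx⟩ :=
  opApply_of_mem (A := op L k) hx

theorem mem_jetOperator_domain {f : Jet M N H} :
    f ∈ (jetOperator N L).domain ↔ ∀ n, f n ∈ D := by
  simp [jetOperator, Submodule.mem_pi]

theorem opApply_jetOperator {f : Jet M N H} (hf : ∀ n, f n ∈ D) (n : multiIndices M N) :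
    opApply (jetOperator N L) f n = ∑ k ∈ multiIndices M N,
      if h : n.1 + k ∈ multiIndices M N then opApply (op L k) (f ⟨n.1 + k, h⟩) else 0 := by
  rw [opApply_of_mem (mem_jetOperator_domain.2 hf)]
  let g : ↥(Submodule.pi Set.univ fun _ : multiIndices M N => D) := ⟨f, fun n _ => hf n⟩
  refine (LinearMap.sum_apply _ _ g).trans ?_
  refine Finset.sum_congr rfl fun k _ => ?_
  by_cases h : n.1 + k ∈ multiIndices M N
  · rw [dif_pos h, dif_pos h, opApply_op (hf _)]
    rfl
  · rw [dif_neg h, dif_neg h]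
    rfl

theorem zero_mem_multiIndices : (0 : Fin M → ℕ) ∈ multiIndices M N :=
  mem_multiIndices.2 (by simp [order])

theorem opApply_jetOperator_eq_add {f : Jet M N H} (hf : ∀ n, f n ∈ D) (n : multiIndices M N) :
    opApply (jetOperator N L) f n = opApply (op L 0) (f n) +
      ∑ k ∈ (multiIndices M N).erase 0,
        if h : n.1 + k ∈ multiIndices M N then opApply (op L k) (f ⟨n.1 + k, h⟩) else 0 := by
  rw [opApply_jetOperator hf, ← Finset.add_sum_erase _ _ zero_mem_multiIndices]
  simp [n.2]

theorem order_pos {k : Fin M → ℕ} (hk : k ≠ 0) : 0 < order k :=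
  Nat.pos_of_ne_zero fun h => hk (order_eq_zero.1 h)

theorem opApply_jetOperator_of_vanishesFrom {f : Jet M N H} (hf : ∀ n, f n ∈ D)
    {n : multiIndices M N} (hn : VanishesFrom (order n.1 + 1) f) :
    opApply (jetOperator N L) f n = opApply (op L 0) (f n) := by
  rw [opApply_jetOperator_eq_add hf, Finset.sum_eq_zero, add_zero]
  intro k hk
  split_ifs with h
  · rw [hn, opApply_zero]
    have := order_pos (Finset.ne_of_mem_erase hk)
    rw [order_add]
    omega
  · rfl

/-- For f in the domain, once the coefficients above n are known to stay zero, the n-th coefficient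
of S t f solves the evolution equation of L_0, and uniqueness identifies it. General f follow by
density. -/
theorem GeneratesSemigroup.isTriangular [CompleteSpace H] (hT : GeneratesSemigroup (op L 0) T)
    {S : ℝ → Jet M N H →L[ℝ] Jet M N H} (hS : GeneratesSemigroup (jetOperator N L) S)
    {t : ℝ} (ht : 0 ≤ t) : IsTriangular (S t) (T t) := by
  -- Induction on N - |n|, that is, from the highest order downwards.
  have key : ∀ f ∈ (jetOperator N L).domain, ∀ (d : ℕ) (n : multiIndices M N), N - order n.1 = d →
      VanishesFrom (order n.1 + 1) f → ∀ t, 0 ≤ t → S t f n = T t (f n) := by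
    intro f hf d
    induction d using Nat.strong_induction_on with
    | _ d ih =>
      intro n hn hfn t ht
      have hvan : ∀ s, 0 ≤ s → VanishesFrom (order n.1 + 1) (S s f) := by
        intro s hs k hk
        have := order_le_of_mem k.2
        rw [ih (N - order k.1) (by omega) k rfl (fun l hl => hfn l (by omega)) s hs, hfn k hk,
          map_zero]
      have hgr := mk_opApply_mem_graph hf
      have h0 : S 0 f n = f n := by rw [hS.zero]; rfl
      rw [← h0]
      refine hT.eq_of_hasDerivWithinAt (g := fun s => S s f n)
        (g' := fun s => S s (opApply (jetOperator N L) f) n) ht ?_ ?_ ?_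
      · exact (continuous_apply n).comp_continuousOn ((hS.continuous f).mono fun s hs => hs.1)
      · intro s hs
        have := hS.hasDerivWithinAt hgr hs.1.le
        exact hasDerivWithinAt_pi.1 this n
      · intro s hs
        obtain ⟨h1, h2⟩ := opApply_eq_of_mem_graph (hS.map_graph hgr hs.1.le)
        rw [← h2, opApply_jetOperator_of_vanishesFrom (mem_jetOperator_domain.1 h1)
          (hvan s hs.1.le)]
        exact mk_opApply_mem_graph (A := op L 0) (mem_jetOperator_domain.1 h1 n)
  intro f n hf
  classical
  -- The approximants must keep the vanishing coefficients of f equal to zero, so the closure is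
  -- taken in a product of copies of {0} and of D rather than in the whole domain.
  have hf' : f ∈ closure (Set.pi univ fun k : multiIndices M N =>
      if f k = 0 then ({0} : Set H) else (D : Set H)) := by
    rw [closure_pi_set]
    intro k _
    by_cases hk : f k = 0
    · simp [hk]
    · simp only [hk, if_false]
      exact hT.dense_domain (f k)
  refine closure_minimal ?_ (isClosed_eq (f := fun g : Jet M N H => S t g n)
    (g := fun g => T t (g n)) (by fun_prop) (by fun_prop)) hf'
  intro g hg
  refine key g (mem_jetOperator_domain.2 fun k => ?_) _ n rfl (fun k hk => ?_) t ht
  · have := hg k (mem_univ _)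
    by_cases hk : f k = 0
    · simp only [hk, if_true] at this
      rw [this]; exact D.zero_mem
    · simpa only [hk, if_false, SetLike.mem_coe] using this
  · have := hg k (mem_univ _)
    simpa only [hf k hk, if_true, mem_singleton_iff] using this

end JetSemigroup

/-! ### Perturbation by a degree-lowering bounded operator -/

section Duhamel

open MeasureTheory Set

variable {E : Type*} [NormedAddCommGroup E] [NormedSpace ℝ E]

/-- Clamping times at 0 extends the family continuously to the whole line, where continuity of
parametric integrals applies. -/
theorem StronglyContinuous.continuous_comp_max [CompleteSpace E] {R : ℝ → E →L[ℝ] E}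
    (hR : StronglyContinuous R) {X : Type*} [TopologicalSpace X] {a : X → ℝ} {g : X → E}
    (ha : Continuous a) (hg : Continuous g) : Continuous (fun x => R (max (a x) 0) (g x)) := by
  rw [← continuousOn_univ]
  exact hR.comp (by fun_prop) (fun x _ => le_max_right _ _) hg.continuousOn

theorem StronglyContinuous.continuousOn_convolution [CompleteSpace E] {R : ℝ → E →L[ℝ] E}
    (hR : StronglyContinuous R) {g : ℝ → E} (hg : ContinuousOn g (Ici 0)) :
    ContinuousOn (fun t => ∫ s in (0 : ℝ)..t, R (t - s) (g s)) (Ici 0) := by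
  have hg' : Continuous fun s => g (max s 0) := by
    rw [← continuousOn_univ]
    exact hg.comp (by fun_prop) (fun x _ => mem_Ici.2 (le_max_right _ _))
  have hc : Continuous fun t : ℝ => ∫ s in (0 : ℝ)..t, R (max (t - s) 0) (g (max s 0)) := by
    refine intervalIntegral.continuous_parametric_intervalIntegral_of_continuous ?_ continuous_id
    exact hR.continuous_comp_max (X := ℝ × ℝ) (a := fun p => p.1 - p.2) (by fun_prop)
      (hg'.comp continuous_snd)
  refine hc.continuousOn.congr fun t ht => ?_
  refine intervalIntegral.integral_congr fun s hs => ?_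
  rw [uIcc_of_le ht] at hs
  rw [max_eq_left (sub_nonneg.2 hs.2), max_eq_left hs.1]

theorem StronglyContinuous.intervalIntegrable [CompleteSpace E] {R : ℝ → E →L[ℝ] E}
    (hR : StronglyContinuous R) {t : ℝ} (ht : 0 ≤ t) {g : ℝ → E} (hg : ContinuousOn g (Icc 0 t)) :
    IntervalIntegrable (fun s => R (t - s) (g s)) volume 0 t := by
  refine ContinuousOn.intervalIntegrable ?_
  rw [uIcc_of_le ht]
  exact hR.comp (by fun_prop) (fun s hs => sub_nonneg.2 hs.2) hg

theorem StronglyContinuous.clm_apply [CompleteSpace E] {R : ℝ → E →L[ℝ] E}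
    (hR : StronglyContinuous R) (B : E →L[ℝ] E) (x : E) :
    ContinuousOn (fun s => B (R s x)) (Ici 0) :=
  B.continuous.comp_continuousOn (hR x)

/-- One step of the Dyson–Phillips iteration, as a family of bounded operators. -/
theorem exists_duhamel [CompleteSpace E] {T R : ℝ → E →L[ℝ] E} (hT : StronglyContinuous T)
    (hR : StronglyContinuous R) (B : E →L[ℝ] E) :
    ∃ R' : ℝ → E →L[ℝ] E, StronglyContinuous R' ∧
      ∀ t, 0 ≤ t → ∀ x, R' t x = ∫ s in (0 : ℝ)..t, T (t - s) (B (R s x)) := by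
  have hint : ∀ t, 0 ≤ t → ∀ x, IntervalIntegrable (fun s => T (t - s) (B (R s x))) volume 0 t :=
    fun t ht x => hT.intervalIntegrable ht ((hR.clm_apply B x).mono fun s hs => hs.1)
  have h : ∀ t, ∃ Q : E →L[ℝ] E, 0 ≤ t → ∀ x, Q x = ∫ s in (0 : ℝ)..t, T (t - s) (B (R s x)) := by
    intro t
    by_cases ht : 0 ≤ t
    · obtain ⟨C, hC0, hC⟩ := hT.exists_bound t
      obtain ⟨C', hC0', hC'⟩ := hR.exists_bound t
      refine ⟨LinearMap.mkContinuousOfExistsBound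
        { toFun := fun x => ∫ s in (0 : ℝ)..t, T (t - s) (B (R s x))
          map_add' := fun x y => ?_
          map_smul' := fun c x => ?_ } ⟨C * (‖B‖ * C') * t, fun x => ?_⟩, fun _ x => rfl⟩
      · rw [← intervalIntegral.integral_add (hint t ht x) (hint t ht y)]
        simp
      · rw [RingHom.id_apply, ← intervalIntegral.integral_smul]
        simp
      · have : ‖∫ s in (0 : ℝ)..t, T (t - s) (B (R s x))‖ ≤ C * (‖B‖ * (C' * ‖x‖)) * |t - 0| := by
          refine intervalIntegral.norm_integral_le_of_norm_le_const fun s hs => ?_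
          rw [uIoc_of_le ht] at hs
          refine (ContinuousLinearMap.le_opNorm _ _).trans ?_
          gcongr
          · exact hC _ ⟨sub_nonneg.2 hs.2, by linarith [hs.1]⟩
          refine (ContinuousLinearMap.le_opNorm _ _).trans ?_
          gcongr
          refine (ContinuousLinearMap.le_opNorm _ _).trans ?_
          gcongr
          exact hC' _ ⟨hs.1.le, hs.2⟩
        rw [sub_zero, abs_of_nonneg ht] at this
        calc _ ≤ _ := this
          _ = _ := by ring
    · exact ⟨0, fun h => absurd h ht⟩
  choose Q hQ using h
  exact ⟨Q, fun x => (hT.continuousOn_convolution (hR.clm_apply B x)).congr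
    (fun t ht => hQ t ht x), hQ⟩

variable {M N : ℕ}

theorem VanishesFrom.intervalIntegral {E : Type*} [NormedAddCommGroup E] [NormedSpace ℝ E]
    [CompleteSpace E] {j : ℕ} {g : ℝ → Jet M N E} {t : ℝ}
    (ht : 0 ≤ t) (hg : IntervalIntegrable g volume 0 t) (h : ∀ s ∈ Icc 0 t, VanishesFrom j (g s)) :
    VanishesFrom j (∫ s in (0 : ℝ)..t, g s) := by
  intro k hk
  have h1 := ContinuousLinearMap.intervalIntegral_comp_comm
    (ContinuousLinearMap.proj (R := ℝ) (φ := fun _ : multiIndices M N => E) k) hg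
  change _ = (∫ s in (0 : ℝ)..t, g s) k at h1
  rw [← h1]
  rw [intervalIntegral.integral_congr (g := fun _ => 0)]
  · simp
  · intro s hs
    rw [uIcc_of_le ht] at hs
    exact h s hs k hk

/-- A semigroup on multinomials that acts on the coefficients is perturbed by a bounded operator
that lowers the degree. -/
theorem exists_perturbed_semigroup {H : Type*} [NormedAddCommGroup H] [NormedSpace ℝ H]
    [CompleteSpace H] {T : ℝ → H →L[ℝ] H} (hT : StronglyContinuous T)
    (hT0 : T 0 = ContinuousLinearMap.id ℝ H)
    (hTadd : ∀ s t : ℝ, 0 ≤ s → 0 ≤ t → T (s + t) = (T s).comp (T t))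
    {B : Jet M N H →L[ℝ] Jet M N H}
    (hB : ∀ (j : ℕ) (f : Jet M N H), VanishesFrom (j + 1) f → VanishesFrom j (B f)) :
    ∃ S : ℝ → Jet M N H →L[ℝ] Jet M N H, StronglyContinuous S ∧
      S 0 = ContinuousLinearMap.id ℝ _ ∧
      (∀ s t : ℝ, 0 ≤ s → 0 ≤ t → S (s + t) = (S s).comp (S t)) ∧
      ∀ x, Tendsto (fun h : ℝ => h⁻¹ • (S h x - diagonal M N (T h) x)) (𝓝[>] 0) (𝓝 (B x)) := by
  set T' : ℝ → Jet M N H →L[ℝ] Jet M N H := fun t => diagonal M N (T t) with hT'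
  have hTs : StronglyContinuous T' := fun f => continuousOn_pi.2 fun k => hT (f k)
  have hT'add : ∀ s t : ℝ, 0 ≤ s → 0 ≤ t → ∀ f, T' (s + t) f = T' s (T' t f) := by
    intro s t hs ht f
    funext k
    simp [hT', hTadd s t hs ht]
  have hT'v : ∀ t j f, VanishesFrom j f → VanishesFrom j (T' t f) :=
    fun t j f hf => (isTriangular_diagonal (T t)).vanishesFrom hf
  have hT'0 : T' 0 = ContinuousLinearMap.id ℝ _ := by
    ext f k
    simp [hT', hT0]
  choose Q hQs hQ using fun R : {R : ℝ → Jet M N H →L[ℝ] Jet M N H // StronglyContinuous R} =>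
    exists_duhamel hTs R.2 B
  -- The Dyson–Phillips iterates. Each contains one more factor B than the last, so the iterate of
  -- index N + 1 vanishes and the series is a finite sum.
  let P : ℕ → {R : ℝ → Jet M N H →L[ℝ] Jet M N H // StronglyContinuous R} := fun j =>
    Nat.rec ⟨T', hTs⟩ (fun _ R => ⟨Q R, hQs R⟩) j
  have hP0 : (P 0).1 = T' := rfl
  have hPs : ∀ j t, 0 ≤ t → ∀ x,
      (P (j + 1)).1 t x = ∫ s in (0 : ℝ)..t, T' (t - s) (B ((P j).1 s x)) :=
    fun j => hQ (P j)
  have hPv : ∀ j r t, 0 ≤ t → ∀ f, VanishesFrom r f → VanishesFrom (r - j) ((P j).1 t f) := by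
    intro j
    induction j with
    | zero => exact fun r t _ f hf => hT'v t r f hf
    | succ j ih =>
      intro r t ht f hf
      rw [hPs j t ht]
      refine VanishesFrom.intervalIntegral ht
        (hTs.intervalIntegrable ht (((P j).2.clm_apply B f).mono fun s hs => hs.1)) fun s hs => ?_
      refine hT'v _ _ _ (hB _ _ ?_)
      have := ih r s hs.1 f hf
      exact fun k hk => this k (by omega)
  have htop : ∀ f : Jet M N H, VanishesFrom (N + 1) f := fun f k hk => by
    have := order_le_of_mem k.2
    omega
  have hPN : ∀ t, 0 ≤ t → ∀ f, (P (N + 1)).1 t f = 0 := fun t ht f =>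
    funext fun k => hPv (N + 1) (N + 1) t ht f (htop f) k (by simp)
  let S : ℝ → Jet M N H →L[ℝ] Jet M N H := fun t => ∑ j ∈ Finset.range (N + 1), (P j).1 t
  have hSa : ∀ t f, S t f = ∑ j ∈ Finset.range (N + 1), (P j).1 t f := fun t f => by
    simp [S]
  have hSs : StronglyContinuous S := by
    intro f
    simp only [hSa]
    exact continuousOn_finsetSum _ fun j _ => (P j).2 f
  have hint : ∀ t, 0 ≤ t → ∀ g : ℝ → Jet M N H, ContinuousOn g (Icc 0 t) →
      IntervalIntegrable (fun s => T' (t - s) (B (g s))) volume 0 t := fun t ht g hg =>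
    hTs.intervalIntegrable ht (B.continuous.comp_continuousOn hg)
  have hmono : ∀ t : ℝ, Icc (0 : ℝ) t ⊆ Ici 0 := fun t s hs => hs.1
  have hS : ∀ t, 0 ≤ t → ∀ f, S t f = T' t f + ∫ s in (0 : ℝ)..t, T' (t - s) (B (S s f)) := by
    intro t ht f
    have : ∫ s in (0 : ℝ)..t, T' (t - s) (B (S s f))
        = ∑ j ∈ Finset.range (N + 1), (P (j + 1)).1 t f := by
      simp only [hSa, map_sum]
      rw [intervalIntegral.integral_finsetSum
        (fun j _ => hint t ht _ (((P j).2 f).mono (hmono t)))]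
      exact Finset.sum_congr rfl fun j _ => (hPs j t ht f).symm
    rw [this, Finset.sum_range_succ, hPN t ht, add_zero, hSa, Finset.sum_range_succ', add_comm, hP0]
  -- A solution of the homogeneous Volterra equation loses a degree each time it is inserted into
  -- the equation, hence is zero; no Gronwall estimate is needed.
  have huniq : ∀ d : ℝ → Jet M N H, ContinuousOn d (Ici 0) →
      (∀ t, 0 ≤ t → d t = ∫ s in (0 : ℝ)..t, T' (t - s) (B (d s))) → ∀ t, 0 ≤ t → d t = 0 := by
    intro d hd hdt
    have : ∀ r t, 0 ≤ t → VanishesFrom (N + 1 - r) (d t) := by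
      intro r
      induction r with
      | zero => exact fun t _ => htop _
      | succ r ih =>
        intro t ht
        rw [hdt t ht]
        refine VanishesFrom.intervalIntegral ht (hint t ht d (hd.mono (hmono t))) fun s hs => ?_
        refine hT'v _ _ _ (hB _ _ ?_)
        exact fun k hk => ih s hs.1 k (by omega)
    exact fun t ht => funext fun k => this (N + 1) t ht k (by simp)
  refine ⟨S, hSs, ?_, ?_, ?_⟩
  · ext1 f
    rw [hS 0 le_rfl, hT'0]
    simp
  · intro s t hs ht
    ext1 f
    rw [ContinuousLinearMap.comp_apply]
    have hc1 : ContinuousOn (fun s => S (s + t) f) (Ici 0) :=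
      (hSs f).comp (by fun_prop) fun s hs => add_nonneg hs ht
    -- As functions of s, both S (s + t) f and S s (S t f) solve the Volterra equation with initial
    -- value S t f.
    have := huniq (fun s => S (s + t) f - S s (S t f)) (hc1.sub (hSs _)) ?_ s hs
    · exact sub_eq_zero.1 this
    intro s hs
    have hst : 0 ≤ s + t := add_nonneg hs ht
    simp only [map_sub]
    rw [intervalIntegral.integral_sub (hint s hs _ (hc1.mono (hmono s)))
      (hint s hs _ ((hSs _).mono (hmono s))), hS (s + t) hst, hS s hs (S t f)]
    have e1 : T' s (S t f) = T' (s + t) f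
        + ∫ r in (0 : ℝ)..t, T' (s + t - r) (B (S r f)) := by
      rw [hS t ht, map_add, hT'add s t hs ht,
        ← ContinuousLinearMap.intervalIntegral_comp_comm _ (hint t ht _ ((hSs f).mono (hmono t)))]
      congr 1
      refine intervalIntegral.integral_congr fun r hr => ?_
      rw [uIcc_of_le ht] at hr
      rw [← hT'add s _ hs (sub_nonneg.2 hr.2), add_sub_assoc]
    have hI := hint (s + t) hst _ ((hSs f).mono (hmono _))
    have e2 := intervalIntegral.integral_add_adjacent_intervals
      (hI.mono_set (c := 0) (d := t)
        (by rw [uIcc_of_le ht, uIcc_of_le hst]; exact Icc_subset_Icc_right (by linarith)))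
      (hI.mono_set (c := t) (d := s + t)
        (by rw [uIcc_of_le hst, uIcc_of_le (by linarith)]; exact Icc_subset_Icc_left ht))
    have e3 : ∫ r in t..(s + t), T' (s + t - r) (B (S r f))
        = ∫ r in (0 : ℝ)..s, T' (s - r) (B (S (r + t) f)) := by
      have := intervalIntegral.integral_comp_add_right (a := 0) (b := s)
        (fun r => T' (s + t - r) (B (S r f))) t
      rw [zero_add] at this
      rw [← this]
      simp
    rw [e1, ← e2, e3]
    abel
  · intro f
    have h1 := tendsto_average (f := fun h s => T' (h - s) (B (S s f)))
      (hTs.comp (a := fun p : ℝ × ℝ => p.1 - p.2) (g := fun p => B (S p.2 f)) (by fun_prop)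
        (fun p hp => sub_nonneg.2 hp.2)
        ((hSs.clm_apply B f).comp continuousOn_snd fun p hp => hp.1))
    have hS0 : S 0 f = f := by
      rw [hS 0 le_rfl, hT'0]
      simp
    simp only [sub_zero, hT'0, hS0, ContinuousLinearMap.id_apply] at h1
    refine h1.congr' ?_
    filter_upwards [self_mem_nhdsWithin] with t ht
    rw [hS t (le_of_lt ht) f, add_sub_cancel_left]

end Duhamel

/-! ### Generation when the higher operators are bounded -/

section BoundedPerturbation

variable {H : Type*} [NormedAddCommGroup H] [InnerProductSpace ℝ H] [CompleteSpace H]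
  {M N : ℕ} {D : Submodule ℝ H} {L : (Fin M → ℕ) → D →ₗ[ℝ] H} {T : ℝ → H →L[ℝ] H}

/-- Each bounded L_k extends from the dense D to the whole space. Their combination B with the index
shifts lowers the degree, so the perturbed semigroup exists, and its generator is the diagonal one
plus B. -/
theorem exists_generatesSemigroup_jetOperator (hT : GeneratesSemigroup (op L 0) T)
    (hL : ∀ k, k ≠ 0 → ∃ C : ℝ, ∀ v : D, ‖L k v‖ ≤ C * ‖(v : H)‖) :
    ∃ S, GeneratesSemigroup (jetOperator N L) S := by
  have hD : DenseRange D.subtypeL := by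
    have := hT.dense_domain
    rw [DenseRange]
    convert this
    ext x
    simp [op]
  have hext : ∀ k, ∃ Q : H →L[ℝ] H, k ≠ 0 → ∀ x (hx : x ∈ D), Q x = L k ⟨x, hx⟩ := by
    intro k
    by_cases hk : k = 0
    · exact ⟨0, fun h => absurd hk h⟩
    · refine ⟨((L k).mkContinuousOfExistsBound (hL k hk)).extend D.subtypeL, fun _ x hx => ?_⟩
      exact ContinuousLinearMap.extend_eq _ hD (isUniformInducing_val _) ⟨x, hx⟩
  choose Q hQ using hext
  let B : Jet M N H →L[ℝ] Jet M N H := ContinuousLinearMap.pi fun n =>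
    ∑ k ∈ (multiIndices M N).erase 0, if h : n.1 + k ∈ multiIndices M N then
      (Q k).comp (ContinuousLinearMap.proj ⟨n.1 + k, h⟩) else 0
  have hBa : ∀ f n, B f n = ∑ k ∈ (multiIndices M N).erase 0,
      if h : n.1 + k ∈ multiIndices M N then Q k (f ⟨n.1 + k, h⟩) else 0 := by
    intro f n
    simp only [B, ContinuousLinearMap.pi_apply, sum_apply]
    refine Finset.sum_congr rfl fun k _ => ?_
    split_ifs <;> rfl
  have hBv : ∀ (j : ℕ) (f : Jet M N H), VanishesFrom (j + 1) f → VanishesFrom j (B f) := by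
    intro j f hf n hn
    rw [hBa]
    refine Finset.sum_eq_zero fun k hk => ?_
    split_ifs with h
    · have := order_pos (Finset.ne_of_mem_erase hk)
      rw [hf _ (by rw [order_add]; omega), map_zero]
    · rfl
  obtain ⟨S, hSs, hS0, hSadd, hSB⟩ := exists_perturbed_semigroup hT.stronglyContinuous hT.zero
    hT.add hBv
  refine ⟨S, hS0, hSadd, hSs, fun f g => ?_⟩
  -- The quotients of the perturbed and the diagonal semigroup differ by a term with limit B f for
  -- every f, so both converge for the same f and the domains agree.
  have h1 : Tendsto (fun h : ℝ => h⁻¹ • (S h f - f)) (𝓝[>] 0) (𝓝 g) ↔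
      Tendsto (fun h : ℝ => h⁻¹ • (diagonal M N (T h) f - f)) (𝓝[>] 0) (𝓝 (g - B f)) := by
    refine ⟨fun h => (h.sub (hSB f)).congr fun t => ?_, fun h => ?_⟩
    · rw [← smul_sub]; congr 1; abel
    · have := h.add (hSB f)
      rw [sub_add_cancel] at this
      refine this.congr fun t => ?_
      rw [← smul_add]; congr 1; abel
  rw [h1, tendsto_pi_nhds]
  have h2 : ∀ n, Tendsto (fun h : ℝ => (h⁻¹ • (diagonal M N (T h) f - f)) n) (𝓝[>] 0)
      (𝓝 ((g - B f) n)) ↔ (f n, (g - B f) n) ∈ (op L 0).graph :=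
    fun n => (hT.generator _ _).symm
  simp only [h2]
  have hval : (∀ n, f n ∈ D) → ∀ n, opApply (jetOperator N L) f n
      = opApply (op L 0) (f n) + B f n := by
    intro hf n
    rw [opApply_jetOperator_eq_add hf, hBa]
    congr 1
    refine Finset.sum_congr rfl fun k hk => ?_
    split_ifs with h
    · rw [opApply_op (hf _), hQ k (Finset.ne_of_mem_erase hk)]
    · rfl
  constructor
  · intro h n
    obtain ⟨h3, h4⟩ := opApply_eq_of_mem_graph h
    have h5 := mem_jetOperator_domain.1 h3
    have := hval h5 n
    rw [h4] at this
    rw [Pi.sub_apply, this, add_sub_cancel_right]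
    exact mk_opApply_mem_graph (A := op L 0) (h5 n)
  · intro h
    have h5 : ∀ n, f n ∈ D := fun n => (opApply_eq_of_mem_graph (h n)).1
    have : g = opApply (jetOperator N L) f := by
      funext n
      rw [hval h5 n, (opApply_eq_of_mem_graph (h n)).2]
      simp
    rw [this]
    exact mk_opApply_mem_graph (mem_jetOperator_domain.2 h5)

end BoundedPerturbation

/-! ### Chains of generalised eigenvectors and their orbits -/

section GeneralisedEigenvectors

variable {E : Type*} [NormedAddCommGroup E] [NormedSpace ℝ E] {A : E →ₗ.[ℝ] E} {lam : ℂ}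

/-- Multiplication by a complex number of the element `w.1 + i w.2` of the complexification. -/
def cmul (c : ℂ) (w : E × E) : E × E :=
  (c.re • w.1 - c.im • w.2, c.im • w.1 + c.re • w.2)

theorem cmul_add_left (c d : ℂ) (w : E × E) : cmul (c + d) w = cmul c w + cmul d w := by
  ext <;> simp [cmul, add_smul] <;> abel

theorem cmul_add_right (c : ℂ) (w w' : E × E) : cmul c (w + w') = cmul c w + cmul c w' := by
  ext <;> simp [cmul] <;> abel

theorem cmul_cmul (c d : ℂ) (w : E × E) : cmul c (cmul d w) = cmul (c * d) w := by
  ext <;> simp only [cmul, Complex.mul_re, Complex.mul_im] <;> module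

@[simp] theorem cmul_zero_left (w : E × E) : cmul 0 w = 0 := by ext <;> simp [cmul]

@[simp] theorem cmul_zero_right (c : ℂ) : cmul c (0 : E × E) = 0 := by ext <;> simp [cmul]

@[simp] theorem cmul_one (w : E × E) : cmul 1 w = w := by ext <;> simp [cmul]

theorem norm_cmul_le (c : ℂ) (w : E × E) : ‖cmul c w‖ ≤ 2 * ‖c‖ * ‖w‖ := by
  have h1 := Complex.abs_re_le_norm c
  have h2 := Complex.abs_im_le_norm c
  have h3 := norm_fst_le w
  have h4 := norm_snd_le w
  refine norm_prod_le_iff.2 ⟨?_, ?_⟩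
  · refine (norm_sub_le _ _).trans ?_
    rw [norm_smul, norm_smul, Real.norm_eq_abs, Real.norm_eq_abs]
    calc |c.re| * ‖w.1‖ + |c.im| * ‖w.2‖ ≤ ‖c‖ * ‖w‖ + ‖c‖ * ‖w‖ := by gcongr
      _ = _ := by ring
  · refine (norm_add_le _ _).trans ?_
    rw [norm_smul, norm_smul, Real.norm_eq_abs, Real.norm_eq_abs]
    calc |c.im| * ‖w.1‖ + |c.re| * ‖w.2‖ ≤ ‖c‖ * ‖w‖ + ‖c‖ * ‖w‖ := by gcongr
      _ = _ := by ring

theorem hasDerivAt_cmul {c : ℝ → ℂ} {c' : ℂ} {t : ℝ} (h : HasDerivAt c c' t) (w : E × E) :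
    HasDerivAt (fun s => cmul (c s) w) (cmul c' w) t := by
  have hre : HasDerivAt (fun s => (c s).re) c'.re t :=
    (Complex.reCLM.hasFDerivAt.comp_hasDerivAt t h)
  have him : HasDerivAt (fun s => (c s).im) c'.im t :=
    (Complex.imCLM.hasFDerivAt.comp_hasDerivAt t h)
  exact ((hre.smul_const w.1).sub (him.smul_const w.2)).prodMk
    ((him.smul_const w.1).add (hre.smul_const w.2))

theorem opApply_add {x y : E} (hx : x ∈ A.domain) (hy : y ∈ A.domain) :
    opApply A (x + y) = opApply A x + opApply A y := by
  rw [opApply_of_mem hx, opApply_of_mem hy, opApply_of_mem (A.domain.add_mem hx hy), ← A.map_add]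
  rfl

theorem opApply_smul {c : ℝ} {x : E} (hx : x ∈ A.domain) :
    opApply A (c • x) = c • opApply A x := by
  rw [opApply_of_mem hx, opApply_of_mem (A.domain.smul_mem c hx), ← A.map_smul]
  rfl

theorem opApply_neg {x : E} : opApply A (-x) = -opApply A x := by
  by_cases hx : x ∈ A.domain
  · have := opApply_smul (c := -1) hx
    simpa using this
  · have hx' : -x ∉ A.domain := fun h => hx (by simpa using A.domain.neg_mem h)
    simp [opApply, hx, hx']

theorem opApply_sub {x y : E} (hx : x ∈ A.domain) (hy : y ∈ A.domain) :
    opApply A (x - y) = opApply A x - opApply A y := by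
  rw [sub_eq_add_neg, opApply_add hx (A.domain.neg_mem hy), opApply_neg, ← sub_eq_add_neg]

theorem opApply_sum {ι : Type*} (s : Finset ι) {x : ι → E} (hx : ∀ i ∈ s, x i ∈ A.domain) :
    opApply A (∑ i ∈ s, x i) = ∑ i ∈ s, opApply A (x i) := by
  classical
  induction s using Finset.induction_on with
  | empty => simp
  | insert a s ha ih =>
    rw [Finset.sum_insert ha, Finset.sum_insert ha, opApply_add (hx a (by simp))
      (A.domain.sum_mem fun i hi => hx i (by simp [hi])), ih fun i hi => hx i (by simp [hi])]

/-- Application of an operator to both parts of an element of the complexification. -/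
def pairApply (A : E →ₗ.[ℝ] E) (w : E × E) : E × E := (opApply A w.1, opApply A w.2)

theorem pairApply_eq (w : E × E) : pairApply A w = cmul lam w + complexShift A lam w := by
  ext
  · simp [pairApply, cmul, complexShift]
  · simp only [pairApply, cmul, complexShift, Prod.snd_add]
    module

/-- Both parts of an element of the complexification lie in the domain. -/
def PairMem (p : Submodule ℝ E) (w : E × E) : Prop := w.1 ∈ p ∧ w.2 ∈ p

theorem PairMem.cmul {p : Submodule ℝ E} {w : E × E} (h : PairMem p w) (c : ℂ) :
    PairMem p (cmul c w) :=
  ⟨p.sub_mem (p.smul_mem _ h.1) (p.smul_mem _ h.2), p.add_mem (p.smul_mem _ h.1) (p.smul_mem _ h.2)⟩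

theorem PairMem.sum {p : Submodule ℝ E} {ι : Type*} {s : Finset ι} {w : ι → E × E}
    (h : ∀ i ∈ s, PairMem p (w i)) : PairMem p (∑ i ∈ s, w i) := by
  rw [PairMem, Prod.fst_sum, Prod.snd_sum]
  exact ⟨p.sum_mem fun i hi => (h i hi).1, p.sum_mem fun i hi => (h i hi).2⟩

theorem pairApply_cmul {w : E × E} (h : PairMem A.domain w) (c : ℂ) :
    pairApply A (cmul c w) = cmul c (pairApply A w) := by
  ext
  · simp only [pairApply, cmul]
    rw [opApply_sub (A.domain.smul_mem _ h.1) (A.domain.smul_mem _ h.2), opApply_smul h.1,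
      opApply_smul h.2]
  · simp only [pairApply, cmul]
    rw [opApply_add (A.domain.smul_mem _ h.1) (A.domain.smul_mem _ h.2), opApply_smul h.1,
      opApply_smul h.2]

theorem pairApply_sum {ι : Type*} (s : Finset ι) {w : ι → E × E}
    (h : ∀ i ∈ s, PairMem A.domain (w i)) :
    pairApply A (∑ i ∈ s, w i) = ∑ i ∈ s, pairApply A (w i) := by
  ext
  · rw [Prod.fst_sum]
    simp only [pairApply]
    rw [Prod.fst_sum, opApply_sum s fun i hi => (h i hi).1]
  · rw [Prod.snd_sum]
    simp only [pairApply]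
    rw [Prod.snd_sum, opApply_sum s fun i hi => (h i hi).2]

/-- `(A - lam)^k w = 0`, every power being defined. -/
def IsChain (A : E →ₗ.[ℝ] E) (lam : ℂ) (k : ℕ) (w : E × E) : Prop :=
  (∀ i < k, PairMem A.domain ((complexShift A lam)^[i] w)) ∧ (complexShift A lam)^[k] w = 0

theorem isChain_zero {w : E × E} : IsChain A lam 0 w ↔ w = 0 := by simp [IsChain]

theorem isChain_succ {k : ℕ} {w : E × E} :
    IsChain A lam (k + 1) w ↔ PairMem A.domain w ∧ IsChain A lam k (complexShift A lam w) := by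
  constructor
  · rintro ⟨h1, h2⟩
    exact ⟨h1 0 (by omega), fun i hi => h1 (i + 1) (by omega), h2⟩
  · rintro ⟨h1, h2, h3⟩
    refine ⟨fun i hi => ?_, h3⟩
    rcases i with _ | i
    · exact h1
    · exact h2 i (by omega)

theorem IsChain.iterate {k : ℕ} {w : E × E} (h : IsChain A lam k w) {i : ℕ} (hi : i ≤ k) :
    IsChain A lam (k - i) ((complexShift A lam)^[i] w) := by
  refine ⟨fun j hj => ?_, ?_⟩
  · rw [← Function.iterate_add_apply]
    exact h.1 _ (by omega)
  · rw [← Function.iterate_add_apply, Nat.sub_add_cancel hi]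
    exact h.2

theorem IsChain.pairMem_genEigenspan {k : ℕ} {w : E × E} (h : IsChain A lam k w) {P : ℂ → Prop}
    (hP : P lam) : PairMem (genEigenspan A P) w := by
  by_cases hw : w = 0
  · subst hw
    exact ⟨Submodule.zero_mem _, Submodule.zero_mem _⟩
  · exact ⟨Submodule.subset_span ⟨lam, w, hP, ⟨hw, k, h⟩, Or.inl rfl⟩,
      Submodule.subset_span ⟨lam, w, hP, ⟨hw, k, h⟩, Or.inr rfl⟩⟩

theorem IsChain.pairMem_domain {k : ℕ} {w : E × E} (h : IsChain A lam k w) :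
    PairMem A.domain w := by
  rcases k with _ | k
  · rw [isChain_zero.1 h]
    exact ⟨Submodule.zero_mem _, Submodule.zero_mem _⟩
  · exact (isChain_succ.1 h).1

theorem genEigenspan_le_domain (P : ℂ → Prop) : genEigenspan A P ≤ A.domain := by
  refine Submodule.span_le.2 ?_
  rintro x ⟨lam, w, -, ⟨-, k, hk⟩, rfl | rfl⟩
  · exact (IsChain.pairMem_domain hk).1
  · exact (IsChain.pairMem_domain hk).2

/-- Since A w = λ w + (A - λ) w, and the last term generates a shorter chain for the same
eigenvalue, the span is invariant. -/
theorem opApply_mem_genEigenspan {P : ℂ → Prop} {x : E} (hx : x ∈ genEigenspan A P) :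
    opApply A x ∈ genEigenspan A P := by
  induction hx using Submodule.span_induction with
  | mem x hx =>
    obtain ⟨lam, w, hP, ⟨hw, k, hk⟩, hx⟩ := hx
    have hk : IsChain A lam k w := hk
    rcases k with _ | k
    · exact absurd (isChain_zero.1 hk) hw
    have h1 : PairMem (genEigenspan A P) (pairApply A w) := by
      rw [pairApply_eq (lam := lam)]
      have h2 := (hk.pairMem_genEigenspan hP).cmul lam
      have h3 := (isChain_succ.1 hk).2.pairMem_genEigenspan hP
      exact ⟨Submodule.add_mem _ h2.1 h3.1, Submodule.add_mem _ h2.2 h3.2⟩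
    rcases hx with rfl | rfl
    · exact h1.1
    · exact h1.2
  | zero => rw [opApply_zero]; exact Submodule.zero_mem _
  | add x y hx hy ihx ihy =>
    rw [opApply_add (genEigenspan_le_domain P hx) (genEigenspan_le_domain P hy)]
    exact Submodule.add_mem _ ihx ihy
  | smul c x hx ih =>
    rw [opApply_smul (genEigenspan_le_domain P hx)]
    exact Submodule.smul_mem _ _ ih

theorem hasDerivAt_pow_div_factorial_mul_exp (lam : ℂ) (i : ℕ) (t : ℝ) :
    HasDerivAt (fun s : ℝ => (s : ℂ) ^ i / (i.factorial : ℂ) * Complex.exp (lam * s))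
      (lam * ((t : ℂ) ^ i / (i.factorial : ℂ) * Complex.exp (lam * t)) +
        if i = 0 then 0 else (t : ℂ) ^ (i - 1) / ((i - 1).factorial : ℂ) * Complex.exp (lam * t))
      t := by
  have h0 : HasDerivAt (fun s : ℝ => (s : ℂ)) 1 t := Complex.ofRealCLM.hasDerivAt
  have h1 : HasDerivAt (fun s : ℝ => Complex.exp (lam * s)) (Complex.exp (lam * t) * lam) t := by
    simpa using (h0.const_mul lam).cexp
  have h2 : HasDerivAt (fun s : ℝ => (s : ℂ) ^ i) (i * (t : ℂ) ^ (i - 1)) t := by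
    simpa using h0.fun_pow i
  have h3 := (h2.div_const (i.factorial : ℂ)).mul h1
  refine HasDerivAt.congr_deriv h3 ?_
  rcases i with _ | i
  · simp; ring
  · have : ((i + 1 : ℕ) : ℂ) ≠ 0 := by exact_mod_cast Nat.succ_ne_zero i
    have h4 : (i.factorial : ℂ) ≠ 0 := by exact_mod_cast Nat.factorial_ne_zero i
    rw [if_neg (Nat.succ_ne_zero i), Nat.add_sub_cancel, Nat.factorial_succ]
    push_cast at this ⊢
    field_simp
    ring

/-- A chain of generalised eigenvectors yields an explicit solution, defined for all times, of the
evolution equation of the operator. -/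
theorem IsChain.exists_orbit {k : ℕ} {w : E × E} (h : IsChain A lam k w) :
    ∃ y : ℝ → E × E, y 0 = w ∧ (∀ t, PairMem A.domain (y t)) ∧
      (∀ t, HasDerivAt y (pairApply A (y t)) t) ∧
      (∀ P : ℂ → Prop, P lam → ∀ t, PairMem (genEigenspan A P) (y t)) ∧
      ∀ ε : ℝ, 0 < ε → ∃ C : ℝ, ∀ t, ‖y t‖ ≤ C * Real.exp (lam.re * t + ε * |t|) := by
  -- The orbit is e^{λt} ∑ (tⁱ / i!) (A - λ)ⁱ w. Here d i is the coefficient of (A - λ)ⁱ w, and e i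
  -- is the previous one, so that (d i)' = λ d i + e i.
  let d : ℕ → ℝ → ℂ := fun i t => (t : ℂ) ^ i / (i.factorial : ℂ) * Complex.exp (lam * t)
  let e : ℕ → ℝ → ℂ := fun i t =>
    if i = 0 then 0 else (t : ℂ) ^ (i - 1) / ((i - 1).factorial : ℂ) * Complex.exp (lam * t)
  let w' : ℕ → E × E := fun i => (complexShift A lam)^[i] w
  have hmem : ∀ i ∈ Finset.range k, PairMem A.domain (w' i) := fun i hi =>
    h.1 i (Finset.mem_range.1 hi)
  refine ⟨fun t => ∑ i ∈ Finset.range k, cmul (d i t) (w' i), ?_, ?_, ?_, ?_, ?_⟩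
  · rcases k with _ | k
    · simp [isChain_zero.1 h]
    · simp only
      rw [Finset.sum_range_succ', Finset.sum_eq_zero]
      · simp [d, w']
      · intro i _
        simp [d]
  · exact fun t => PairMem.sum fun i hi => (hmem i hi).cmul _
  · intro t
    simp only
    rw [pairApply_sum _ fun i hi => (hmem i hi).cmul _]
    have h1 : ∑ i ∈ Finset.range k, pairApply A (cmul (d i t) (w' i))
        = ∑ i ∈ Finset.range k, cmul (lam * d i t + e i t) (w' i) := by
      have h2 : ∀ i ∈ Finset.range k, pairApply A (cmul (d i t) (w' i))
          = cmul (lam * d i t) (w' i) + cmul (d i t) (w' (i + 1)) := by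
        intro i hi
        rw [pairApply_cmul (hmem i hi), pairApply_eq (lam := lam), cmul_add_right, cmul_cmul,
          mul_comm]
        simp only [w', Function.iterate_succ_apply']
      have h3 : ∑ i ∈ Finset.range k, cmul (d i t) (w' (i + 1))
          = ∑ i ∈ Finset.range k, cmul (e i t) (w' i) := by
        have h4 := Finset.sum_range_succ (fun i => cmul (e i t) (w' i)) k
        rw [Finset.sum_range_succ', show w' k = 0 from h.2] at h4
        simpa [e, d] using h4
      rw [Finset.sum_congr rfl h2, Finset.sum_add_distrib, h3, ← Finset.sum_add_distrib]
      exact Finset.sum_congr rfl fun i _ => (cmul_add_left _ _ _).symm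
    rw [h1]
    exact HasDerivAt.fun_sum fun i _ =>
      hasDerivAt_cmul (hasDerivAt_pow_div_factorial_mul_exp lam i t) _
  · intro P hP t
    exact PairMem.sum fun i hi =>
      ((h.iterate (Finset.mem_range.1 hi).le).pairMem_genEigenspan hP).cmul _
  · intro ε hε
    -- From |t|ⁱ / i! ≤ ε⁻ⁱ e^{ε|t|}; the factor 2 comes from `norm_cmul_le`, the product norm being
    -- a maximum.
    refine ⟨∑ i ∈ Finset.range k, 2 * (ε⁻¹ ^ i) * ‖w' i‖, fun t => ?_⟩
    refine (norm_sum_le _ _).trans ?_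
    rw [Finset.sum_mul]
    refine Finset.sum_le_sum fun i _ => (norm_cmul_le _ _).trans ?_
    have h1 : ‖d i t‖ ≤ ε⁻¹ ^ i * Real.exp (lam.re * t + ε * |t|) := by
      simp only [d]
      rw [norm_mul, norm_div, norm_pow, Complex.norm_exp, Complex.norm_real, Complex.norm_natCast,
        Real.exp_add, Real.norm_eq_abs]
      have h2 := Real.pow_div_factorial_le_exp (ε * |t|) (by positivity) i
      have h3 : |t| ^ i / (i.factorial : ℝ) = ε⁻¹ ^ i * ((ε * |t|) ^ i / (i.factorial : ℝ)) := by
        rw [mul_pow, ← mul_div_assoc, ← mul_assoc, ← mul_pow, inv_mul_cancel₀ hε.ne', one_pow,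
          one_mul]
      have h4 : (lam * (t : ℂ)).re = lam.re * t := by simp
      rw [h3, h4]
      calc _ ≤ ε⁻¹ ^ i * Real.exp (ε * |t|) * Real.exp (lam.re * t) := by gcongr
        _ = _ := by ring
    calc 2 * ‖d i t‖ * ‖w' i‖ ≤ 2 * (ε⁻¹ ^ i * Real.exp (lam.re * t + ε * |t|)) * ‖w' i‖ := by
          gcongr
      _ = _ := by ring

theorem GeneratesSemigroup.apply_eq_of_hasDerivAt [CompleteSpace E] {S : ℝ → E →L[ℝ] E}
    (hS : GeneratesSemigroup A S) {y : ℝ → E × E} (hy : ∀ t, PairMem A.domain (y t))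
    (hd : ∀ t, HasDerivAt y (pairApply A (y t)) t) {t : ℝ} (ht : 0 ≤ t) :
    y t = (S t (y 0).1, S t (y 0).2) := by
  have h1 : ∀ t, HasDerivAt (fun s => (y s).1) (opApply A (y t).1) t := fun t => (hd t).fst
  have h2 : ∀ t, HasDerivAt (fun s => (y s).2) (opApply A (y t).2) t := fun t => (hd t).snd
  refine Prod.ext ?_ ?_
  · exact hS.eq_of_hasDerivWithinAt ht (fun s _ => (h1 s).continuousAt.continuousWithinAt)
      (fun s _ => (h1 s).hasDerivWithinAt) (fun s _ => mk_opApply_mem_graph (hy s).1)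
  · exact hS.eq_of_hasDerivWithinAt ht (fun s _ => (h2 s).continuousAt.continuousWithinAt)
      (fun s _ => (h2 s).hasDerivWithinAt) (fun s _ => mk_opApply_mem_graph (hy s).2)

theorem IsChain.exists_norm_semigroup_le [CompleteSpace E] {S : ℝ → E →L[ℝ] E}
    (hS : GeneratesSemigroup A S) {k : ℕ} {w : E × E} (h : IsChain A lam k w) {γ : ℝ}
    (hγ : lam.re < -γ) : ∃ C : ℝ, ∀ t, 0 ≤ t →
      ‖S t w.1‖ ≤ C * Real.exp (-γ * t) ∧ ‖S t w.2‖ ≤ C * Real.exp (-γ * t) := by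
  obtain ⟨y, hy0, hyd, hy', -, hyb⟩ := h.exists_orbit
  -- The gap between Re λ and -γ pays for the polynomial factor.
  obtain ⟨C, hC⟩ := hyb (-γ - lam.re) (by linarith)
  refine ⟨C, fun t ht => ?_⟩
  have h1 := hC t
  rw [hS.apply_eq_of_hasDerivAt hyd hy' ht, hy0, abs_of_nonneg ht,
    show lam.re * t + (-γ - lam.re) * t = -γ * t by ring] at h1
  exact norm_prod_le_iff.1 h1

end GeneralisedEigenvectors

/-! ### Orthogonality of the adjoint's centre subspace to the stable subspace -/

section Adjoint

variable {H : Type*} [NormedAddCommGroup H] [InnerProductSpace ℝ H]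

/-- The complex bilinear extension of the inner product to the complexification. -/
def pairing (z w : H × H) : ℂ := ⟨⟪z.1, w.1⟫_ℝ - ⟪z.2, w.2⟫_ℝ, ⟪z.1, w.2⟫_ℝ + ⟪z.2, w.1⟫_ℝ⟩

theorem pairing_cmul_left (c : ℂ) (z w : H × H) : pairing (cmul c z) w = c * pairing z w := by
  apply Complex.ext <;>
  simp only [pairing, cmul, inner_sub_left, inner_add_left, real_inner_smul_left, Complex.mul_re,
    Complex.mul_im] <;> ring

theorem pairing_cmul_right (c : ℂ) (z w : H × H) : pairing z (cmul c w) = c * pairing z w := by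
  apply Complex.ext <;>
  simp only [pairing, cmul, inner_sub_right, inner_add_right, real_inner_smul_right, Complex.mul_re,
    Complex.mul_im] <;> ring

theorem pairing_add_left (z z' w : H × H) : pairing (z + z') w = pairing z w + pairing z' w := by
  apply Complex.ext <;> simp only [pairing, Prod.fst_add, Prod.snd_add, inner_add_left,
    Complex.add_re, Complex.add_im] <;> ring

theorem pairing_add_right (z w w' : H × H) : pairing z (w + w') = pairing z w + pairing z w' := by
  apply Complex.ext <;> simp only [pairing, Prod.fst_add, Prod.snd_add, inner_add_right,
    Complex.add_re, Complex.add_im] <;> ring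

theorem pairing_pairApply {A A' : H →ₗ.[ℝ] H} (hA : A'.IsFormalAdjoint A) {z w : H × H}
    (hz : PairMem A'.domain z) (hw : PairMem A.domain w) :
    pairing (pairApply A' z) w = pairing z (pairApply A w) := by
  have h : ∀ {a b : H}, a ∈ A'.domain → b ∈ A.domain → ⟪opApply A' a, b⟫_ℝ = ⟪a, opApply A b⟫_ℝ := by
    intro a b ha hb
    rw [opApply_of_mem ha, opApply_of_mem hb]
    exact hA ⟨a, ha⟩ ⟨b, hb⟩
  simp only [pairing, pairApply]
  rw [h hz.1 hw.1, h hz.2 hw.2, h hz.1 hw.2, h hz.2 hw.1]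

/-- Induction on the total chain length. Moving the operator across the pairing gives μ⟨z, w⟩ = λ⟨z,
w⟩ up to pairings with a shorter chain, which vanish already. The pairing is bilinear, not
sesquilinear, so the condition is λ ≠ μ without a conjugate. -/
theorem pairing_eq_zero_of_isChain {A A' : H →ₗ.[ℝ] H} (hA : A'.IsFormalAdjoint A) {lam mu : ℂ}
    (hne : lam ≠ mu) : ∀ (d k l : ℕ), k + l = d → ∀ z w : H × H, IsChain A' mu k z →
      IsChain A lam l w → pairing z w = 0 := by
  intro d
  induction d with
  | zero =>
    intro k l hkl z w hz hw
    obtain rfl : k = 0 := by omega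
    rw [isChain_zero.1 hz]
    apply Complex.ext <;> simp [pairing]
  | succ d ih =>
    intro k l hkl z w hz hw
    rcases k with _ | k
    · rw [isChain_zero.1 hz]
      apply Complex.ext <;> simp [pairing]
    rcases l with _ | l
    · rw [isChain_zero.1 hw]
      apply Complex.ext <;> simp [pairing]
    have h1 := pairing_pairApply hA (isChain_succ.1 hz).1 (isChain_succ.1 hw).1
    rw [pairApply_eq (lam := mu) z, pairApply_eq (lam := lam) w, pairing_add_left,
      pairing_add_right, ih k (l + 1) (by omega) _ w (isChain_succ.1 hz).2 hw,
      ih (k + 1) l (by omega) z _ hz (isChain_succ.1 hw).2, pairing_cmul_left,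
      pairing_cmul_right, add_zero, add_zero, ← sub_eq_zero, ← sub_mul] at h1
    rcases mul_eq_zero.1 h1 with h2 | h2
    · exact absurd (sub_eq_zero.1 h2).symm hne
    · exact h2

theorem IsChain.conj {E : Type*} [NormedAddCommGroup E] [NormedSpace ℝ E] {A : E →ₗ.[ℝ] E} {lam : ℂ}
    {k : ℕ} {w : E × E} (h : IsChain A lam k w) :
    IsChain A (starRingEnd ℂ lam) k (w.1, -w.2) := by
  induction k generalizing w with
  | zero => rw [isChain_zero.1 h]; simp [isChain_zero]
  | succ k ih =>
    obtain ⟨h1, h2⟩ := isChain_succ.1 h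
    refine isChain_succ.2 ⟨⟨h1.1, A.domain.neg_mem h1.2⟩, ?_⟩
    convert ih h2 using 1
    ext
    · simp [complexShift]
    · simp only [complexShift, opApply_neg, Complex.conj_re, Complex.conj_im]
      module

/-- Both z and its conjugate pair to zero with w, and the four real equations separate the four
inner products. Distinct real parts ensure that λ differs from μ and from its conjugate. -/
theorem inner_eq_zero_of_isChain {A A' : H →ₗ.[ℝ] H} (hA : A'.IsFormalAdjoint A) {lam mu : ℂ}
    (hne : lam.re ≠ mu.re) {k l : ℕ} {z w : H × H} (hz : IsChain A' mu k z)
    (hw : IsChain A lam l w) :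
    ⟪z.1, w.1⟫_ℝ = 0 ∧ ⟪z.1, w.2⟫_ℝ = 0 ∧ ⟪z.2, w.1⟫_ℝ = 0 ∧ ⟪z.2, w.2⟫_ℝ = 0 := by
  have h1 := pairing_eq_zero_of_isChain hA (fun h => hne (by rw [h])) _ k l rfl z w hz hw
  have h2 := pairing_eq_zero_of_isChain hA (mu := starRingEnd ℂ mu)
    (fun h => hne (by rw [h]; simp)) _ k l rfl _ w hz.conj hw
  have a1 := congrArg Complex.re h1
  have a2 := congrArg Complex.im h1
  have a3 := congrArg Complex.re h2
  have a4 := congrArg Complex.im h2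
  simp only [pairing, inner_neg_left, Complex.zero_re, Complex.zero_im] at a1 a2 a3 a4
  refine ⟨?_, ?_, ?_, ?_⟩ <;> linarith

/-- The real parts concerned are ≥ -α and ≤ -β < -α, so generators are orthogonal; orthogonal
complements are closed, which covers the closure of the span. -/
theorem inner_centreSubspace_adjoint_stableSubspace [CompleteSpace H] {A : H →ₗ.[ℝ] H}
    (hA : Dense (A.domain : Set H)) {α β : ℝ} (hαβ : α < β) {z v : H}
    (hz : z ∈ centreSubspace (A†) α) (hv : v ∈ stableSubspace A β) : ⟪z, v⟫_ℝ = 0 := by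
  have key : genEigenspan A (fun lam => lam.re ≤ -β) ≤ (centreSubspace (A†) α)ᗮ := by
    refine Submodule.span_le.2 ?_
    rintro x ⟨lam, w, hlam, ⟨-, l, hw⟩, hx⟩
    refine (Submodule.mem_orthogonal _ _).2 fun u hu => ?_
    refine Submodule.span_induction (p := fun u _ => ⟪u, x⟫_ℝ = 0) ?_ (by simp) ?_ ?_ hu
    · rintro u ⟨mu, z, hmu, ⟨-, k, hz⟩, hu⟩
      have hne : lam.re ≠ mu.re := by
        have := (abs_le.1 hmu).1
        intro h
        linarith
      obtain ⟨h1, h2, h3, h4⟩ := inner_eq_zero_of_isChain (LinearPMap.adjoint_isFormalAdjoint hA)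
        hne (show IsChain _ mu k z from hz) (show IsChain _ lam l w from hw)
      rcases hu with rfl | rfl <;> rcases hx with rfl | rfl <;> assumption
    · intro a b _ _ ha hb
      rw [inner_add_left, ha, hb, add_zero]
    · intro c a _ ha
      rw [real_inner_smul_left, ha, mul_zero]
  have := Submodule.topologicalClosure_minimal _ key (Submodule.isClosed_orthogonal _) hv
  exact (Submodule.mem_orthogonal _ _).1 this z hz

end Adjoint

/-! ### Uniform exponential bounds from pointwise ones -/

section UniformBounds

open Set

variable {E F : Type*} [NormedAddCommGroup E] [NormedSpace ℝ E] [CompleteSpace E]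
  [NormedAddCommGroup F] [NormedSpace ℝ F]

/-- The uniform boundedness principle for families that decay at a given exponential rate
pointwise on a closed subspace. -/
theorem exists_norm_le_of_forall_mem {R : ℝ → E →L[ℝ] F} {p : Submodule ℝ E}
    (hp : IsClosed (p : Set E)) {γ : ℝ}
    (h : ∀ x ∈ p, ∃ C : ℝ, ∀ t, 0 ≤ t → ‖R t x‖ ≤ C * Real.exp (-γ * t)) :
    ∃ C : ℝ, 0 ≤ C ∧ ∀ t, 0 ≤ t → ∀ x ∈ p, ‖R t x‖ ≤ C * Real.exp (-γ * t) * ‖x‖ := by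
  have : CompleteSpace p := hp.completeSpace_coe
  obtain ⟨C, hC⟩ := banach_steinhaus
    (g := fun t : Ici (0 : ℝ) => Real.exp (γ * t) • (R t).comp p.subtypeL) (fun x => by
      obtain ⟨C, hC⟩ := h x x.2
      refine ⟨C, fun t => ?_⟩
      have := hC t t.2
      simp only [smul_apply, ContinuousLinearMap.comp_apply, norm_smul,
        Real.norm_eq_abs, Real.abs_exp, Submodule.subtypeL_apply]
      calc Real.exp (γ * t) * ‖R t x‖ ≤ Real.exp (γ * t) * (C * Real.exp (-γ * t)) := by gcongr
        _ = C * (Real.exp (γ * t) * Real.exp (-γ * t)) := by ring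
        _ = C := by rw [← Real.exp_add]; simp)
  refine ⟨max C 0, le_max_right _ _, fun t ht x hx => ?_⟩
  have h1 := (ContinuousLinearMap.le_opNorm
    (Real.exp (γ * t) • (R t).comp p.subtypeL) ⟨x, hx⟩).trans
    (mul_le_mul_of_nonneg_right ((hC ⟨t, ht⟩).trans (le_max_left C 0)) (norm_nonneg _))
  simp only [smul_apply, ContinuousLinearMap.comp_apply, norm_smul,
        Real.norm_eq_abs, Real.abs_exp, Submodule.subtypeL_apply] at h1
  have h2 : Real.exp (-γ * t) * Real.exp (γ * t) = 1 := by rw [← Real.exp_add]; simp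
  calc ‖R t x‖ = Real.exp (-γ * t) * (Real.exp (γ * t) * ‖R t x‖) := by
        rw [← mul_assoc, h2, one_mul]
    _ ≤ Real.exp (-γ * t) * (max C 0 * ‖(⟨x, hx⟩ : p)‖) := by gcongr
    _ = max C 0 * Real.exp (-γ * t) * ‖x‖ := by rw [Submodule.coe_norm]; ring

/-- The vectors that decay pointwise at a given exponential rate. -/
def boundedSubspace (R : ℝ → E →L[ℝ] F) (γ : ℝ) : Submodule ℝ E where
  carrier := {x | ∃ C : ℝ, ∀ t, 0 ≤ t → ‖R t x‖ ≤ C * Real.exp (-γ * t)}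
  zero_mem' := ⟨0, by simp⟩
  add_mem' := by
    rintro x y ⟨C, hC⟩ ⟨C', hC'⟩
    refine ⟨C + C', fun t ht => ?_⟩
    rw [map_add, add_mul]
    exact (norm_add_le _ _).trans (add_le_add (hC t ht) (hC' t ht))
  smul_mem' := by
    rintro c x ⟨C, hC⟩
    refine ⟨|c| * C, fun t ht => ?_⟩
    rw [map_smul, norm_smul, Real.norm_eq_abs, mul_assoc]
    exact mul_le_mul_of_nonneg_left (hC t ht) (abs_nonneg c)

end UniformBounds

/-! ### Finite families, inner products and matrices as bounded operators -/

section Combinations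

variable {H : Type*} [NormedAddCommGroup H] [InnerProductSpace ℝ H] {m : ℕ}

/-- The linear combination of a finite family with given coefficients. -/
def combination (V : Fin m → H) : (Fin m → ℝ) →L[ℝ] H :=
  LinearMap.toContinuousLinearMap (Fintype.linearCombination ℝ V)

theorem combination_apply (V : Fin m → H) (c : Fin m → ℝ) : combination V c = ∑ j, c j • V j := rfl

/-- The inner products with a finite family. -/
def innerVec (Z : Fin m → H) : H →L[ℝ] (Fin m → ℝ) :=
  ContinuousLinearMap.pi fun i => innerSL ℝ (Z i)

@[simp] theorem innerVec_apply (Z : Fin m → H) (v : H) (i : Fin m) :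
    innerVec Z v i = ⟪Z i, v⟫_ℝ := rfl

/-- A matrix as a bounded operator. -/
def matrixOp (A : Matrix (Fin m) (Fin m) ℝ) : (Fin m → ℝ) →L[ℝ] (Fin m → ℝ) :=
  LinearMap.toContinuousLinearMap (Matrix.mulVecLin A)

@[simp] theorem matrixOp_apply (A : Matrix (Fin m) (Fin m) ℝ) (c : Fin m → ℝ) :
    matrixOp A c = A *ᵥ c := rfl

theorem combination_mulVec (V : Fin m → H) (A₀ : Matrix (Fin m) (Fin m) ℝ) (c : Fin m → ℝ) :
    combination V (A₀ *ᵥ c) = ∑ j, c j • ∑ i, A₀ i j • V i := by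
  simp only [combination_apply, Matrix.mulVec, dotProduct, Finset.sum_smul, Finset.smul_sum]
  rw [Finset.sum_comm]
  simp only [smul_smul, mul_comm]

theorem opApply_combination {F : H →ₗ.[ℝ] H} {V : Fin m → H} (hV : ∀ j, V j ∈ F.domain)
    (c : Fin m → ℝ) : opApply F (combination V c) = ∑ j, c j • opApply F (V j) := by
  rw [combination_apply, opApply_sum _ fun j _ => F.domain.smul_mem _ (hV j)]
  exact Finset.sum_congr rfl fun j _ => opApply_smul (hV j)

end Combinations

/-! ### Decay on the stable subspace and growth on the centre subspace of L_0 -/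

section Spectral

open Set MeasureTheory

variable {H : Type*} [NormedAddCommGroup H] [InnerProductSpace ℝ H] [CompleteSpace H]
  {A : H →ₗ.[ℝ] H} {T : ℝ → H →L[ℝ] H} {α β : ℝ}

/-- In finite dimensions every generating vector decays along its explicit orbit, and the uniform
boundedness principle turns this into one constant. Otherwise the assumed rate is only lowered below
β. -/
theorem SpectralSplitting.exists_decay (hT : SpectralSplitting A T α β) (hαβ : α < β) :
    ∃ γ C : ℝ, α < γ ∧ γ < β ∧ 0 ≤ C ∧
      ∀ t, 0 ≤ t → ∀ v ∈ stableSubspace A β, ‖T t v‖ ≤ C * Real.exp (-γ * t) * ‖v‖ := by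
  rcases hT.stable_decay with hfin | ⟨γ, C, hγ, hC⟩
  · obtain ⟨γ, hγ, hγ'⟩ := exists_between hαβ
    have hcl : stableSubspace A β = genEigenspan A (fun lam => lam.re ≤ -β) := by
      exact (Submodule.closed_of_finiteDimensional _).submodule_topologicalClosure_eq
    have hle : genEigenspan A (fun lam => lam.re ≤ -β) ≤ boundedSubspace T γ := by
      refine Submodule.span_le.2 ?_
      rintro x ⟨lam, w, hlam, ⟨-, k, hk⟩, hx⟩
      obtain ⟨C, hC⟩ := IsChain.exists_norm_semigroup_le hT.semigroup
        (show IsChain A lam k w from hk) (γ := γ) (by linarith)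
      rcases hx with rfl | rfl
      · exact ⟨C, fun t ht => (hC t ht).1⟩
      · exact ⟨C, fun t ht => (hC t ht).2⟩
    obtain ⟨C, hC0, hC⟩ := exists_norm_le_of_forall_mem (R := T)
      (Submodule.isClosed_topologicalClosure _ : IsClosed (stableSubspace A β : Set H)) (γ := γ)
      (fun x hx => hle (hcl ▸ hx))
    exact ⟨γ, C, hγ, hγ', hC0, hC⟩
  · obtain ⟨γ', hγ', hγ''⟩ := exists_between (lt_min hγ hαβ)
    refine ⟨γ', max C 0, hγ', hγ''.trans_le (min_le_right _ _), le_max_right _ _,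
      fun t ht v hv => (hC t ht v hv).trans ?_⟩
    have h1 : γ' ≤ γ := (hγ''.trans_le (min_le_left _ _)).le
    have h2 : -γ * t ≤ -γ' * t := by nlinarith
    gcongr
    exact le_max_left _ _

variable {m : ℕ} {V₀ Z₀ : Fin m → H}

theorem CentreBases.innerVec_combination (h : CentreBases A α V₀ Z₀) (c : Fin m → ℝ) :
    innerVec Z₀ (combination V₀ c) = c := by
  funext i
  simp [combination_apply, inner_sum, real_inner_smul_right, h.dual]

theorem CentreBases.exists_combination (h : CentreBases A α V₀ Z₀) {v : H}
    (hv : v ∈ centreSubspace A α) : combination V₀ (innerVec Z₀ v) = v := by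
  rw [← h.span_V] at hv
  obtain ⟨c, rfl⟩ := (Submodule.mem_span_range_iff_exists_fun ℝ).1 hv
  have := h.innerVec_combination c
  rw [combination_apply] at this
  rw [this, combination_apply]

theorem CentreBases.combination_mem (h : CentreBases A α V₀ Z₀) (c : Fin m → ℝ) :
    combination V₀ c ∈ centreSubspace A α := by
  rw [← h.span_V]
  exact (Submodule.mem_span_range_iff_exists_fun ℝ).2 ⟨c, rfl⟩

/-- Orthogonality gives one inclusion. Conversely, the centre component of v is recovered from the
inner products of v with Z⁰, so it vanishes with them. Thus Z⁰ represents the spectral projection of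
L_0. -/
theorem CentreBases.mem_stableSubspace_iff (h : CentreBases A α V₀ Z₀)
    (hT : SpectralSplitting A T α β) (hαβ : α < β) {v : H} :
    v ∈ stableSubspace A β ↔ innerVec Z₀ v = 0 := by
  have h1 : ∀ v ∈ stableSubspace A β, innerVec Z₀ v = 0 := fun v hv => funext fun i =>
    inner_centreSubspace_adjoint_stableSubspace hT.semigroup.dense_domain hαβ
      (by rw [← h.span_Z]; exact Submodule.subset_span ⟨i, rfl⟩) hv
  refine ⟨h1 v, fun hv => ?_⟩
  obtain ⟨c, hc, s, hs, rfl⟩ := Submodule.mem_sup.1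
    (hT.isCompl.sup_eq_top ▸ Submodule.mem_top : v ∈ centreSubspace A α ⊔ stableSubspace A β)
  rw [map_add, h1 s hs, add_zero] at hv
  rw [← h.exists_combination hc, hv, map_zero, zero_add]
  exact hs

theorem CentreBases.V_mem_domain (h : CentreBases A α V₀ Z₀) (j : Fin m) : V₀ j ∈ A.domain := by
  refine genEigenspan_le_domain (A := A) (fun lam => |lam.re| ≤ α) ?_
  change V₀ j ∈ centreSubspace A α
  rw [← h.span_V]
  exact Submodule.subset_span ⟨j, rfl⟩

theorem CentreBases.opApply_combination (h : CentreBases A α V₀ Z₀)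
    {A₀ : Matrix (Fin m) (Fin m) ℝ} (hA₀ : ∀ j, opApply A (V₀ j) = ∑ i, A₀ i j • V₀ i)
    (c : Fin m → ℝ) : opApply A (combination V₀ c) = combination V₀ (A₀ *ᵥ c) := by
  rw [SlowlyVarying.opApply_combination h.V_mem_domain, combination_mulVec]
  simp only [hA₀]

theorem CentreBases.exists_matrix (h : CentreBases A α V₀ Z₀) :
    ∃ A₀ : Matrix (Fin m) (Fin m) ℝ, ∀ j, opApply A (V₀ j) = ∑ i, A₀ i j • V₀ i := by
  refine ⟨fun i j => innerVec Z₀ (opApply A (V₀ j)) i, fun j => ?_⟩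
  have h1 : opApply A (V₀ j) ∈ centreSubspace A α := by
    refine opApply_mem_genEigenspan ?_
    change V₀ j ∈ centreSubspace A α
    rw [← h.span_V]
    exact Submodule.subset_span ⟨j, rfl⟩
  have h2 := h.exists_combination h1
  rw [combination_apply] at h2
  exact h2.symm

theorem exp_add_smul {F : Type*} [NormedAddCommGroup F] [NormedSpace ℝ F] [CompleteSpace F]
    (a : F →L[ℝ] F)
    (s t : ℝ) : NormedSpace.exp ((s + t) • a)
      = NormedSpace.exp (s • a) * NormedSpace.exp (t • a) := by
  let _ : NormedAlgebra ℚ (F →L[ℝ] F) := NormedAlgebra.restrictScalars ℚ ℝ _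
  rw [add_smul, NormedSpace.exp_add_of_commute]
  exact (Commute.refl a).smul_left s |>.smul_right t

theorem exp_smul_mul_exp_neg_smul {F : Type*} [NormedAddCommGroup F] [NormedSpace ℝ F] [CompleteSpace F]
    (a : F →L[ℝ] F) (t : ℝ) : NormedSpace.exp (t • a) * NormedSpace.exp (t • (-a)) = 1 := by
  rw [smul_neg, ← neg_smul, ← exp_add_smul]
  simp

theorem exp_neg_smul_mul_exp_smul {F : Type*} [NormedAddCommGroup F] [NormedSpace ℝ F] [CompleteSpace F]
    (a : F →L[ℝ] F) (t : ℝ) : NormedSpace.exp (t • (-a)) * NormedSpace.exp (t • a) = 1 := by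
  rw [smul_neg, ← neg_smul, ← exp_add_smul]
  simp

/-- The function e^{-sa} c(s) has zero derivative. The identity is later used at negative times. -/
theorem eq_exp_smul_apply {F : Type*} [NormedAddCommGroup F] [NormedSpace ℝ F] [CompleteSpace F]
    {a : F →L[ℝ] F} {c : ℝ → F} (hc : ∀ t, HasDerivAt c (a (c t)) t) (t : ℝ) :
    c t = NormedSpace.exp (t • a) (c 0) := by
  have h1 : ∀ s, HasDerivAt (fun s : ℝ => NormedSpace.exp (s • (-a)) (c s)) 0 s := by
    intro s
    have h2 := (hasDerivAt_exp_smul_const (𝕂 := ℝ) (-a) s).clm_apply (hc s)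
    convert h2 using 1
    simp
  have h2 := is_const_of_deriv_eq_zero (fun s => (h1 s).differentiableAt)
    (fun s => (h1 s).deriv) t 0
  simp only [zero_smul, NormedSpace.exp_zero, one_apply_eq_self] at h2
  rw [← h2, ← mul_apply_eq_comp, exp_smul_mul_exp_neg_smul, one_apply_eq_self]

/-- Orbits of chains exist for negative times too, and their coordinates in the basis V⁰ solve c' =
A_0 c. At time -t they are e^{-tA_0} c(0), of size at most e^{(α + ε)t} because Re λ ≥ -α. The
chains span, and uniform boundedness gives one constant. -/
theorem CentreBases.exists_norm_exp_le (h : CentreBases A α V₀ Z₀)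
    {A₀ : Matrix (Fin m) (Fin m) ℝ} (hA₀ : ∀ j, opApply A (V₀ j) = ∑ i, A₀ i j • V₀ i)
    {α' : ℝ} (hα' : α < α') : ∃ C : ℝ, 0 ≤ C ∧ ∀ t, 0 ≤ t →
      ‖NormedSpace.exp (t • (-matrixOp A₀))‖ ≤ C * Real.exp (α' * t) := by
  set R : ℝ → (Fin m → ℝ) →L[ℝ] (Fin m → ℝ) := fun t => NormedSpace.exp (t • (-matrixOp A₀)) with hR
  have key : centreSubspace A α ≤ (boundedSubspace R (-α')).comap (innerVec Z₀ : H →ₗ[ℝ] _) := by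
    refine Submodule.span_le.2 ?_
    rintro x ⟨lam, w, hlam, ⟨-, k, hk⟩, hx⟩
    obtain ⟨y, hy0, hyd, hy', hyc, hyb⟩ := IsChain.exists_orbit (show IsChain A lam k w from hk)
    obtain ⟨C, hC⟩ := hyb (α' - α) (by linarith)
    -- Here f stands for either projection of the complexification, so that real and imaginary parts
    -- are treated at once.
    have main : ∀ f : H × H →L[ℝ] H, (∀ t, f (y t) ∈ centreSubspace A α) →
        (∀ t, f (pairApply A (y t)) = opApply A (f (y t))) →
        f w ∈ (boundedSubspace R (-α')).comap (innerVec Z₀ : H →ₗ[ℝ] _) := by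
      intro f hf hf'
      have h1 : ∀ t, HasDerivAt (fun s => innerVec Z₀ (f (y s)))
          (matrixOp A₀ (innerVec Z₀ (f (y t)))) t := by
        intro t
        have h2 := ((innerVec Z₀).comp f).hasFDerivAt.comp_hasDerivAt t (hy' t)
        refine HasDerivAt.congr_deriv h2 ?_
        rw [ContinuousLinearMap.comp_apply, hf']
        conv_lhs => rw [← h.exists_combination (hf t)]
        rw [h.opApply_combination hA₀, h.innerVec_combination, matrixOp_apply]
      have h2 := eq_exp_smul_apply h1
      refine ⟨‖(innerVec Z₀).comp f‖ * C, fun t ht => ?_⟩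
      have h3 := h2 (-t)
      have h4 := hC (-t)
      rw [abs_neg, abs_of_nonneg ht] at h4
      change ‖R t (innerVec Z₀ (f w))‖ ≤ _
      simp only [hR, smul_neg]
      rw [hy0, neg_smul] at h3
      rw [← h3]
      have hlam' := (abs_le.1 hlam).1
      have hC0 : 0 ≤ C := by
        have := hC 0
        simp only [mul_zero, abs_zero, add_zero, Real.exp_zero, mul_one] at this
        exact (norm_nonneg _).trans this
      calc ‖innerVec Z₀ (f (y (-t)))‖ ≤ ‖(innerVec Z₀).comp f‖ * ‖y (-t)‖ :=
            ((innerVec Z₀).comp f).le_opNorm _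
        _ ≤ ‖(innerVec Z₀).comp f‖ * (C * Real.exp (- -α' * t)) := by
            gcongr
            refine h4.trans ?_
            gcongr
            nlinarith
        _ = _ := by ring
    rcases hx with rfl | rfl
    · exact main (ContinuousLinearMap.fst ℝ H H) (fun t => (hyc _ hlam t).1) (fun t => rfl)
    · exact main (ContinuousLinearMap.snd ℝ H H) (fun t => (hyc _ hlam t).2) (fun t => rfl)
  obtain ⟨C, hC0, hC⟩ := exists_norm_le_of_forall_mem (R := R) (p := ⊤) isClosed_univ (γ := -α')
    (fun c _ => by
      have := key (h.combination_mem c)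
      rw [Submodule.mem_comap] at this
      change innerVec Z₀ (combination V₀ c) ∈ _ at this
      rw [h.innerVec_combination] at this
      exact this)
  refine ⟨C, hC0, fun t ht => ContinuousLinearMap.opNorm_le_bound _ (by positivity) fun c => ?_⟩
  have := hC t ht c trivial
  rwa [neg_neg] at this

end Spectral

/-! ### The Sylvester equation on the stable subspace -/

section Sylvester

open Set MeasureTheory

variable {H : Type*} [NormedAddCommGroup H] [InnerProductSpace ℝ H] [CompleteSpace H]
  {A : H →ₗ.[ℝ] H} {T : ℝ → H →L[ℝ] H} {α β : ℝ} {m : ℕ} {V₀ Z₀ : Fin m → H}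

theorem continuous_exp_smul {F : Type*} [NormedAddCommGroup F] [NormedSpace ℝ F] [CompleteSpace F]
    (a : F →L[ℝ] F) : Continuous fun t : ℝ => NormedSpace.exp (t • a) :=
  continuous_iff_continuousAt.2 fun t => (hasDerivAt_exp_smul_const (𝕂 := ℝ) a t).continuousAt

/-- The Sylvester equation `A 𝒱 - 𝒱 a = G`, when the semigroup generated by `A` decays on the
range of `G` faster than `exp (-t a)` grows. -/
theorem exists_sylvester {F : Type*} [NormedAddCommGroup F] [NormedSpace ℝ F]
    [FiniteDimensional ℝ F] (hT : GeneratesSemigroup A T) {a : F →L[ℝ] F}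
    {p : Submodule ℝ H} (hp : IsClosed (p : Set H)) (hTp : ∀ t, 0 ≤ t → ∀ v ∈ p, T t v ∈ p)
    {C C' γ γ' : ℝ} (hγ : γ' < γ)
    (hC : ∀ t, 0 ≤ t → ∀ v ∈ p, ‖T t v‖ ≤ C * Real.exp (-γ * t) * ‖v‖)
    (hC' : ∀ t, 0 ≤ t → ‖NormedSpace.exp (t • (-a))‖ ≤ C' * Real.exp (γ' * t))
    (G : F →L[ℝ] H) (hG : ∀ c, G c ∈ p) :
    ∃ V : F →L[ℝ] H, ∀ c, V c ∈ p ∧ (V c, V (a c) + G c) ∈ A.graph := by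
  have : CompleteSpace F := FiniteDimensional.complete ℝ F
  let E : ℝ → F →L[ℝ] F := fun t => NormedSpace.exp (t • (-a))
  have hE : Continuous E := continuous_exp_smul (-a)
  let φ : F → ℝ → H := fun c t => T t (G (E t c))
  have hφc : ∀ c, ContinuousOn (φ c) (Ici 0) := fun c =>
    hT.stronglyContinuous.comp continuousOn_id (fun t ht => ht)
      (G.continuous.comp (hE.clm_apply continuous_const)).continuousOn
  have hφb : ∀ c t, 0 ≤ t → ‖φ c t‖ ≤ |C| * (‖G‖ * (|C'| * ‖c‖)) * Real.exp (-(γ - γ') * t) := by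
    intro c t ht
    have h1 : ‖E t c‖ ≤ |C'| * Real.exp (γ' * t) * ‖c‖ := by
      refine ((E t).le_opNorm c).trans ?_
      gcongr
      refine (hC' t ht).trans ?_
      gcongr
      exact le_abs_self _
    calc ‖φ c t‖ ≤ C * Real.exp (-γ * t) * ‖G (E t c)‖ := hC t ht _ (hG _)
      _ ≤ |C| * Real.exp (-γ * t) * (‖G‖ * (|C'| * Real.exp (γ' * t) * ‖c‖)) := by
        gcongr
        · exact le_abs_self C
        · exact (G.le_opNorm _).trans (by gcongr)
      _ = |C| * (‖G‖ * (|C'| * ‖c‖)) * (Real.exp (-γ * t) * Real.exp (γ' * t)) := by ring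
      _ = _ := by rw [← Real.exp_add]; ring_nf
  have hφi : ∀ c, IntegrableOn (φ c) (Ioi 0) := by
    intro c
    refine Integrable.mono' ((exp_neg_integrableOn_Ioi 0 (sub_pos.2 hγ)).const_mul
      (|C| * (‖G‖ * (|C'| * ‖c‖)))) ?_ ?_
    · exact ((hφc c).mono Ioi_subset_Ici_self).aestronglyMeasurable measurableSet_Ioi
    · filter_upwards [ae_restrict_mem measurableSet_Ioi] with t ht
      exact hφb c t (le_of_lt ht)
  -- The solution -∫_0^∞ T t G e^{-ta} dt; the integrand is bounded by a multiple of e^{-(γ - γ')t}.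
  let V : F →L[ℝ] H := LinearMap.toContinuousLinearMap
    { toFun := fun c => -∫ t in Ioi (0 : ℝ), φ c t
      map_add' := fun c c' => by
        rw [← neg_add, ← integral_add (hφi c) (hφi c')]
        simp [φ]
      map_smul' := fun r c => by
        rw [RingHom.id_apply, smul_neg, ← integral_smul]
        simp [φ] }
  have hV : ∀ c, V c = -∫ t in Ioi (0 : ℝ), φ c t := fun c => rfl
  have hVp : ∀ c, V c ∈ p := by
    intro c
    rw [hV]
    refine p.neg_mem ?_
    have h1 := intervalIntegral_tendsto_integral_Ioi (0 : ℝ) (hφi c) tendsto_id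
    refine hp.mem_of_tendsto h1 ?_
    filter_upwards [eventually_ge_atTop 0] with b hb
    have hcp : IsClosed (p : Set H) := hp
    have hmem : ∀ t ∈ Icc (0 : ℝ) b, φ c t ∈ p := fun t ht => hTp t ht.1 _ (hG _)
    have : CompleteSpace p := hp.completeSpace_coe
    -- The orthogonal projection onto p fixes the integrand, hence also the integral.
    have h2 : ∀ t ∈ uIcc (0 : ℝ) b, φ c t = p.starProjection (φ c t) := by
      intro t ht
      rw [uIcc_of_le hb] at ht
      exact (Submodule.starProjection_eq_self_iff.2 (hmem t ht)).symm
    rw [id, intervalIntegral.integral_congr h2, ContinuousLinearMap.intervalIntegral_comp_comm]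
    · exact Submodule.starProjection_apply_mem _ _
    · exact ((hφc c).mono (by rw [uIcc_of_le hb]; exact fun t ht => ht.1)).intervalIntegrable
  -- Applying T h shifts the integral to start at h, with c replaced by e^{ha} c. The right
  -- derivative of this identity at h = 0 is A V c = V a c + G c.
  have hshift : ∀ c h, 0 ≤ h → T h (V c) = V (NormedSpace.exp (h • a) c)
      + ∫ t in (0 : ℝ)..h, φ (NormedSpace.exp (h • a) c) t := by
    intro c h hh
    have h1 : ∀ t, 0 ≤ t → T h (φ c t) = φ (NormedSpace.exp (h • a) c) (t + h) := by
      intro t ht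
      have e1 : E (t + h) (NormedSpace.exp (h • a) c) = E t c := by
        simp only [E]
        rw [exp_add_smul, mul_apply_eq_comp]
        have := congrArg (fun Q : F →L[ℝ] F => Q c) (exp_neg_smul_mul_exp_smul a h)
        simp only [mul_apply_eq_comp] at this
        rw [this]
        rfl
      simp only [φ]
      rw [e1, add_comm t h, hT.add h t hh ht]
      rfl
    have h2 : T h (∫ t in Ioi (0 : ℝ), φ c t)
        = ∫ t in Ioi h, φ (NormedSpace.exp (h • a) c) t := by
      rw [← ContinuousLinearMap.integral_comp_comm _ (hφi c)]
      rw [← (measurePreserving_add_right volume h).setIntegral_preimage_emb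
        (measurableEmbedding_addRight h) _ (Ioi h)]
      rw [preimage_add_const_Ioi, sub_self]
      exact setIntegral_congr_fun measurableSet_Ioi fun t ht => h1 t (le_of_lt ht)
    have h3 := intervalIntegral.integral_interval_add_Ioi (hφi (NormedSpace.exp (h • a) c))
      ((hφi (NormedSpace.exp (h • a) c)).mono_set (Ioi_subset_Ioi hh))
    rw [hV, hV, map_neg, h2, ← h3]
    abel
  refine ⟨V, fun c => ⟨hVp c, (hT.generator _ _).2 ?_⟩⟩
  have h1 : Tendsto (fun h : ℝ => h⁻¹ • (V (NormedSpace.exp (h • a) c) - V c)) (𝓝[>] 0)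
      (𝓝 (V (a c))) := by
    have h2 : HasDerivAt (fun t : ℝ => V (NormedSpace.exp (t • a) c)) (V (a c)) 0 := by
      have h3 := (hasDerivAt_exp_smul_const (𝕂 := ℝ) a 0).clm_apply
        (hasDerivAt_const (0 : ℝ) c)
      have h4 := V.hasFDerivAt.comp_hasDerivAt 0 h3
      refine HasDerivAt.congr_deriv h4 ?_
      simp
    have h5 := hasDerivWithinAt_Ioi_iff_tendsto.1 (h2.hasDerivWithinAt (s := Ioi 0))
    simpa using h5
  have h2 := tendsto_average (f := fun h t => φ (NormedSpace.exp (h • a) c) t)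
    (hT.stronglyContinuous.comp (a := fun q : ℝ × ℝ => q.2)
      (g := fun q => G (E q.2 (NormedSpace.exp (q.1 • a) c))) (by fun_prop) (fun q hq => hq.1)
      (G.continuous.comp ((hE.comp continuous_snd).clm_apply
        (((continuous_exp_smul a).comp continuous_fst).clm_apply
          continuous_const))).continuousOn)
  have h3 : φ (NormedSpace.exp ((0 : ℝ) • a) c) 0 = G c := by
    simp [φ, E, hT.zero]
  rw [h3] at h2
  refine (h1.add h2).congr' ?_
  filter_upwards [self_mem_nhdsWithin] with h hh
  rw [hshift c h (le_of_lt hh), ← smul_add]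
  congr 1
  abel

/-- A right-hand side annihilated by Z⁰ is stable, and a rate γ' between α and the stable rate
dominates the growth of e^{-tA_0}. That the solution is again stable gives the normalisation. -/
theorem CentreBases.exists_sylvester (h : CentreBases A α V₀ Z₀)
    (hT : SpectralSplitting A T α β) (hαβ : α < β) {A₀ : Matrix (Fin m) (Fin m) ℝ}
    (hA₀ : ∀ j, opApply A (V₀ j) = ∑ i, A₀ i j • V₀ i) {G : Fin m → H}
    (hG : ∀ j, innerVec Z₀ (G j) = 0) :
    ∃ W : Fin m → H, ∀ j, W j ∈ A.domain ∧ innerVec Z₀ (W j) = 0 ∧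
      opApply A (W j) - ∑ i, A₀ i j • W i = G j := by
  obtain ⟨γ, C, hγ, -, -, hC⟩ := hT.exists_decay hαβ
  obtain ⟨γ', hγ', hγ''⟩ := exists_between hγ
  obtain ⟨C', -, hC'⟩ := h.exists_norm_exp_le hA₀ hγ'
  have hG' : ∀ c, combination G c ∈ stableSubspace A β := by
    intro c
    rw [combination_apply]
    exact Submodule.sum_mem _ fun j _ =>
      Submodule.smul_mem _ _ ((h.mem_stableSubspace_iff hT hαβ).2 (hG j))
  obtain ⟨V, hV⟩ := SlowlyVarying.exists_sylvester hT.semigroup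
    (Submodule.isClosed_topologicalClosure _ : IsClosed (stableSubspace A β : Set H))
    hT.stable_invariant hγ'' hC hC' (combination G) hG'
  refine ⟨fun j => V (Pi.single j 1), fun j => ?_⟩
  obtain ⟨h1, h2⟩ := hV (Pi.single j 1)
  obtain ⟨h3, h4⟩ := opApply_eq_of_mem_graph h2
  refine ⟨h3, (h.mem_stableSubspace_iff hT hαβ).1 h1, ?_⟩
  have e1 : combination G (Pi.single j 1) = G j := by
    simp [combination_apply, Pi.single_apply]
  have e2 : V (matrixOp A₀ (Pi.single j 1)) = ∑ i, A₀ i j • V (Pi.single i 1) := by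
    have : matrixOp A₀ (Pi.single j 1) = ∑ i, A₀ i j • (Pi.single i 1 : Fin m → ℝ) := by
      funext l
      simp [Pi.single_apply]
    rw [this, map_sum]
    simp
  rw [h4, e1, e2, add_sub_cancel_left]

end Sylvester

/-! ### Solvability of the recursion -/

section Recursion

variable {H : Type*} [NormedAddCommGroup H] [InnerProductSpace ℝ H] [CompleteSpace H]
  {M N m : ℕ} {D : Submodule ℝ H} {L : (Fin M → ℕ) → D →ₗ[ℝ] H} {T : ℝ → H →L[ℝ] H} {α β : ℝ}
  {V₀ Z₀ : Fin m → H}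

theorem order_sub_add {n k : Fin M → ℕ} (h : k ≤ n) : order (n - k) + order k = order n := by
  rw [← order_add, tsub_add_cancel_of_le h]

theorem order_sub_lt {n k : Fin M → ℕ} (hk : k ∈ (Finset.Iic n).erase 0) :
    order (n - k) < order n := by
  have h1 := order_sub_add (Finset.mem_Iic.1 (Finset.mem_of_mem_erase hk))
  have h2 := order_pos (Finset.ne_of_mem_erase hk)
  omega

theorem order_lt_of_ne {n k : Fin M → ℕ} (hk : k ≤ n) (hne : k ≠ n) : order k < order n := by
  have h1 := order_sub_add hk
  have h2 : n - k ≠ 0 := fun h => hne (le_antisymm hk (tsub_eq_zero_iff_le.1 h))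
  have := order_pos h2
  omega

/-- The equations of the recursion at a single multi-index. -/
structure RecursionAt (L : (Fin M → ℕ) → D →ₗ[ℝ] H) (Z₀ : Fin m → H)
    (A : (Fin M → ℕ) → Matrix (Fin m) (Fin m) ℝ) (V : (Fin M → ℕ) → Fin m → H)
    (n : Fin M → ℕ) : Prop where
  V_mem : ∀ j, V n j ∈ D
  A_eq : ∀ i j, A n i j = ∑ k ∈ (Finset.Iic n).erase 0, ⟪Z₀ i, opApply (op L k) (V (n - k) j)⟫_ℝ
  V_eq : ∀ j, opApply (op L 0) (V n j) - ∑ i, A 0 i j • V n i =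
      - ∑ k ∈ (Finset.Iic n).erase 0, opApply (op L k) (V (n - k) j)
      + ∑ k ∈ (Finset.Iic n).erase 0, ∑ i, A k i j • V (n - k) i
  V_orth : ∀ i j, ⟪Z₀ i, V n j⟫_ℝ = 0

omit [CompleteSpace H] in
theorem RecursionAt.congr {A A' : (Fin M → ℕ) → Matrix (Fin m) (Fin m) ℝ}
    {V V' : (Fin M → ℕ) → Fin m → H} {n : Fin M → ℕ} (h : RecursionAt L Z₀ A V n)
    (hA : ∀ k ≤ n, A' k = A k) (hV : ∀ k ≤ n, V' k = V k) : RecursionAt L Z₀ A' V' n := by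
  have hsub : ∀ k, V' (n - k) = V (n - k) := fun k => hV _ (tsub_le_self)
  refine ⟨fun j => ?_, fun i j => ?_, fun j => ?_, fun i j => ?_⟩
  · rw [hV n le_rfl]; exact h.V_mem j
  · rw [hA n le_rfl, h.A_eq]
    simp only [hsub]
  · rw [hA 0 (fun i => Nat.zero_le _), hV n le_rfl, h.V_eq]
    simp only [hsub]
    congr 1
    refine Finset.sum_congr rfl fun k hk => ?_
    rw [hA k (Finset.mem_Iic.1 (Finset.mem_of_mem_erase hk))]
  · rw [hV n le_rfl]; exact h.V_orth i j

/-- The matrix B is forced by solvability: in the product of Z⁰ with the right-hand side, the term k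
= n contributes B itself, as V^0 is dual to Z⁰, while all other V^{n-k} are orthogonal to Z⁰. -/
theorem CentreBases.exists_recursion_step (h : CentreBases (op L 0) α V₀ Z₀)
    (hT : SpectralSplitting (op L 0) T α β) (hαβ : α < β)
    {A : (Fin M → ℕ) → Matrix (Fin m) (Fin m) ℝ} {V : (Fin M → ℕ) → Fin m → H}
    (hV0 : V 0 = V₀) (hA0 : ∀ j, opApply (op L 0) (V₀ j) = ∑ i, A 0 i j • V₀ i)
    {n : Fin M → ℕ} (hn : n ≠ 0)
    (horth : ∀ k, k ≠ 0 → order k < order n → ∀ i j, ⟪Z₀ i, V k j⟫_ℝ = 0) :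
    ∃ (B : Matrix (Fin m) (Fin m) ℝ) (W : Fin m → H),
      RecursionAt L Z₀ (Function.update A n B) (Function.update V n W) n := by
  set B : Matrix (Fin m) (Fin m) ℝ := fun i j =>
    ∑ k ∈ (Finset.Iic n).erase 0, ⟪Z₀ i, opApply (op L k) (V (n - k) j)⟫_ℝ with hB
  set A' := Function.update A n B with hA'
  let G : Fin m → H := fun j => - ∑ k ∈ (Finset.Iic n).erase 0, opApply (op L k) (V (n - k) j)
      + ∑ k ∈ (Finset.Iic n).erase 0, ∑ i, A' k i j • V (n - k) i
  have hnmem : n ∈ (Finset.Iic n).erase 0 := Finset.mem_erase.2 ⟨hn, Finset.mem_Iic.2 le_rfl⟩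
  have hG : ∀ j, innerVec Z₀ (G j) = 0 := by
    intro j
    funext l
    simp only [G, innerVec_apply, inner_add_right, inner_neg_right, inner_sum,
      real_inner_smul_right, Pi.zero_apply]
    rw [← Finset.add_sum_erase _ (fun k => ∑ i, A' k i j * ⟪Z₀ l, V (n - k) i⟫_ℝ) hnmem,
      Finset.sum_eq_zero (s := ((Finset.Iic n).erase 0).erase n)]
    · have e1 : A' n = B := Function.update_self _ _ _
      have e2 : ∑ i, A' n i j * ⟪Z₀ l, V (n - n) i⟫_ℝ = B l j := by
        simp [e1, hV0, h.dual]
      rw [e2, add_zero]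
      exact neg_add_cancel _
    · intro k hk
      obtain ⟨hk1, hk2⟩ := Finset.mem_erase.1 hk
      refine Finset.sum_eq_zero fun i _ => ?_
      rw [horth _ _ (order_sub_lt hk2), mul_zero]
      intro h0
      exact hk1 (le_antisymm (Finset.mem_Iic.1 (Finset.mem_of_mem_erase hk2))
        (tsub_eq_zero_iff_le.1 h0))
  obtain ⟨W, hW⟩ := h.exists_sylvester hT hαβ hA0 hG
  refine ⟨B, W, ?_⟩
  have hsub : ∀ k ∈ (Finset.Iic n).erase 0, Function.update V n W (n - k) = V (n - k) := by
    intro k hk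
    refine Function.update_of_ne ?_ _ _
    intro h0
    have := order_sub_lt hk
    rw [h0] at this
    exact lt_irrefl _ this
  refine ⟨fun j => ?_, fun i j => ?_, fun j => ?_, fun i j => ?_⟩
  · rw [Function.update_self]
    exact (hW j).1
  · rw [Function.update_self, hB]
    exact Finset.sum_congr rfl fun k hk => by rw [hsub k hk]
  · rw [Function.update_self, Function.update_of_ne hn.symm, (hW j).2.2]
    simp only [G]
    congr 1
    · congr 1
      exact Finset.sum_congr rfl fun k hk => by rw [hsub k hk]
    · exact Finset.sum_congr rfl fun k hk => by rw [hsub k hk]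
  · rw [Function.update_self]
    exact congrFun (hW j).2.1 i

/-- Induction on the order, filling in a whole layer |n| = d + 1 at once. The equations at n involve
only indices k ≤ n, none of which except n lies in that layer, so the single-index solutions do not
interfere. -/
theorem CentreBases.exists_centreRecursion (h : CentreBases (op L 0) α V₀ Z₀)
    (hT : SpectralSplitting (op L 0) T α β) (hαβ : α < β) :
    ∃ A V, CentreRecursion N L V₀ Z₀ A V := by
  obtain ⟨A₀, hA₀⟩ := h.exists_matrix
  have key : ∀ d : ℕ, ∃ (A : (Fin M → ℕ) → Matrix (Fin m) (Fin m) ℝ) (V : (Fin M → ℕ) → Fin m → H),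
      A 0 = A₀ ∧ V 0 = V₀ ∧ ∀ n, n ≠ 0 → order n ≤ d → RecursionAt L Z₀ A V n := by
    intro d
    induction d with
    | zero =>
      exact ⟨fun _ => A₀, fun _ => V₀, rfl, rfl, fun n hn hn' =>
        absurd (order_eq_zero.1 (Nat.le_zero.1 hn')) hn⟩
    | succ d ih =>
      obtain ⟨A, V, hA, hV, hAV⟩ := ih
      have hstep : ∀ n : Fin M → ℕ, ∃ (B : Matrix (Fin m) (Fin m) ℝ) (W : Fin m → H),
          order n = d + 1 →
          RecursionAt L Z₀ (Function.update A n B) (Function.update V n W) n := by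
        intro n
        by_cases hn : order n = d + 1
        · obtain ⟨B, W, hBW⟩ := h.exists_recursion_step hT hαβ hV (hA.symm ▸ hA₀)
            (n := n) (by rintro rfl; simp [order] at hn)
            (fun k hk hkn => (hAV k hk (by omega)).V_orth)
          exact ⟨B, W, fun _ => hBW⟩
        · exact ⟨0, 0, fun h => absurd h hn⟩
      choose B W hBW using hstep
      refine ⟨fun n => if order n = d + 1 then B n else A n,
        fun n => if order n = d + 1 then W n else V n, by simpa [order] using hA,
        by simpa [order] using hV, fun n hn hnd => ?_⟩
      have hlt : ∀ k ≤ n, k ≠ n → order k ≠ d + 1 := fun k hk hkn => by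
        have := order_lt_of_ne hk hkn
        omega
      by_cases hn' : order n = d + 1
      · refine (hBW n hn').congr (fun k hk => ?_) (fun k hk => ?_)
        · by_cases hkn : k = n
          · subst hkn; simp [hn']
          · simp [hlt k hk hkn, hkn]
        · by_cases hkn : k = n
          · subst hkn; simp [hn']
          · simp [hlt k hk hkn, hkn]
      · have hk' : ∀ k ≤ n, order k ≠ d + 1 := fun k hk => by
          by_cases hkn : k = n
          · rwa [hkn]
          · exact hlt k hk hkn
        exact (hAV n hn (by omega)).congr (fun k hk => by simp [hk' k hk])
          (fun k hk => by simp [hk' k hk])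
  obtain ⟨A, V, hA, hV, hAV⟩ := key N
  have hmem : ∀ n ∈ multiIndices M N, n ≠ 0 → RecursionAt L Z₀ A V n := fun n hn hn0 =>
    hAV n hn0 (order_le_of_mem hn)
  refine ⟨A, V, hV, fun n hn j => ?_, hA.symm ▸ hA₀, fun n hn hn0 => (hmem n hn hn0).A_eq,
    fun n hn hn0 => (hmem n hn hn0).V_eq, fun n hn hn0 => (hmem n hn hn0).V_orth⟩
  by_cases hn0 : n = 0
  · rw [hn0, hV]
    exact h.V_mem_domain j
  · exact (hmem n hn hn0).V_mem j

end Recursion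

/-! ### An invariant complement from the gap between two growth rates -/

section SpectralProjection

variable {E C : Type*} [NormedAddCommGroup E] [NormedSpace ℝ E]
  [NormedAddCommGroup C] [NormedSpace ℝ C] [CompleteSpace C]

/-- An invariant subspace, parametrised by `V`, on which an operator `S` expands more than it does
on the quotient space, has an invariant complement, the kernel of `P`. -/
theorem exists_invariant_projection {S : E →L[ℝ] E} {G G' : C →L[ℝ] C} {V : C →L[ℝ] E}
    {P₀ : E →L[ℝ] C} (hGG' : ∀ c, G (G' c) = c) (hPV : ∀ c, P₀ (V c) = c)
    (hSV : ∀ c, S (V c) = V (G c)) {a b q r : ℝ} (hq : 0 ≤ q) (hr : 0 ≤ r) (hqr : r * q < 1)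
    (hW : ∀ n : ℕ, ‖((1 - V.comp P₀).comp S) ^ n‖ ≤ a * q ^ n)
    (hG' : ∀ n : ℕ, ‖G' ^ n‖ ≤ b * r ^ n) :
    ∃ P : E →L[ℝ] C, (∀ c, P (V c) = c) ∧ (∀ f, P (S f) = G (P f)) ∧
      ∃ d : ℝ, 0 ≤ d ∧ ∀ (n : ℕ) (f : E), P f = 0 → ‖(S ^ n) f‖ ≤ d * q ^ n * ‖f‖ := by
  set Q : E →L[ℝ] E := 1 - V.comp P₀ with hQ
  set W : E →L[ℝ] E := Q.comp S with hWdef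
  set K : E →L[ℝ] C := P₀.comp S - G.comp P₀ with hK
  have ha : 0 ≤ a := by simpa using (norm_nonneg _).trans (hW 0)
  have hb : 0 ≤ b := by simpa using (norm_nonneg _).trans (hG' 0)
  have hQa : ∀ f, Q f = f - V (P₀ f) := fun f => rfl
  have hQV : ∀ c, Q (V c) = 0 := fun c => by rw [hQa, hPV, sub_self]
  have hKa : ∀ f, K f = P₀ (S f) - G (P₀ f) := fun f => rfl
  have hKV : ∀ c, K (V c) = 0 := fun c => by rw [hKa, hSV, hPV, hPV, sub_self]
  have hSVn : ∀ (n : ℕ) c, (S ^ n) (V c) = V ((G ^ n) c) := by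
    intro n
    induction n with
    | zero => exact fun c => rfl
    | succ n ih =>
      intro c
      rw [pow_succ, mul_apply_eq_comp, hSV, ih, pow_succ, mul_apply_eq_comp]
  -- The defect K vanishes on the range of V, so it sees S only modulo that range, where S decays
  -- like W although S itself need not.
  have hKW : ∀ (n : ℕ) f, K ((W ^ n) f) = K ((S ^ n) f) := by
    intro n
    induction n with
    | zero => exact fun f => rfl
    | succ n ih =>
      intro f
      rw [pow_succ, mul_apply_eq_comp, ih, pow_succ, mul_apply_eq_comp, hWdef,
        ContinuousLinearMap.comp_apply, hQa, map_sub, map_sub, hSVn, hKV, sub_zero]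
  have hQS : ∀ (n : ℕ) f, Q ((S ^ n) f) = (W ^ n) (Q f) := by
    intro n
    induction n with
    | zero => exact fun f => rfl
    | succ n ih =>
      intro f
      have h1 : Q (S f) = W (Q f) := by
        rw [hWdef, ContinuousLinearMap.comp_apply, hQa f, map_sub, map_sub, hSV, hQV, sub_zero]
      rw [pow_succ, mul_apply_eq_comp, ih, h1, pow_succ, mul_apply_eq_comp]
  -- The increments of the formal limit of G'ⁿ P₀ Sⁿ. They are bounded by a multiple of (r q)ⁿ.
  let T : ℕ → E →L[ℝ] C := fun n => (G' ^ (n + 1)).comp (K.comp (S ^ n))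
  have hT : ∀ n, ‖T n‖ ≤ b * r * ‖K‖ * a * (r * q) ^ n := by
    intro n
    have : T n = (G' ^ (n + 1)).comp (K.comp (W ^ n)) := by
      ext1 f
      simp only [T, ContinuousLinearMap.comp_apply]
      rw [hKW]
    rw [this]
    calc _ ≤ ‖G' ^ (n + 1)‖ * (‖K‖ * ‖W ^ n‖) :=
          (ContinuousLinearMap.opNorm_comp_le _ _).trans
            (by gcongr; exact ContinuousLinearMap.opNorm_comp_le _ _)
      _ ≤ (b * r ^ (n + 1)) * (‖K‖ * (a * q ^ n)) := by gcongr; exacts [hG' _, hW _]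
      _ = _ := by ring
  have hsum : Summable T := Summable.of_norm_bounded
    ((summable_geometric_of_lt_one (by positivity) hqr).mul_left _) hT
  have hTx : ∀ f, HasSum (fun n => T n f) ((∑' n, T n) f) := fun f =>
    hsum.hasSum.mapL (ContinuousLinearMap.apply ℝ C f)
  set P : E →L[ℝ] C := P₀ + ∑' n, T n with hP
  have hPa : ∀ f, P f = P₀ f + (∑' n, T n) f := fun f => rfl
  have hPV' : ∀ c, P (V c) = c := by
    intro c
    have h1 : ∀ n, T n (V c) = 0 := fun n => by
      simp only [T, ContinuousLinearMap.comp_apply]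
      rw [hSVn, hKV, map_zero]
    have h2 := hTx (V c)
    simp only [h1] at h2
    rw [hPa, hPV, h2.unique hasSum_zero, add_zero]
  -- Telescoping: G T_{n+1} = T_n S, and the remaining term G T_0 = K is the failure of P₀ to
  -- intertwine.
  have hPS : ∀ f, P (S f) = G (P f) := by
    intro f
    have h1 := (hasSum_nat_add_iff' 1).2 (hTx f)
    have h2 : HasSum (fun n => G (T (n + 1) f)) _ := h1.mapL G
    have h3 : ∀ n, G (T (n + 1) f) = T n (S f) := by
      intro n
      simp only [T, ContinuousLinearMap.comp_apply]
      rw [pow_succ' G' (n + 1), mul_apply_eq_comp, hGG', pow_succ S, mul_apply_eq_comp]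
    simp only [h3] at h2
    have h4 := (hTx (S f)).unique h2
    have h5 : G (T 0 f) = K f := by
      simp only [T, ContinuousLinearMap.comp_apply]
      rw [zero_add, pow_one, hGG']
      rfl
    rw [hPa, hPa, h4]
    simp only [Finset.range_one, Finset.sum_singleton, map_sub, map_add]
    rw [h5, hKa]
    abel
  refine ⟨P, hPV', hPS, (1 + ‖V‖ * ‖P‖) * (a * ‖Q‖), by positivity, fun n f hf => ?_⟩
  have hPn : P ((S ^ n) f) = 0 := by
    induction n with
    | zero => exact hf
    | succ n ih => rw [pow_succ', mul_apply_eq_comp, hPS, ih, map_zero]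
  -- On the kernel of P, a vector is determined by its image under Q, which evolves under W; the
  -- component along V is recovered from P (Sⁿ f) = 0.
  have h1 : (S ^ n) f = (W ^ n) (Q f) - V (P ((W ^ n) (Q f))) := by
    rw [← hQS, hQa, map_sub, hPn, hPV', zero_sub, map_neg, sub_neg_eq_add, sub_add_cancel]
  have h2 : ‖(W ^ n) (Q f)‖ ≤ a * q ^ n * (‖Q‖ * ‖f‖) :=
    ((W ^ n).le_opNorm _).trans (by gcongr; exacts [hW n, Q.le_opNorm f])
  rw [h1]
  calc _ ≤ ‖(W ^ n) (Q f)‖ + ‖V‖ * (‖P‖ * ‖(W ^ n) (Q f)‖) :=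
        (norm_sub_le _ _).trans (by
          gcongr
          exact (V.le_opNorm _).trans (by gcongr; exact P.le_opNorm _))
    _ = (1 + ‖V‖ * ‖P‖) * ‖(W ^ n) (Q f)‖ := by ring
    _ ≤ (1 + ‖V‖ * ‖P‖) * (a * q ^ n * (‖Q‖ * ‖f‖)) := by gcongr
    _ = _ := by ring

end SpectralProjection

/-! ### The multinomial centre subspace and the dynamics on it -/

section CentreMap

open scoped Classical

variable {H : Type*} [NormedAddCommGroup H] [InnerProductSpace ℝ H]
  {M N m : ℕ} {D : Submodule ℝ H} {L : (Fin M → ℕ) → D →ₗ[ℝ] H}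
  {V₀ Z₀ : Fin m → H} {A : (Fin M → ℕ) → Matrix (Fin m) (Fin m) ℝ} {V : (Fin M → ℕ) → Fin m → H}

theorem centreCombination_apply (N : ℕ) (V : (Fin M → ℕ) → Fin m → H)
    (c : multiIndices M N → Fin m → ℝ) (k : multiIndices M N) :
    centreCombination N V c k
      = ∑ n : multiIndices M N, if k.1 ≤ n.1 then combination (V (n.1 - k.1)) (c n) else 0 := by
  simp only [centreCombination, Finset.sum_apply, Pi.smul_apply, centreVector]
  refine Finset.sum_congr rfl fun n _ => ?_
  split_ifs
  · rfl
  · simp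

/-- The parametrisation of the multinomial centre subspace by coefficients. -/
def centreMap (N : ℕ) (V : (Fin M → ℕ) → Fin m → H) : Jet M N (Fin m → ℝ) →L[ℝ] Jet M N H :=
  LinearMap.toContinuousLinearMap
    { toFun := centreCombination N V
      map_add' := fun c c' => by simp [centreCombination, add_smul, Finset.sum_add_distrib]
      map_smul' := fun r c => by simp [centreCombination, mul_smul, Finset.smul_sum] }

theorem centreMap_apply (c : Jet M N (Fin m → ℝ)) : centreMap N V c = centreCombination N V c := rfl

/-- The operator `∑ A_n ∂_ξ^n` on multinomials with coefficients in `ℝ^m`. -/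
def centreOp (N : ℕ) (A : (Fin M → ℕ) → Matrix (Fin m) (Fin m) ℝ) :
    Jet M N (Fin m → ℝ) →L[ℝ] Jet M N (Fin m → ℝ) :=
  ContinuousLinearMap.pi fun k => ∑ n : multiIndices M N,
    if k.1 ≤ n.1 then (matrixOp (A (n.1 - k.1))).comp (ContinuousLinearMap.proj n) else 0

theorem centreOp_apply (c : Jet M N (Fin m → ℝ)) (k : multiIndices M N) :
    centreOp N A c k
      = ∑ n : multiIndices M N, if k.1 ≤ n.1 then A (n.1 - k.1) *ᵥ c n else 0 := by
  simp only [centreOp, ContinuousLinearMap.pi_apply, sum_apply]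
  refine Finset.sum_congr rfl fun n _ => ?_
  split_ifs <;> rfl

theorem sum_ite_le_eq_of_vanishesFrom {E F : Type*} [NormedAddCommGroup E] [NormedAddCommGroup F]
    {f : Jet M N E} {k : multiIndices M N} (hf : VanishesFrom (order k.1 + 1) f)
    (g : multiIndices M N → E → F) (hg : ∀ n, g n 0 = 0) :
    (∑ n : multiIndices M N, if k.1 ≤ n.1 then g n (f n) else 0) = g k (f k) := by
  classical
  rw [Finset.sum_eq_single k]
  · simp
  · intro n _ hn
    split_ifs with h
    · rw [hf n (order_lt_of_ne h fun h' => hn (Subtype.ext h'.symm)), hg]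
    · rfl
  · simp

theorem isTriangular_centreMap : IsTriangular (centreMap N V) (combination (V 0)) := by
  intro c k hc
  rw [centreMap_apply, centreCombination_apply,
    sum_ite_le_eq_of_vanishesFrom hc (fun n => combination (V (n.1 - k.1))) (by simp), tsub_self]

theorem isTriangular_centreOp : IsTriangular (centreOp N A) (matrixOp (A 0)) := by
  intro c k hc
  rw [centreOp_apply,
    sum_ite_le_eq_of_vanishesFrom hc (fun n v => A (n.1 - k.1) *ᵥ v) (by simp), tsub_self]
  rfl

theorem sub_mem_multiIndices {n k : Fin M → ℕ} (hn : n ∈ multiIndices M N) :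
    n - k ∈ multiIndices M N := by
  refine mem_multiIndices.2 (le_trans ?_ (order_le_of_mem hn))
  exact Finset.sum_le_sum fun i _ => Nat.sub_le _ _

theorem mem_multiIndices_of_le {n k : Fin M → ℕ} (hn : n ∈ multiIndices M N) (hk : k ≤ n) :
    k ∈ multiIndices M N :=
  mem_multiIndices.2 (le_trans (Finset.sum_le_sum fun i _ => hk i) (order_le_of_mem hn))

/-- The recursion with the terms of index 0 moved into the sums, which includes L_0 V⁰ = V⁰ A_0 as
the case p = 0. In this symmetric form it is the coefficientwise statement of L̃𝒱 = 𝒱𝒜. -/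
theorem CentreRecursion.sum_eq (h : CentreRecursion N L V₀ Z₀ A V) {p : Fin M → ℕ}
    (hp : p ∈ multiIndices M N) (c : Fin m → ℝ) :
    ∑ l ∈ Finset.Iic p, opApply (op L l) (combination (V (p - l)) c)
      = ∑ l ∈ Finset.Iic p, combination (V (p - l)) (A l *ᵥ c) := by
  have hcol : ∀ j, ∑ l ∈ Finset.Iic p, opApply (op L l) (V (p - l) j)
      = ∑ l ∈ Finset.Iic p, ∑ i, A l i j • V (p - l) i := by
    intro j
    have h0 : (0 : Fin M → ℕ) ∈ Finset.Iic p := Finset.mem_Iic.2 fun i => Nat.zero_le _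
    rw [← Finset.add_sum_erase _ _ h0, ← Finset.add_sum_erase _ _ h0]
    by_cases hp0 : p = 0
    · subst hp0
      have : (Finset.Iic (0 : Fin M → ℕ)).erase 0 = ∅ := by
        ext k
        simp only [Finset.mem_erase, Finset.mem_Iic, Finset.notMem_empty, iff_false, not_and]
        exact fun hk hk' => hk (le_antisymm hk' fun i => Nat.zero_le _)
      rw [this]
      simp [h.V_zero, h.A_zero]
    · have := h.V_eq p hp hp0 j
      rw [sub_eq_iff_eq_add] at this
      rw [tsub_zero, this]
      abel
  have h1 : ∀ l, opApply (op L l) (combination (V (p - l)) c)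
      = ∑ j, c j • opApply (op L l) (V (p - l) j) := fun l =>
    opApply_combination (F := op L l) (fun j => h.V_mem _ (sub_mem_multiIndices hp) j) c
  simp only [h1, combination_mulVec]
  rw [Finset.sum_comm, Finset.sum_comm (s := Finset.Iic p)]
  simp only [← Finset.smul_sum, hcol]

theorem CentreRecursion.centreMap_mem_domain (h : CentreRecursion N L V₀ Z₀ A V)
    (c : Jet M N (Fin m → ℝ)) : centreMap N V c ∈ (jetOperator N L).domain := by
  refine mem_jetOperator_domain.2 fun k => ?_
  rw [centreMap_apply, centreCombination_apply]
  refine D.sum_mem fun n _ => ?_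
  split_ifs
  · rw [combination_apply]
    exact D.sum_mem fun j _ => D.smul_mem _ (h.V_mem _ (sub_mem_multiIndices n.2) j)
  · exact D.zero_mem

/-- At position k, the contribution of c_n to either side is a sum over l ≤ n - k, and the two sums
agree by the recursion at n - k. -/
theorem CentreRecursion.opApply_centreMap (h : CentreRecursion N L V₀ Z₀ A V)
    (c : Jet M N (Fin m → ℝ)) :
    opApply (jetOperator N L) (centreMap N V c) = centreMap N V (centreOp N A c) := by
  funext k
  have hmem := fun n => mem_jetOperator_domain.1 (h.centreMap_mem_domain c) n
  have hcomb : ∀ (n : multiIndices M N) (l : Fin M → ℕ) (x : Fin m → ℝ),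
      combination (V (n.1 - l)) x ∈ D := fun n l x => by
    rw [combination_apply]
    exact D.sum_mem fun j _ => D.smul_mem _ (h.V_mem _ (sub_mem_multiIndices n.2) j)
  rw [opApply_jetOperator hmem, centreMap_apply, centreMap_apply, centreCombination_apply]
  have e1 : ∀ l ∈ multiIndices M N, (if hl : k.1 + l ∈ multiIndices M N then
      opApply (op L l) (centreCombination N V c ⟨k.1 + l, hl⟩) else 0)
      = ∑ n : multiIndices M N, if k.1 + l ≤ n.1 then
        opApply (op L l) (combination (V (n.1 - (k.1 + l))) (c n)) else 0 := by
    intro l _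
    by_cases hl : k.1 + l ∈ multiIndices M N
    · rw [dif_pos hl, centreCombination_apply, opApply_sum]
      · refine Finset.sum_congr rfl fun n _ => ?_
        split_ifs
        · rfl
        · exact opApply_zero _
      · intro n _
        change _ ∈ D
        split_ifs
        · exact hcomb n _ _
        · exact D.zero_mem
    · rw [dif_neg hl, Finset.sum_eq_zero]
      intro n _
      rw [if_neg fun h' => hl (mem_multiIndices_of_le n.2 h')]
  have e2 : ∀ q : multiIndices M N,
      (if k.1 ≤ q.1 then combination (V (q.1 - k.1)) (centreOp N A c q) else 0)
      = ∑ n : multiIndices M N, if k.1 ≤ q.1 ∧ q.1 ≤ n.1 then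
        combination (V (q.1 - k.1)) (A (n.1 - q.1) *ᵥ c n) else 0 := by
    intro q
    by_cases hq : k.1 ≤ q.1
    · rw [if_pos hq, centreOp_apply, map_sum]
      refine Finset.sum_congr rfl fun n _ => ?_
      by_cases hn : q.1 ≤ n.1
      · rw [if_pos hn, if_pos ⟨hq, hn⟩]
      · rw [if_neg hn, if_neg fun h' => hn h'.2, map_zero]
    · rw [if_neg hq, Finset.sum_eq_zero]
      intro n _
      rw [if_neg fun h' => hq h'.1]
  rw [Finset.sum_congr rfl e1, Finset.sum_congr rfl fun q _ => e2 q]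
  refine Finset.sum_comm.trans (Eq.trans ?_ Finset.sum_comm)
  refine Finset.sum_congr rfl fun n _ => ?_
  by_cases hkn : k.1 ≤ n.1
  · have h1 : (∑ l ∈ multiIndices M N, if k.1 + l ≤ n.1 then
        opApply (op L l) (combination (V (n.1 - (k.1 + l))) (c n)) else 0)
        = ∑ l ∈ Finset.Iic (n.1 - k.1), opApply (op L l) (combination (V (n.1 - k.1 - l)) (c n)) := by
      rw [← Finset.sum_filter]
      refine Finset.sum_congr ?_ fun l _ => by rw [tsub_add_eq_tsub_tsub]
      ext l
      rw [Finset.mem_filter, Finset.mem_Iic, le_tsub_iff_left hkn]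
      exact ⟨fun h => h.2, fun h => ⟨mem_multiIndices_of_le n.2 (le_trans le_add_self h), h⟩⟩
    have h2 : (∑ q : multiIndices M N, if k.1 ≤ q.1 ∧ q.1 ≤ n.1 then
        combination (V (q.1 - k.1)) (A (n.1 - q.1) *ᵥ c n) else 0)
        = ∑ l ∈ Finset.Iic (n.1 - k.1), combination (V (n.1 - k.1 - l)) (A l *ᵥ c n) := by
      rw [← Finset.sum_filter]
      symm
      -- Substitution q = n - l of the intermediate index.
      refine Finset.sum_bij' (i := fun l _ => (⟨n.1 - l, sub_mem_multiIndices n.2⟩ : multiIndices M N))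
        (j := fun q _ => n.1 - q.1) ?_ ?_ ?_ ?_ ?_
      · intro l hl
        rw [Finset.mem_Iic, le_tsub_iff_left hkn] at hl
        refine Finset.mem_filter.2 ⟨Finset.mem_univ _, ?_, tsub_le_self⟩
        exact le_tsub_of_add_le_right hl
      · intro q hq
        obtain ⟨-, hq1, hq2⟩ := Finset.mem_filter.1 hq
        exact Finset.mem_Iic.2 (tsub_le_tsub_left hq1 _)
      · intro l hl
        rw [Finset.mem_Iic] at hl
        exact tsub_tsub_cancel_of_le (hl.trans tsub_le_self)
      · intro q hq
        obtain ⟨-, hq1, hq2⟩ := Finset.mem_filter.1 hq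
        exact Subtype.ext (tsub_tsub_cancel_of_le hq2)
      · intro l hl
        rw [Finset.mem_Iic] at hl
        rw [tsub_tsub_cancel_of_le (hl.trans tsub_le_self), tsub_right_comm]
    rw [h1, h2, h.sum_eq (sub_mem_multiIndices n.2)]
  · rw [Finset.sum_eq_zero, Finset.sum_eq_zero]
    · intro q _
      rw [if_neg fun h' => hkn (h'.1.trans h'.2)]
    · intro l _
      rw [if_neg fun h' => hkn (le_trans le_self_add h')]

theorem CentreRecursion.innerVec_combination [CompleteSpace H] {L₀ : H →ₗ.[ℝ] H} {α : ℝ}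
    (h : CentreRecursion N L V₀ Z₀ A V) (hb : CentreBases L₀ α V₀ Z₀) {n : Fin M → ℕ}
    (hn : n ∈ multiIndices M N) (c : Fin m → ℝ) :
    innerVec Z₀ (combination (V n) c) = if n = 0 then c else 0 := by
  split_ifs with h0
  · rw [h0, h.V_zero, hb.innerVec_combination]
  · funext i
    simp [combination_apply, inner_sum, real_inner_smul_right, h.V_orth n hn h0]

/-- Only V^0 has a nonzero product with Z⁰. So c consists of the macroscale coefficients of 𝒱c,
which is also what makes the A_n act directly on derivatives of U. -/
theorem CentreRecursion.innerVec_centreMap [CompleteSpace H] {L₀ : H →ₗ.[ℝ] H} {α : ℝ}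
    (h : CentreRecursion N L V₀ Z₀ A V) (hb : CentreBases L₀ α V₀ Z₀) (c : Jet M N (Fin m → ℝ)) :
    diagonal M N (innerVec Z₀) (centreMap N V c) = c := by
  classical
  funext k
  rw [diagonal_apply, centreMap_apply, centreCombination_apply, map_sum, Finset.sum_eq_single k]
  · rw [if_pos le_rfl, h.innerVec_combination hb (sub_mem_multiIndices k.2), if_pos (tsub_self _)]
  · intro n _ hn
    split_ifs with hk
    · rw [h.innerVec_combination hb (sub_mem_multiIndices n.2), if_neg]
      exact fun h0 => hn (Subtype.ext (le_antisymm (tsub_eq_zero_iff_le.1 h0) hk))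
    · exact map_zero _
  · simp

theorem CentreRecursion.semigroup_centreMap [CompleteSpace H]
    {S : ℝ → Jet M N H →L[ℝ] Jet M N H} (h : CentreRecursion N L V₀ Z₀ A V)
    (hS : GeneratesSemigroup (jetOperator N L) S) (c : Jet M N (Fin m → ℝ)) {t : ℝ} (ht : 0 ≤ t) :
    S t (centreMap N V c) = centreMap N V (NormedSpace.exp (t • centreOp N A) c) := by
  let y : ℝ → Jet M N (Fin m → ℝ) := fun t => NormedSpace.exp (t • centreOp N A) c
  have hy : ∀ t, HasDerivAt y (centreOp N A (y t)) t := by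
    intro t
    have h1 := (hasDerivAt_exp_smul_const' (𝕂 := ℝ) (centreOp N A) t).clm_apply
      (hasDerivAt_const t c)
    refine HasDerivAt.congr_deriv h1 ?_
    simp [y]
  have hy' : ∀ t, HasDerivAt (fun s => centreMap N V (y s)) (centreMap N V (centreOp N A (y t))) t :=
    fun t => (centreMap N V).hasFDerivAt.comp_hasDerivAt t (hy t)
  have := hS.eq_of_hasDerivWithinAt ht (g := fun s => centreMap N V (y s))
    (fun s _ => (hy' s).continuousAt.continuousWithinAt)
    (fun s _ => (hy' s).hasDerivWithinAt) (fun s _ => by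
      rw [← h.opApply_centreMap]
      exact mk_opApply_mem_graph (h.centreMap_mem_domain _))
  simp only [y, zero_smul, NormedSpace.exp_zero, one_apply_eq_self] at this
  exact this.symm

theorem jetCentreSubspace_eq_range (N : ℕ) (V : (Fin M → ℕ) → Fin m → H) :
    jetCentreSubspace N V
      = LinearMap.range (centreMap N V : Jet M N (Fin m → ℝ) →ₗ[ℝ] Jet M N H) := by
  classical
  refine le_antisymm (Submodule.span_le.2 ?_) ?_
  · rintro _ ⟨⟨n, j⟩, rfl⟩
    refine ⟨Pi.single n (Pi.single j 1), ?_⟩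
    change centreCombination N V _ = _
    rw [centreCombination, Finset.sum_eq_single n, Finset.sum_eq_single j]
    · simp
    · intro i _ hi
      simp [hi]
    · simp
    · intro k _ hk
      simp [hk]
    · simp
  · rintro _ ⟨c, rfl⟩
    exact Submodule.sum_mem _ fun n _ => Submodule.sum_mem _ fun j _ =>
      Submodule.smul_mem _ _ (Submodule.subset_span ⟨(n, j), rfl⟩)

end CentreMap

/-! ### Decaying states and eigenvectors among them -/

section DecayingSubspace

variable {E : Type*} [NormedAddCommGroup E] [NormedSpace ℝ E] {A : E →ₗ.[ℝ] E}
  {S : ℝ → E →L[ℝ] E} {α : ℝ}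

theorem mem_decayingSubspace_of_norm_le {f : E} {C γ : ℝ} (hγ : α < γ)
    (h : ∀ t, 0 ≤ t → ‖S t f‖ ≤ C * Real.exp (-γ * t)) : f ∈ decayingSubspace S α := by
  refine ⟨γ, hγ, IsBigO.of_bound C ?_⟩
  filter_upwards [eventually_ge_atTop 0] with t ht
  rw [Real.norm_eq_abs, Real.abs_exp]
  exact h t ht

theorem GeneratesSemigroup.map_decayingSubspace (hS : GeneratesSemigroup A S) {f : E}
    (hf : f ∈ decayingSubspace S α) {s : ℝ} (hs : 0 ≤ s) : S s f ∈ decayingSubspace S α := by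
  obtain ⟨γ, hγ, hO⟩ := hf
  refine ⟨γ, hγ, ?_⟩
  have h1 := hO.comp_tendsto (tendsto_atTop_add_const_right atTop s tendsto_id)
  have h2 : ((fun t : ℝ => Real.exp (-γ * t)) ∘ fun t => id t + s)
      = fun t => Real.exp (-γ * s) * Real.exp (-γ * t) := by
    funext t
    simp only [Function.comp_apply, id]
    rw [← Real.exp_add]
    ring_nf
  rw [h2] at h1
  refine (h1.trans (isBigO_const_mul_self _ _ _)).congr' ?_ EventuallyEq.rfl
  filter_upwards [eventually_ge_atTop 0] with t ht
  simp [hS.add t s ht hs]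

theorem GeneratesSemigroup.opApply_mem_decayingSubspace (hS : GeneratesSemigroup A S)
    (hcl : IsClosed (decayingSubspace S α : Set E)) {f : E} (hf : f ∈ decayingSubspace S α)
    (hfA : f ∈ A.domain) : opApply A f ∈ decayingSubspace S α := by
  refine hcl.mem_of_tendsto ((hS.generator _ _).1 (mk_opApply_mem_graph hfA)) ?_
  filter_upwards [self_mem_nhdsWithin] with t ht
  exact Submodule.smul_mem _ _ (Submodule.sub_mem _ (hS.map_decayingSubspace hf (le_of_lt ht)) hf)

theorem GeneratesSemigroup.pow_eq (hS : GeneratesSemigroup A S) (n : ℕ) : S 1 ^ n = S n := by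
  induction n with
  | zero => rw [pow_zero, Nat.cast_zero, hS.zero]; rfl
  | succ n ih => rw [pow_succ, ih, Nat.cast_succ, hS.add n 1 (Nat.cast_nonneg n) zero_le_one]; rfl

/-- Integer times suffice: over the fractional part the semigroup is bounded, and rounding down
costs a factor e^γ as γ ≥ 0. The constant does not depend on f. -/
theorem GeneratesSemigroup.exists_norm_le_of_pow [CompleteSpace E] (hS : GeneratesSemigroup A S)
    {γ d : ℝ} (hγ : 0 ≤ γ) (hd : 0 ≤ d) :
    ∃ C : ℝ, ∀ f : E, (∀ n : ℕ, ‖(S 1 ^ n) f‖ ≤ d * Real.exp (-γ) ^ n * ‖f‖) →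
      ∀ t, 0 ≤ t → ‖S t f‖ ≤ C * Real.exp (-γ * t) * ‖f‖ := by
  obtain ⟨B, hB0, hB⟩ := hS.stronglyContinuous.exists_bound 1
  refine ⟨B * d * Real.exp γ, fun f hf t ht => ?_⟩
  have h1 := Nat.floor_le ht
  have h2 := Nat.lt_floor_add_one t
  set n := ⌊t⌋₊
  have h3 : S t f = S (t - n) ((S 1 ^ n) f) := by
    rw [hS.pow_eq]
    have := hS.add (t - n) n (by linarith) (Nat.cast_nonneg n)
    rw [sub_add_cancel] at this
    rw [this]
    rfl
  have h4 : Real.exp (-γ) ^ n ≤ Real.exp γ * Real.exp (-γ * t) := by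
    rw [← Real.exp_nat_mul, ← Real.exp_add]
    refine Real.exp_le_exp.2 ?_
    nlinarith
  rw [h3]
  calc _ ≤ B * ‖(S 1 ^ n) f‖ := ((S _).le_opNorm _).trans (by
        gcongr
        exact hB _ ⟨by linarith, by linarith⟩)
    _ ≤ B * (d * (Real.exp γ * Real.exp (-γ * t)) * ‖f‖) := by
        gcongr
        exact (hf n).trans (by gcongr)
    _ = _ := by ring

/-- The last nonzero member of a chain is an eigenvector, and it remains in any invariant p. -/
theorem IsChain.exists_eigenvector {lam : ℂ} {p : Submodule ℝ E}
    (hp : ∀ f ∈ p, f ∈ A.domain → opApply A f ∈ p) {k : ℕ} {w : E × E} (hw : w ≠ 0)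
    (hwp : PairMem p w) (h : IsChain A lam k w) :
    ∃ e : E × E, e ≠ 0 ∧ PairMem p e ∧ IsChain A lam 1 e := by
  induction k generalizing w with
  | zero => exact absurd (isChain_zero.1 h) hw
  | succ k ih =>
    obtain ⟨h1, h2⟩ := isChain_succ.1 h
    by_cases h0 : complexShift A lam w = 0
    · exact ⟨w, hw, hwp, isChain_succ.2 ⟨h1, isChain_zero.2 h0⟩⟩
    · refine ih h0 ⟨?_, ?_⟩ h2
      · exact p.add_mem (p.sub_mem (hp _ hwp.1 h1.1) (p.smul_mem _ hwp.1)) (p.smul_mem _ hwp.2)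
      · exact p.sub_mem (p.sub_mem (hp _ hwp.2 h1.2) (p.smul_mem _ hwp.2)) (p.smul_mem _ hwp.1)

theorem IsChain.semigroup_apply [CompleteSpace E] (hS : GeneratesSemigroup A S) {lam : ℂ}
    {e : E × E} (h : IsChain A lam 1 e) {t : ℝ} (ht : 0 ≤ t) :
    cmul (Complex.exp (lam * t)) e = (S t e.1, S t e.2) := by
  obtain ⟨h1, h2⟩ := isChain_succ.1 h
  have h3 : pairApply A e = cmul lam e := by
    rw [pairApply_eq (lam := lam), isChain_zero.1 h2, add_zero]
  have := hS.apply_eq_of_hasDerivAt (y := fun t => cmul (Complex.exp (lam * t)) e)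
    (fun t => h1.cmul _) (fun t => ?_) ht
  · simpa using this
  · rw [pairApply_cmul h1, h3, cmul_cmul]
    have h4 : HasDerivAt (fun s : ℝ => Complex.exp (lam * s)) (Complex.exp (lam * t) * lam) t := by
      simpa using ((Complex.ofRealCLM.hasDerivAt (x := t)).const_mul lam).cexp
    exact hasDerivAt_cmul h4 e

/-- For an eigenvector, e = e^{-λt} S t e at all times t ≥ 0. If Re λ ≥ -α, decay faster than
e^{-αt} makes the right-hand side tend to zero. -/
theorem IsChain.re_lt_of_decay [CompleteSpace E] (hS : GeneratesSemigroup A S) {lam : ℂ}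
    {e : E × E} (he : e ≠ 0) (h : IsChain A lam 1 e)
    (hd : PairMem (decayingSubspace S α) e) : lam.re < -α := by
  by_contra! hlam
  have key : ∀ f ∈ decayingSubspace S α,
      Tendsto (fun t : ℝ => Real.exp (-lam.re * t) * ‖S t f‖) atTop (𝓝 0) := by
    rintro f ⟨γ, hγ, hO⟩
    have h1 := ((isBigO_refl (fun t : ℝ => Real.exp (-lam.re * t)) atTop).mul hO.norm_left)
    refine h1.trans_tendsto ?_
    have h2 : ∀ t : ℝ, Real.exp (-lam.re * t) * Real.exp (-γ * t)
        = Real.exp ((-lam.re - γ) * t) := fun t => by rw [← Real.exp_add]; ring_nf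
    simp only [h2]
    exact Real.tendsto_exp_atBot.comp (tendsto_id.const_mul_atTop_of_neg (by linarith))
  have h3 : Tendsto (fun t : ℝ => 2 * (Real.exp (-lam.re * t) * ‖S t e.1‖
      + Real.exp (-lam.re * t) * ‖S t e.2‖)) atTop (𝓝 0) := by
    simpa using ((key _ hd.1).add (key _ hd.2)).const_mul 2
  have h4 : ∀ᶠ t : ℝ in atTop, ‖e‖ ≤ 2 * (Real.exp (-lam.re * t) * ‖S t e.1‖
      + Real.exp (-lam.re * t) * ‖S t e.2‖) := by
    filter_upwards [eventually_ge_atTop 0] with t ht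
    have h5 : e = cmul (Complex.exp (-(lam * t))) (S t e.1, S t e.2) := by
      rw [← h.semigroup_apply hS ht, cmul_cmul, ← Complex.exp_add]
      simp
    have h6 := norm_cmul_le (Complex.exp (-(lam * t))) (S t e.1, S t e.2)
    rw [← h5, Complex.norm_exp] at h6
    have h7 : (-(lam * (t : ℂ))).re = -lam.re * t := by simp
    have h8 : ‖(S t e.1, S t e.2)‖ ≤ ‖S t e.1‖ + ‖S t e.2‖ :=
      max_le (le_add_of_nonneg_right (norm_nonneg _)) (le_add_of_nonneg_left (norm_nonneg _))
    rw [h7] at h6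
    calc ‖e‖ ≤ _ := h6
      _ ≤ 2 * Real.exp (-lam.re * t) * (‖S t e.1‖ + ‖S t e.2‖) := by gcongr
      _ = _ := by ring
  have := ge_of_tendsto h3 h4
  exact he (norm_le_zero_iff.1 this)

end DecayingSubspace

/-! ### Spectrum and spectral projection of the multinomial operator -/

section JetSpectrum

variable {H : Type*} [NormedAddCommGroup H] [InnerProductSpace ℝ H]
  {M N m : ℕ} {D : Submodule ℝ H} {L : (Fin M → ℕ) → D →ₗ[ℝ] H} {lam : ℂ}

theorem IsChain.coeff {k : ℕ} {w : Jet M N H × Jet M N H} {n : multiIndices M N}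
    (h : IsChain (jetOperator N L) lam k w) (h1 : VanishesFrom (order n.1 + 1) w.1)
    (h2 : VanishesFrom (order n.1 + 1) w.2) : IsChain (op L 0) lam k (w.1 n, w.2 n) := by
  induction k generalizing w with
  | zero => rw [isChain_zero.1 h]; exact isChain_zero.2 rfl
  | succ k ih =>
    obtain ⟨h3, h4⟩ := isChain_succ.1 h
    have h31 := mem_jetOperator_domain.1 h3.1
    have h32 := mem_jetOperator_domain.1 h3.2
    have hvan : ∀ f : Jet M N H, (∀ n, f n ∈ D) → VanishesFrom (order n.1 + 1) f →
        VanishesFrom (order n.1 + 1) (opApply (jetOperator N L) f) := by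
      intro f hf hfn l hl
      rw [opApply_jetOperator_of_vanishesFrom hf (fun q hq => hfn q (by omega)), hfn l hl,
        opApply_zero]
    refine isChain_succ.2 ⟨⟨h31 n, h32 n⟩, ?_⟩
    have h5 : complexShift (op L 0) lam (w.1 n, w.2 n)
        = ((complexShift (jetOperator N L) lam w).1 n, (complexShift (jetOperator N L) lam w).2 n) := by
      simp only [complexShift, Pi.add_apply, Pi.sub_apply, Pi.smul_apply,
        opApply_jetOperator_of_vanishesFrom h31 h1, opApply_jetOperator_of_vanishesFrom h32 h2]
    rw [h5]
    refine ih h4 (fun l hl => ?_) (fun l hl => ?_)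
    · simp only [complexShift, Pi.add_apply, Pi.sub_apply, Pi.smul_apply, hvan _ h31 h1 l hl,
        h1 l hl, h2 l hl, smul_zero, sub_zero, add_zero]
    · simp only [complexShift, Pi.sub_apply, Pi.smul_apply, hvan _ h32 h2 l hl,
        h1 l hl, h2 l hl, smul_zero, sub_zero]

/-- A nonzero coefficient of maximal order inherits the chain, since there the operator acts as L_0.
-/
theorem IsGenEigenvector.exists_coeff {w : Jet M N H × Jet M N H}
    (h : IsGenEigenvector (jetOperator N L) lam w) : ∃ v, IsGenEigenvector (op L 0) lam v := by
  classical
  obtain ⟨hw, k, hk⟩ := h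
  have hne : (Finset.univ.filter fun n : multiIndices M N => (w.1 n, w.2 n) ≠ 0).Nonempty := by
    by_contra h0
    rw [Finset.not_nonempty_iff_eq_empty, Finset.filter_eq_empty_iff] at h0
    refine hw (Prod.ext (funext fun n => ?_) (funext fun n => ?_))
    · exact congrArg Prod.fst (not_not.1 (h0 (Finset.mem_univ n)))
    · exact congrArg Prod.snd (not_not.1 (h0 (Finset.mem_univ n)))
  obtain ⟨n, hn, hmax⟩ := Finset.exists_max_image _ (fun n => order n.1) hne
  have hvan : ∀ l : multiIndices M N, order n.1 + 1 ≤ order l.1 → (w.1 l, w.2 l) = 0 := by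
    intro l hl
    by_contra h0
    have := hmax l (Finset.mem_filter.2 ⟨Finset.mem_univ _, h0⟩)
    omega
  exact ⟨_, (Finset.mem_filter.1 hn).2, k, IsChain.coeff hk
    (fun l hl => congrArg Prod.fst (hvan l hl)) (fun l hl => congrArg Prod.snd (hvan l hl))⟩

variable [CompleteSpace H] {T : ℝ → H →L[ℝ] H} {α β : ℝ}

/-- A decaying chain contains a decaying eigenvector, so Re λ < -α. As λ is also an eigenvalue of
L_0, the spectral gap improves this to Re λ ≤ -β. -/
theorem IsGenEigenvector.mem_decayingSubspace_iff {S : ℝ → Jet M N H →L[ℝ] Jet M N H}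
    (hT : SpectralSplitting (op L 0) T α β) (hαβ : α < β)
    (hS : GeneratesSemigroup (jetOperator N L) S)
    (hcl : IsClosed (decayingSubspace S α : Set (Jet M N H))) {w : Jet M N H × Jet M N H}
    (h : IsGenEigenvector (jetOperator N L) lam w) :
    w.1 ∈ decayingSubspace S α ∧ w.2 ∈ decayingSubspace S α ↔ lam.re ≤ -β := by
  constructor
  · intro hd
    obtain ⟨hw, k, hk⟩ := id h
    obtain ⟨e, he, hep, hec⟩ := IsChain.exists_eigenvector
      (fun f hf hfA => hS.opApply_mem_decayingSubspace hcl hf hfA) hw hd hk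
    have h1 := hec.re_lt_of_decay hS he hep
    obtain ⟨v, hv⟩ := h.exists_coeff
    rcases hT.eigenvalues lam v hv with h2 | h2
    · have := (abs_le.1 h2).1
      linarith
    · exact h2
  · intro hlam
    obtain ⟨-, k, hk⟩ := h
    obtain ⟨γ, hγ, hγ'⟩ := exists_between hαβ
    obtain ⟨C, hC⟩ := IsChain.exists_norm_semigroup_le hS hk (γ := γ) (by linarith)
    exact ⟨mem_decayingSubspace_of_norm_le hγ fun t ht => (hC t ht).1,
      mem_decayingSubspace_of_norm_le hγ fun t ht => (hC t ht).2⟩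

variable {V₀ Z₀ : Fin m → H} {A : (Fin M → ℕ) → Matrix (Fin m) (Fin m) ℝ}
  {V : (Fin M → ℕ) → Fin m → H}

/-- The operator maps everything into the stable subspace, on which it is T 1; so its powers beyond
the first are values of the decaying semigroup. -/
theorem CentreBases.exists_norm_pow_le (h : CentreBases (op L 0) α V₀ Z₀)
    (hT : SpectralSplitting (op L 0) T α β) (hαβ : α < β) {C₀ γ₀ : ℝ}
    (hC₀ : ∀ t, 0 ≤ t → ∀ v ∈ stableSubspace (op L 0) β, ‖T t v‖ ≤ C₀ * Real.exp (-γ₀ * t) * ‖v‖) :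
    ∃ C : ℝ, ∀ n : ℕ, ‖((1 - (combination V₀).comp (innerVec Z₀)).comp (T 1)) ^ n‖
      ≤ C * Real.exp (-γ₀) ^ n := by
  set Q : H →L[ℝ] H := 1 - (combination V₀).comp (innerVec Z₀) with hQ
  set X := Q.comp (T 1) with hX
  have hQs : ∀ v, Q v ∈ stableSubspace (op L 0) β := by
    intro v
    rw [h.mem_stableSubspace_iff hT hαβ]
    change innerVec Z₀ (v - combination V₀ (innerVec Z₀ v)) = 0
    rw [map_sub, h.innerVec_combination, sub_self]
  have hXs : ∀ v ∈ stableSubspace (op L 0) β, ∀ n : ℕ, (X ^ n) v = T n v := by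
    intro v hv n
    rw [← hT.semigroup.pow_eq]
    induction n with
    | zero => rfl
    | succ n ih =>
      have h1 : (T 1 ^ n) v ∈ stableSubspace (op L 0) β := by
        rw [hT.semigroup.pow_eq]
        exact hT.stable_invariant _ (Nat.cast_nonneg n) v hv
      have h2 := hT.stable_invariant 1 zero_le_one _ h1
      rw [pow_succ', mul_apply_eq_comp, ih, pow_succ', mul_apply_eq_comp]
      change T 1 ((T 1 ^ n) v) - combination V₀ (innerVec Z₀ (T 1 ((T 1 ^ n) v))) = _
      rw [(h.mem_stableSubspace_iff hT hαβ).1 h2, map_zero, sub_zero]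
  -- The summand 1 serves n = 0; the factor e^{γ₀} makes up for the step spent on entering the
  -- stable subspace.
  refine ⟨1 + |C₀| * Real.exp γ₀ * ‖X‖, fun n => ?_⟩
  refine ContinuousLinearMap.opNorm_le_bound _ (by positivity) fun v => ?_
  rcases n with _ | n
  · simp only [pow_zero, one_apply_eq_self, mul_one]
    nlinarith [norm_nonneg v, mul_nonneg (mul_nonneg (abs_nonneg C₀) (Real.exp_pos γ₀).le)
      (norm_nonneg X), mul_nonneg (mul_nonneg (mul_nonneg (abs_nonneg C₀) (Real.exp_pos γ₀).le)
      (norm_nonneg X)) (norm_nonneg v)]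
  · have hXv : X v ∈ stableSubspace (op L 0) β := hQs (T 1 v)
    rw [pow_succ, mul_apply_eq_comp, hXs _ hXv]
    have h1 : Real.exp (-γ₀ * n) = Real.exp γ₀ * Real.exp (-γ₀) ^ (n + 1) := by
      rw [← Real.exp_nat_mul, ← Real.exp_add]
      push_cast
      ring_nf
    calc ‖T n (X v)‖ ≤ C₀ * Real.exp (-γ₀ * n) * ‖X v‖ := hC₀ _ (Nat.cast_nonneg n) _ hXv
      _ ≤ |C₀| * (Real.exp γ₀ * Real.exp (-γ₀) ^ (n + 1)) * (‖X‖ * ‖v‖) := by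
        rw [h1]
        gcongr
        · exact le_abs_self _
        · exact X.le_opNorm v
      _ = (|C₀| * Real.exp γ₀ * ‖X‖) * Real.exp (-γ₀) ^ (n + 1) * ‖v‖ := by ring
      _ ≤ _ := by gcongr; linarith

/-- The operator e^{-𝒜} is triangular with diagonal e^{-A_0}, so its powers grow at any rate above
α; the intermediate α₁ leaves room for the triangular loss. -/
theorem CentreBases.exists_norm_exp_centreOp_pow_le (h : CentreBases (op L 0) α V₀ Z₀)
    (hrec : CentreRecursion N L V₀ Z₀ A V) {α' : ℝ} (hα' : α < α') :
    ∃ C : ℝ, ∀ n : ℕ, ‖NormedSpace.exp (-centreOp N A) ^ n‖ ≤ C * Real.exp α' ^ n := by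
  obtain ⟨α₁, hα₁, hα₁'⟩ := exists_between hα'
  obtain ⟨C, -, hC⟩ := h.exists_norm_exp_le hrec.A_zero hα₁
  have htri : IsTriangular (NormedSpace.exp (-centreOp N A)) (NormedSpace.exp (-matrixOp (A 0))) :=
    isTriangular_centreOp.neg.exp
  have hpow : ∀ n : ℕ, NormedSpace.exp (-matrixOp (A 0)) ^ n
      = NormedSpace.exp ((n : ℝ) • (-matrixOp (A 0))) := by
    intro n
    induction n with
    | zero => simp
    | succ n ih => rw [pow_succ, ih, Nat.cast_succ, exp_add_smul, one_smul]
  obtain ⟨C', -, hC'⟩ := htri.exists_norm_pow_le (C := C) (Real.exp_pos α₁)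
    (Real.exp_lt_exp.2 hα₁') (fun n => by
      rw [hpow]
      refine (hC n (Nat.cast_nonneg n)).trans (le_of_eq ?_)
      rw [← Real.exp_nat_mul, mul_comm α₁])
  exact ⟨C', hC'⟩

/-- The spectral projection of the multinomial problem: a bounded left inverse of the
parametrisation of the centre subspace whose kernel is the decaying subspace. -/
theorem CentreBases.exists_jet_projection (h : CentreBases (op L 0) α V₀ Z₀)
    (hT : SpectralSplitting (op L 0) T α β) (hα : 0 ≤ α) (hαβ : α < β)
    {S : ℝ → Jet M N H →L[ℝ] Jet M N H} (hS : GeneratesSemigroup (jetOperator N L) S)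
    (hrec : CentreRecursion N L V₀ Z₀ A V) {C₀ γ₀ γ : ℝ}
    (hC₀ : ∀ t, 0 ≤ t → ∀ v ∈ stableSubspace (op L 0) β, ‖T t v‖ ≤ C₀ * Real.exp (-γ₀ * t) * ‖v‖)
    (hγ : α < γ) (hγγ₀ : γ < γ₀) :
    ∃ P : Jet M N H →L[ℝ] Jet M N (Fin m → ℝ), (∀ c, P (centreMap N V c) = c) ∧
      (∀ f, f ∈ decayingSubspace S α ↔ P f = 0) ∧
      ∃ C : ℝ, ∀ f, P f = 0 → ∀ t, 0 ≤ t → ‖S t f‖ ≤ C * Real.exp (-γ * t) * ‖f‖ := by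
  obtain ⟨C₁, hC₁⟩ := h.exists_norm_pow_le hT hαβ hC₀
  -- The map W = (1 - 𝒱P₀) S 1 has as diagonal the corresponding operator of L_0, whose powers decay
  -- at rate γ₀; passing to γ < γ₀ absorbs the off-diagonal part.
  have htri : IsTriangular ((1 - (centreMap N V).comp (diagonal M N (innerVec Z₀))).comp (S 1))
      ((1 - (combination V₀).comp (innerVec Z₀)).comp (T 1)) := by
    refine (hT.semigroup.isTriangular hS zero_le_one).comp (IsTriangular.one.sub ?_)
    have := (isTriangular_diagonal (M := M) (N := N) (innerVec Z₀)).comp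
      (isTriangular_centreMap (V := V))
    rwa [hrec.V_zero] at this
  obtain ⟨a, -, ha⟩ := htri.exists_norm_pow_le (Real.exp_pos (-γ₀))
    (Real.exp_lt_exp.2 (neg_lt_neg hγγ₀)) hC₁
  obtain ⟨α₁, hα₁, hα₁γ⟩ := exists_between hγ
  obtain ⟨b, hb⟩ := h.exists_norm_exp_centreOp_pow_le hrec hα₁
  have hGG' : ∀ c, NormedSpace.exp (centreOp N A) (NormedSpace.exp (-centreOp N A) c) = c := by
    intro c
    have := congrArg (fun Q : Jet M N (Fin m → ℝ) →L[ℝ] Jet M N (Fin m → ℝ) => Q c)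
      (exp_smul_mul_exp_neg_smul (centreOp N A) 1)
    simpa only [one_smul, mul_apply_eq_comp, one_apply_eq_self] using this
  have hG'G : ∀ c, NormedSpace.exp (-centreOp N A) (NormedSpace.exp (centreOp N A) c) = c := by
    intro c
    have := congrArg (fun Q : Jet M N (Fin m → ℝ) →L[ℝ] Jet M N (Fin m → ℝ) => Q c)
      (exp_neg_smul_mul_exp_smul (centreOp N A) 1)
    simpa only [one_smul, mul_apply_eq_comp, one_apply_eq_self] using this
  have hSV : ∀ c, S 1 (centreMap N V c) = centreMap N V (NormedSpace.exp (centreOp N A) c) := by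
    intro c
    rw [hrec.semigroup_centreMap hS c zero_le_one, one_smul]
  obtain ⟨P, hPV, hPS, d, hd, hdecay⟩ := exists_invariant_projection hGG'
    (hrec.innerVec_centreMap h) hSV (Real.exp_pos (-γ)).le (Real.exp_pos α₁).le
    (by rw [← Real.exp_add]; exact Real.exp_lt_one_iff.2 (by linarith)) ha hb
  obtain ⟨C, hC⟩ := hS.exists_norm_le_of_pow (hα.trans hγ.le) hd
  have hP0 : ∀ f, P f = 0 → ∀ t, 0 ≤ t → ‖S t f‖ ≤ C * Real.exp (-γ * t) * ‖f‖ :=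
    fun f hf => hC f fun n => hdecay n f hf
  refine ⟨P, hPV, fun f => ⟨fun hf => ?_, fun hf => ?_⟩, C, hP0⟩
  · obtain ⟨γ', hγ', hO⟩ := hf
    obtain ⟨α₂, hα₂, hα₂γ'⟩ := exists_between hγ'
    obtain ⟨b', hb'⟩ := h.exists_norm_exp_centreOp_pow_le hrec hα₂
    -- For a decaying f, P f = e^{-n𝒜} P (S n f) tends to zero. The rate γ' of f may be any number
    -- above α, even one below γ, so every decaying state in fact decays at rate γ.
    have hPn : ∀ n : ℕ, P f = (NormedSpace.exp (-centreOp N A) ^ n) (P (S n f)) := by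
      intro n
      rw [← hS.pow_eq]
      induction n with
      | zero => rfl
      | succ n ih =>
        rw [pow_succ' (S 1), mul_apply_eq_comp, hPS, pow_succ (NormedSpace.exp _),
          mul_apply_eq_comp, hG'G, ← ih]
    have h1 : (fun n : ℕ => ‖S n f‖) =O[atTop] fun n : ℕ => Real.exp (-γ' * n) :=
      (hO.comp_tendsto tendsto_natCast_atTop_atTop).norm_left
    have h2 : Tendsto (fun n : ℕ => Real.exp (α₂ * n) * ‖S n f‖) atTop (𝓝 0) := by
      refine ((isBigO_refl (fun n : ℕ => Real.exp (α₂ * n)) atTop).mul h1).trans_tendsto ?_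
      have h3 : ∀ n : ℕ, Real.exp (α₂ * n) * Real.exp (-γ' * n) = Real.exp ((α₂ - γ') * n) :=
        fun n => by rw [← Real.exp_add]; ring_nf
      simp only [h3]
      exact Real.tendsto_exp_atBot.comp
        (tendsto_natCast_atTop_atTop.const_mul_atTop_of_neg (by linarith))
    have h4 : ∀ n : ℕ, ‖P f‖ ≤ b' * ‖P‖ * (Real.exp (α₂ * n) * ‖S n f‖) := by
      intro n
      have h5 := hb' n
      rw [← Real.exp_nat_mul, mul_comm (n : ℝ)] at h5
      calc ‖P f‖ ≤ ‖NormedSpace.exp (-centreOp N A) ^ n‖ * ‖P (S n f)‖ := by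
            conv_lhs => rw [hPn n]
            exact ContinuousLinearMap.le_opNorm _ _
        _ ≤ (b' * Real.exp (α₂ * n)) * (‖P‖ * ‖S n f‖) :=
            mul_le_mul h5 (P.le_opNorm _) (norm_nonneg _) ((norm_nonneg _).trans h5)
        _ = _ := by ring
    have h6 : Tendsto (fun n : ℕ => b' * ‖P‖ * (Real.exp (α₂ * n) * ‖S n f‖)) atTop (𝓝 0) := by
      simpa using h2.const_mul (b' * ‖P‖)
    exact norm_le_zero_iff.1 (ge_of_tendsto' h6 h4)
  · refine mem_decayingSubspace_of_norm_le (C := C * ‖f‖) hγ fun t ht => (hP0 f hf t ht).trans ?_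
    exact le_of_eq (by ring)

end JetSpectrum

/-! ### Iterated directional derivatives -/

section DirDeriv

variable {P F G : Type*} [NormedAddCommGroup P] [NormedSpace ℝ P] [NormedAddCommGroup F]
  [NormedSpace ℝ F] [NormedAddCommGroup G] [NormedSpace ℝ G]

/-- The iterated directional derivative along the vectors of a list. -/
def dirDeriv (l : List P) (f : P → F) : P → F :=
  l.foldr (fun v g x => lineDeriv ℝ g x v) f

@[simp] theorem dirDeriv_nil (f : P → F) : dirDeriv [] f = f := rfl

theorem dirDeriv_cons (v : P) (l : List P) (f : P → F) :
    dirDeriv (v :: l) f = fun x => lineDeriv ℝ (dirDeriv l f) x v := rfl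

theorem dirDeriv_append (l l' : List P) (f : P → F) :
    dirDeriv (l ++ l') f = dirDeriv l (dirDeriv l' f) := by
  simp [dirDeriv]

theorem eqOn_dirDeriv {U : Set P} (hU : IsOpen U) {f g : P → F} (h : Set.EqOn f g U)
    (l : List P) : Set.EqOn (dirDeriv l f) (dirDeriv l g) U := by
  induction l with
  | nil => exact h
  | cons v l ih =>
    intro x hx
    exact (ih.eventuallyEq_of_mem (hU.mem_nhds hx)).lineDeriv_eq

theorem contDiffOn_lineDeriv {U : Set P} (hU : IsOpen U) {q : ℕ} {f : P → F}
    (hf : ContDiffOn ℝ (q + 1 : ℕ) f U) (v : P) :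
    ContDiffOn ℝ q (fun x => lineDeriv ℝ f x v) U := by
  have h := (hf.fderiv_of_isOpen hU (m := (q : WithTop ℕ∞)) (by push_cast; exact le_rfl)).clm_apply
    (contDiffOn_const (c := v))
  refine h.congr fun x hx => ?_
  exact ((hf.differentiableOn (by simp)).differentiableAt (hU.mem_nhds hx)).lineDeriv_eq_fderiv

theorem contDiffOn_dirDeriv {U : Set P} (hU : IsOpen U) (l : List P) {q : ℕ} {f : P → F}
    (hf : ContDiffOn ℝ (l.length + q : ℕ) f U) : ContDiffOn ℝ q (dirDeriv l f) U := by
  induction l generalizing q with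
  | nil => simpa using hf
  | cons v l ih =>
    refine contDiffOn_lineDeriv hU (ih ?_) v
    simpa [add_assoc, add_comm 1 q] using hf

theorem differentiableAt_dirDeriv {U : Set P} (hU : IsOpen U) (l : List P) {f : P → F}
    (hf : ContDiffOn ℝ (l.length + 1 : ℕ) f U) {x : P} (hx : x ∈ U) :
    DifferentiableAt ℝ (dirDeriv l f) x :=
  ((contDiffOn_dirDeriv hU l (q := 1) hf).differentiableOn (by simp)).differentiableAt
    (hU.mem_nhds hx)

theorem dirDeriv_clm_comp {U : Set P} (hU : IsOpen U) (l : List P) {f : P → F}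
    (hf : ContDiffOn ℝ l.length f U) (A : F →L[ℝ] G) :
    Set.EqOn (dirDeriv l fun x => A (f x)) (fun x => A (dirDeriv l f x)) U := by
  induction l with
  | nil => intro x _; rfl
  | cons v l ih =>
    intro x hx
    have h1 : ContDiffOn ℝ l.length f U :=
      hf.of_le (by exact_mod_cast (Nat.le_succ l.length))
    have h2 : DifferentiableAt ℝ (dirDeriv l f) x := differentiableAt_dirDeriv hU l hf hx
    simp only [dirDeriv_cons]
    rw [((ih h1).eventuallyEq_of_mem (hU.mem_nhds hx)).lineDeriv_eq]
    exact ((A.hasFDerivAt.comp x h2.hasFDerivAt).hasLineDerivAt v).lineDeriv.trans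
      (by rw [h2.lineDeriv_eq_fderiv]; rfl)

/-- The summands are the components of one map into a product, so additivity is an instance of
commuting with a bounded operator. -/
theorem dirDeriv_sum {ι : Type*} (s : Finset ι) {U : Set P} (hU : IsOpen U) (l : List P)
    {f : ι → P → F} (hf : ∀ i ∈ s, ContDiffOn ℝ l.length (f i) U) :
    Set.EqOn (dirDeriv l fun x => ∑ i ∈ s, f i x) (fun x => ∑ i ∈ s, dirDeriv l (f i) x) U := by
  have hg : ContDiffOn ℝ l.length (fun x => fun i : s => f i x) U :=
    contDiffOn_pi.mpr fun i => hf i i.2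
  intro x hx
  have h1 := dirDeriv_clm_comp hU l hg
    (∑ i : s, ContinuousLinearMap.proj (R := ℝ) (φ := fun _ : s => F) i) hx
  have h2 : ∀ i : s, dirDeriv l (f i) x = dirDeriv l (fun x => fun i : s => f i x) x i := fun i =>
    dirDeriv_clm_comp hU l hg (ContinuousLinearMap.proj (R := ℝ) (φ := fun _ : s => F) i) hx
  simp only [_root_.sum_apply, ContinuousLinearMap.proj_apply] at h1
  simp only [← Finset.sum_coe_sort s]
  rw [h1]
  exact Finset.sum_congr rfl fun i _ => (h2 i).symm

theorem lineDeriv_comm {U : Set P} (hU : IsOpen U) {f : P → F} (hf : ContDiffOn ℝ 2 f U)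
    (v w : P) : Set.EqOn (fun x => lineDeriv ℝ (fun y => lineDeriv ℝ f y v) x w)
      (fun x => lineDeriv ℝ (fun y => lineDeriv ℝ f y w) x v) U := by
  intro x hx
  have key : ∀ a b : P, lineDeriv ℝ (fun y => lineDeriv ℝ f y a) x b
      = fderiv ℝ (fderiv ℝ f) x b a := by
    intro a b
    have h1 : (fun y => lineDeriv ℝ f y a) =ᶠ[𝓝 x] fun y => fderiv ℝ f y a := by
      filter_upwards [hU.mem_nhds hx] with y hy
      exact ((hf.differentiableOn (by simp)).differentiableAt (hU.mem_nhds hy)).lineDeriv_eq_fderiv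
    rw [h1.lineDeriv_eq]
    have h2 : DifferentiableAt ℝ (fderiv ℝ f) x :=
      ((hf.fderiv_of_isOpen hU (m := 1) (by norm_num)).differentiableOn
        (by simp)).differentiableAt (hU.mem_nhds hx)
    have h3 := (h2.hasFDerivAt.clm_apply (hasFDerivAt_const a x)).hasLineDerivAt b
    rw [h3.lineDeriv]
    simp
  have hs : IsSymmSndFDerivAt ℝ f x :=
    (hf.contDiffAt (hU.mem_nhds hx)).isSymmSndFDerivAt (by simp)
  simp only [key]
  exact hs w v

theorem dirDeriv_perm {U : Set P} (hU : IsOpen U) {l l' : List P} (h : l.Perm l') {f : P → F}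
    (hf : ContDiffOn ℝ l.length f U) : Set.EqOn (dirDeriv l f) (dirDeriv l' f) U := by
  induction h with
  | nil => exact fun _ _ => rfl
  | cons v h ih =>
    intro x hx
    exact ((ih (hf.of_le (by exact_mod_cast (Nat.le_succ _)))).eventuallyEq_of_mem
      (hU.mem_nhds hx)).lineDeriv_eq
  | swap v w l =>
    exact lineDeriv_comm hU (contDiffOn_dirDeriv hU l (q := 2)
      (by simpa [add_assoc, one_add_one_eq_two] using hf)) v w
  | trans h₁ h₂ ih₁ ih₂ =>
    exact (ih₁ hf).trans (ih₂ (by rwa [← h₁.length_eq]))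

/-- Spatial derivatives at a fixed time become derivatives on space-time along vectors (v, 0), so
that time and space derivatives can be permuted alike. -/
theorem dirDeriv_slice {Q : Type*} [NormedAddCommGroup Q] [NormedSpace ℝ Q] (l : List P)
    (f : P × Q → F) (x : P) (t : Q) :
    dirDeriv l (fun y => f (y, t)) x = dirDeriv (l.map fun v => (v, (0 : Q))) f (x, t) := by
  induction l generalizing x with
  | nil => rfl
  | cons v l ih =>
    simp only [List.map_cons, dirDeriv_cons, lineDeriv, ih, Prod.smul_mk, smul_zero,
      Prod.mk_add_mk, add_zero]

/-- A derivative of a function with values in a closed subspace has values there. -/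
theorem dirDeriv_mem {U : Set P} (hU : IsOpen U) {W : Submodule ℝ F} (hW : IsClosed (W : Set F))
    {f : P → F} (hf : ∀ x ∈ U, f x ∈ W) (l : List P) : ∀ x ∈ U, dirDeriv l f x ∈ W := by
  induction l with
  | nil => exact hf
  | cons v l ih =>
    intro x hx
    have hc : Continuous fun s : ℝ => x + s • v := by fun_prop
    have ho : IsOpen ((fun s : ℝ => x + s • v) ⁻¹' U) := hU.preimage hc
    have h0 : (0 : ℝ) ∈ (fun s : ℝ => x + s • v) ⁻¹' U := by simpa using hx
    set O := (fun s : ℝ => x + s • v) ⁻¹' U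
    -- A derivative lies in the closed span of the values of the function.
    have h1 := range_derivWithin_subset_closure_span_image
      (fun s : ℝ => dirDeriv l f (x + s • v)) (s := O) (t := O)
      (by simpa using subset_closure)
    have h2 := h1 ⟨0, rfl⟩
    rw [derivWithin_of_mem_nhds (ho.mem_nhds h0)] at h2
    refine hW.closure_subset_iff.mpr ?_ h2
    have : Submodule.span ℝ ((fun s : ℝ => dirDeriv l f (x + s • v)) '' O) ≤ W := by
      rw [Submodule.span_le]
      rintro _ ⟨s, hs, rfl⟩
      exact ih _ hs
    exact this

theorem hasDerivAt_time {U : Set (P × ℝ)} (hU : IsOpen U) {f : P × ℝ → F}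
    (hf : ContDiffOn ℝ 1 f U) {x : P} {t : ℝ} (hx : (x, t) ∈ U) :
    HasDerivAt (fun s => f (x, s)) (lineDeriv ℝ f (x, t) ((0 : P), (1 : ℝ))) t := by
  have h := (hf.differentiableOn (by simp)).differentiableAt (hU.mem_nhds hx)
  rw [h.lineDeriv_eq_fderiv]
  have h1 : HasDerivAt (fun s : ℝ => (x, s)) ((0 : P), (1 : ℝ)) t :=
    (hasDerivAt_const t x).prodMk (hasDerivAt_id t)
  exact HasFDerivAt.comp_hasDerivAt t h.hasFDerivAt h1

end DirDeriv

/-! ### Mixed partial derivatives and Taylor coefficients -/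

section Mixed

variable {M : ℕ} {F : Type*} [NormedAddCommGroup F] [NormedSpace ℝ F]

/-- The list of indices in which `i` occurs `n i` times. -/
def indexList (n : Fin M → ℕ) : List (Fin M) :=
  (List.finRange M).flatMap fun i => List.replicate (n i) i

/-- The list of coordinate directions in which the `i`-th one occurs `n i` times. -/
def directions (n : Fin M → ℕ) : List (EuclideanSpace ℝ (Fin M)) :=
  (indexList n).map fun i => EuclideanSpace.single i (1 : ℝ)

theorem count_indexList (n : Fin M → ℕ) (i : Fin M) : (indexList n).count i = n i := by
  rw [indexList, List.count_flatMap, ← Fin.sum_univ_def]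
  simp [List.count_replicate]

theorem indexList_add_perm (n k : Fin M → ℕ) :
    (indexList (n + k)).Perm (indexList n ++ indexList k) := by
  rw [List.perm_iff_count]
  intro i
  simp [count_indexList]

theorem directions_add_perm (n k : Fin M → ℕ) :
    (directions (n + k)).Perm (directions n ++ directions k) := by
  simpa [directions] using (indexList_add_perm n k).map
    fun i => EuclideanSpace.single i (1 : ℝ)

@[simp] theorem length_directions (n : Fin M → ℕ) : (directions n).length = order n := by
  rw [directions, List.length_map, indexList, List.length_flatMap, ← Fin.sum_univ_def]
  simp [order]

/-- With lists of directions, the symmetry of higher derivatives is invariance under permutation of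
the list. -/
theorem mixedDeriv_eq_dirDeriv (n : Fin M → ℕ) (f : EuclideanSpace ℝ (Fin M) → F) :
    mixedDeriv n f = dirDeriv (directions n) f := by
  have key : ∀ l : List (Fin M), l.foldr
      (fun i g => (fun (h : EuclideanSpace ℝ (Fin M) → F) (x : EuclideanSpace ℝ (Fin M)) =>
        lineDeriv ℝ h x (EuclideanSpace.single i (1 : ℝ)))^[n i] g) f
      = dirDeriv ((l.flatMap fun i => List.replicate (n i) i).map
          fun i => EuclideanSpace.single i (1 : ℝ)) f := by
    intro l
    induction l with
    | nil => rfl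
    | cons i l ih =>
      rw [List.foldr_cons, ih, List.flatMap_cons, List.map_append, dirDeriv_append]
      generalize dirDeriv _ f = g
      generalize n i = j
      induction j with
      | zero => rfl
      | succ j ihj =>
        rw [Function.iterate_succ_apply', ihj]
        rfl
  exact key _

theorem multiChoose_eq_zero {n k : Fin M → ℕ} (h : ¬ k ≤ n) : multiChoose n k = 0 := by
  simp only [Pi.le_def, not_forall, not_le] at h
  obtain ⟨i, hi⟩ := h
  exact Finset.prod_eq_zero (Finset.mem_univ i) (Nat.choose_eq_zero_of_lt hi)

/-- The Vandermonde identity for multi-indices. -/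
theorem sum_multiChoose (p : Fin M → ℕ) (N : ℕ) :
    ∑ l ∈ (multiIndices M N).filter (fun l => order l = N), multiChoose p l
      = (order p).choose N := by
  -- The identity compares the coefficients of X^N in this product and in (1 + X)^{|p|}.
  have h1 : ∏ i, ((1 + Polynomial.X : Polynomial ℕ) ^ p i)
      = ∑ l ∈ Fintype.piFinset fun i => Finset.range (p i + 1),
        Polynomial.monomial (order l) (multiChoose p l) := by
    have : ∀ i, ((1 + Polynomial.X : Polynomial ℕ) ^ p i)
        = ∑ j ∈ Finset.range (p i + 1), Polynomial.monomial j ((p i).choose j) := by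
      intro i
      ext j
      simp only [Polynomial.coeff_one_add_X_pow, Polynomial.finsetSum_coeff,
        Polynomial.coeff_monomial, Finset.sum_ite_eq', Finset.mem_range]
      split_ifs with h
      · simp
      · simpa using Nat.choose_eq_zero_of_lt (by omega)
    simp only [this]
    rw [Finset.prod_univ_sum]
    refine Finset.sum_congr rfl fun l _ => ?_
    simp only [multiChoose, order]
    generalize (Finset.univ : Finset (Fin M)) = s
    induction s using Finset.cons_induction with
    | empty => simp
    | cons a s ha ih => rw [Finset.prod_cons, ih, Finset.sum_cons, Finset.prod_cons,
        Polynomial.monomial_mul_monomial]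
  rw [Finset.prod_pow_eq_pow_sum] at h1
  have h2 := congrArg (fun q => Polynomial.coeff q N) h1
  simp only [Polynomial.coeff_one_add_X_pow, Polynomial.finsetSum_coeff,
    Polynomial.coeff_monomial] at h2
  rw [← Finset.sum_filter] at h2
  rw [order, ← Nat.cast_id (Nat.choose _ _), h2]
  have hsub : ∀ l : Fin M → ℕ, order l = N → l ∈ multiIndices M N := fun l hl =>
    mem_multiIndices.mpr hl.le
  symm
  refine Finset.sum_subset_zero_on_sdiff ?_ ?_ fun _ _ => rfl
  · intro l hl
    rw [Finset.mem_filter] at hl ⊢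
    exact ⟨hsub l hl.2, hl.2⟩
  · intro l hl
    refine multiChoose_eq_zero fun hle => ?_
    simp only [Finset.mem_sdiff, Finset.mem_filter, Fintype.mem_piFinset, Finset.mem_range,
      not_and] at hl
    exact hl.2 (fun i => Nat.lt_succ_of_le (hle i)) hl.1.2

/-- An integer case of Euler's Beta integral. -/
theorem choose_mul_integral (N j : ℕ) :
    ((N + 1 + j).choose (N + 1) : ℝ) * (N + 1) * ∫ s in (0 : ℝ)..1, (1 - s) ^ N * s ^ j = 1 := by
  induction j generalizing N with
  | zero =>
    have h := intervalIntegral.integral_comp_sub_left (a := 0) (b := 1)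
      (fun s : ℝ => s ^ N) 1
    simp only [add_zero, Nat.choose_self, Nat.cast_one, one_mul, pow_zero, mul_one, h]
    rw [integral_pow]
    have : (N : ℝ) + 1 ≠ 0 := by positivity
    simp
    field_simp
  | succ j ih =>
    -- Integration by parts trades a power of s for a power of 1 - s, which is why the induction on
    -- j is over all N.
    have hd : ∀ s ∈ Set.uIcc (0 : ℝ) 1, HasDerivAt (fun s : ℝ => (1 - s) ^ (N + 1) * s ^ (j + 1))
        ((j + 1) * ((1 - s) ^ (N + 1) * s ^ j) - (N + 1) * ((1 - s) ^ N * s ^ (j + 1))) s := by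
      intro s _
      have h1 := (((hasDerivAt_id s).const_sub 1).pow (N + 1)).mul ((hasDerivAt_id s).pow (j + 1))
      refine h1.congr_deriv ?_
      simp
      ring
    have h2 := intervalIntegral.integral_eq_sub_of_hasDerivAt hd
      (Continuous.intervalIntegrable (by fun_prop) _ _)
    rw [intervalIntegral.integral_sub (Continuous.intervalIntegrable (by fun_prop) _ _)
      (Continuous.intervalIntegrable (by fun_prop) _ _), intervalIntegral.integral_const_mul,
      intervalIntegral.integral_const_mul] at h2
    simp only [sub_self, ne_eq, Nat.add_eq_zero_iff, one_ne_zero, and_false, not_false_eq_true,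
      zero_pow, zero_mul, sub_zero, mul_zero] at h2
    have h3 := ih (N + 1)
    have h4 : ((N + 1 + (j + 1)).choose (N + 2) : ℝ) * (N + 2)
        = (N + 1 + (j + 1)).choose (N + 1) * (j + 1) := by
      have := Nat.choose_succ_right_eq (N + 1 + (j + 1)) (N + 1)
      rw [show N + 1 + (j + 1) - (N + 1) = j + 1 by omega] at this
      exact_mod_cast this
    rw [show N + 1 + 1 + j = N + 1 + (j + 1) by ring] at h3
    push_cast at h3
    refine Eq.trans ?_ h3
    rw [show (N : ℝ) + 1 + 1 = N + 2 by ring, h4, mul_assoc, mul_assoc]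
    exact congrArg _ (sub_eq_zero.mp h2).symm

/-- Differentiation under the integral sign; scaling the displacement by s makes each derivative
contribute a factor s. -/
theorem hasLineDerivAt_integral_segment [CompleteSpace F] {P : Type*} [NormedAddCommGroup P]
    [NormedSpace ℝ P] {U : Set P} (hU : IsOpen U) {X : P} (hs : StarConvex ℝ X U) {G : P → F}
    (hG : ContDiffOn ℝ 1 G U) {c : ℝ → ℝ} (hc : Continuous c) {x : P} (hx : x ∈ U) (v : P) :
    HasLineDerivAt ℝ (fun y => ∫ s in (0 : ℝ)..1, c s • G (X + s • (y - X)))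
      (∫ s in (0 : ℝ)..1, (c s * s) • lineDeriv ℝ G (X + s • (x - X)) v) x v := by
  have hmem : ∀ y ∈ U, ∀ s ∈ Set.Icc (0 : ℝ) 1, X + s • (y - X) ∈ U := by
    intro y hy s h
    have := hs hy (sub_nonneg.mpr h.2) h.1 (by ring)
    convert this using 1
    module
  have hcont : Continuous fun ε : ℝ => x + ε • v := by fun_prop
  obtain ⟨δ, hδ, hδU⟩ : ∃ δ > 0, ∀ ε ∈ Metric.closedBall (0 : ℝ) δ, x + ε • v ∈ U := by
    have h0 : (fun ε : ℝ => x + ε • v) ⁻¹' U ∈ 𝓝 (0 : ℝ) :=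
      (hU.preimage hcont).mem_nhds (by simpa using hx)
    exact Metric.nhds_basis_closedBall.mem_iff.mp h0
  have hl : ContinuousOn (fun y => lineDeriv ℝ G y v) U :=
    (contDiffOn_lineDeriv hU (q := 0) (by simpa using hG) v).continuousOn
  have hGc : ContinuousOn G U := hG.continuousOn
  have hK : IsCompact (Metric.closedBall (0 : ℝ) δ ×ˢ Set.Icc (0 : ℝ) 1) :=
    (isCompact_closedBall _ _).prod isCompact_Icc
  have hF'c : ContinuousOn (fun q : ℝ × ℝ =>
      (c q.2 * q.2) • lineDeriv ℝ G (X + q.2 • (x + q.1 • v - X)) v)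
      (Metric.closedBall (0 : ℝ) δ ×ˢ Set.Icc (0 : ℝ) 1) := by
    refine ContinuousOn.smul (by fun_prop) (hl.comp (by fun_prop) ?_)
    exact fun q hq => hmem _ (hδU _ hq.1) _ hq.2
  have hFc : ContinuousOn (fun q : ℝ × ℝ => c q.2 • G (X + q.2 • (x + q.1 • v - X)))
      (Metric.closedBall (0 : ℝ) δ ×ˢ Set.Icc (0 : ℝ) 1) := by
    refine ContinuousOn.smul (by fun_prop) (hGc.comp (by fun_prop) ?_)
    exact fun q hq => hmem _ (hδU _ hq.1) _ hq.2
  have hslice : ∀ ε ∈ Metric.closedBall (0 : ℝ) δ, ∀ {Φ : ℝ × ℝ → F},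
      ContinuousOn Φ (Metric.closedBall (0 : ℝ) δ ×ˢ Set.Icc (0 : ℝ) 1) →
      IntervalIntegrable (fun s => Φ (ε, s)) MeasureTheory.volume 0 1 := by
    intro ε hε Φ hΦ
    refine ContinuousOn.intervalIntegrable ?_
    rw [Set.uIcc_of_le zero_le_one]
    exact hΦ.comp (by fun_prop) fun s hs => ⟨hε, hs⟩
  obtain ⟨C, hC⟩ := hK.exists_bound_of_continuousOn hF'c
  have h0 : (0 : ℝ) ∈ Metric.closedBall (0 : ℝ) δ := by simpa using hδ.le
  have key := intervalIntegral.hasDerivAt_integral_of_dominated_loc_of_deriv_le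
    (μ := MeasureTheory.volume) (a := 0) (b := 1) (x₀ := (0 : ℝ)) (bound := fun _ => C)
    (s := Metric.ball (0 : ℝ) δ)
    (F := fun ε s => c s • G (X + s • (x + ε • v - X)))
    (F' := fun ε s => (c s * s) • lineDeriv ℝ G (X + s • (x + ε • v - X)) v)
    (Metric.ball_mem_nhds _ hδ)
    (by
      filter_upwards [Metric.closedBall_mem_nhds _ hδ] with ε hε
      exact (hslice ε hε hFc).def'.aestronglyMeasurable)
    (hslice 0 h0 hFc) (hslice 0 h0 hF'c).def'.aestronglyMeasurable
    (by
      refine Eventually.of_forall fun s hs ε hε => ?_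
      rw [Set.uIoc_of_le zero_le_one] at hs
      exact hC (ε, s) ⟨Metric.ball_subset_closedBall hε, Set.Ioc_subset_Icc_self hs⟩)
    intervalIntegrable_const
    (by
      refine Eventually.of_forall fun s hs ε hε => ?_
      rw [Set.uIoc_of_le zero_le_one] at hs
      have hm := hmem _ (hδU ε (Metric.ball_subset_closedBall hε)) s (Set.Ioc_subset_Icc_self hs)
      have hd := (hG.differentiableOn (by simp)).differentiableAt (hU.mem_nhds hm)
      have h1 : HasDerivAt (fun ε : ℝ => X + s • (x + ε • v - X)) (s • v) ε := by
        have := ((((hasDerivAt_id ε).smul_const v).const_add x).sub_const X).const_smul s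
        simpa using this.const_add X
      have h2 := HasFDerivAt.comp_hasDerivAt ε hd.hasFDerivAt h1
      rw [map_smul, ← hd.lineDeriv_eq_fderiv] at h2
      rw [mul_smul]
      exact h2.const_smul (c s))
  simpa [HasLineDerivAt] using key.2

theorem dirDeriv_integral_segment [CompleteSpace F] {P : Type*} [NormedAddCommGroup P]
    [NormedSpace ℝ P] {U : Set P} (hU : IsOpen U) {X : P} (hs : StarConvex ℝ X U) {G : P → F}
    (l : List P) (hG : ContDiffOn ℝ l.length G U) {c : ℝ → ℝ} (hc : Continuous c) :
    Set.EqOn (dirDeriv l fun y => ∫ s in (0 : ℝ)..1, c s • G (X + s • (y - X)))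
      (fun x => ∫ s in (0 : ℝ)..1, (c s * s ^ l.length) • dirDeriv l G (X + s • (x - X))) U := by
  induction l with
  | nil => intro x _; simp
  | cons v l ih =>
    intro x hx
    have h1 : ContDiffOn ℝ l.length G U :=
      hG.of_le (by exact_mod_cast (Nat.le_succ l.length))
    simp only [dirDeriv_cons]
    rw [((ih h1).eventuallyEq_of_mem (hU.mem_nhds hx)).lineDeriv_eq]
    rw [(hasLineDerivAt_integral_segment hU hs (contDiffOn_dirDeriv hU l (q := 1) hG)
      (c := fun s => c s * s ^ l.length) (by fun_prop) hx v).lineDeriv]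
    simp only [List.length_cons, pow_succ, mul_assoc]

theorem mixedDeriv_add {Ω : Set (EuclideanSpace ℝ (Fin M))} (hΩ : IsOpen Ω) (n k : Fin M → ℕ)
    {f : EuclideanSpace ℝ (Fin M) → F} (hf : ContDiffOn ℝ (order (n + k)) f Ω) :
    Set.EqOn (mixedDeriv n (mixedDeriv k f)) (mixedDeriv (n + k) f) Ω := by
  simp only [mixedDeriv_eq_dirDeriv, ← dirDeriv_append]
  exact (dirDeriv_perm hΩ (directions_add_perm n k) (by simpa using hf)).symm

/-- At x = X the segment shrinks to the point X, so the derivative leaves the integral and the Beta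
integral N ∫ (1-s)^{N-1} s^{|p|-N} ds remains. -/
theorem mixedDeriv_taylorCoeff [CompleteSpace F] {Ω : Set (EuclideanSpace ℝ (Fin M))}
    (hΩ : IsOpen Ω) {X : EuclideanSpace ℝ (Fin M)} (hX : X ∈ Ω) {N : ℕ} (hN : 1 ≤ N)
    {l p : Fin M → ℕ} (hl : order l = N) (hlp : l ≤ p) {f : EuclideanSpace ℝ (Fin M) → F}
    (hf : ContDiffOn ℝ (order p) f Ω) :
    mixedDeriv (p - l) (taylorCoeff N l f X) X
      = ((order p).choose N : ℝ)⁻¹ • mixedDeriv p f X := by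
  -- Ω need not contain the segments from X; a ball around X does, and derivatives at X are local.
  obtain ⟨ε, hε, hεΩ⟩ := Metric.isOpen_iff.mp hΩ X hX
  set U := Metric.ball X ε
  have hU : IsOpen U := Metric.isOpen_ball
  have hXU : X ∈ U := Metric.mem_ball_self hε
  have hs : StarConvex ℝ X U := (convex_ball X ε).starConvex hXU
  have hfU : ContDiffOn ℝ (order p) f U := hf.mono hεΩ
  have hpl : p - l + l = p := tsub_add_cancel_of_le hlp
  have hord : order (p - l) + order l = order p := by rw [← order_add, hpl]
  obtain ⟨N, rfl⟩ : ∃ N', N = N' + 1 := ⟨N - 1, by omega⟩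
  have hG : ContDiffOn ℝ (directions (p - l)).length (mixedDeriv l f) U := by
    rw [mixedDeriv_eq_dirDeriv, length_directions]
    exact contDiffOn_dirDeriv hU _ (by rwa [length_directions, add_comm, hord])
  have h1 := dirDeriv_integral_segment hU hs (directions (p - l)) hG
    (c := fun s => ((N + 1 : ℕ) : ℝ) * (1 - s) ^ N) (by fun_prop) hXU
  have h2 : taylorCoeff (N + 1) l f X = fun y => ∫ s in (0 : ℝ)..1,
      (((N + 1 : ℕ) : ℝ) * (1 - s) ^ N) • mixedDeriv l f (X + s • (y - X)) := by
    funext y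
    rw [taylorCoeff, ← intervalIntegral.integral_smul]
    simp only [mul_smul, Nat.add_sub_cancel]
  rw [h2, mixedDeriv_eq_dirDeriv (p - l), h1]
  simp only [sub_self, smul_zero, add_zero]
  rw [intervalIntegral.integral_smul_const, ← mixedDeriv_eq_dirDeriv,
    mixedDeriv_add hU (p - l) l (by rwa [hpl]) hXU, hpl]
  congr 1
  simp only [mul_assoc, intervalIntegral.integral_const_mul, length_directions]
  have h3 := choose_mul_integral N (order (p - l))
  rw [show N + 1 + order (p - l) = order p by omega, mul_assoc] at h3
  push_cast
  exact eq_inv_of_mul_eq_one_right h3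

end Mixed

/-! ### Derivatives of solutions -/

section Solutions

variable {H : Type*} [NormedAddCommGroup H] [InnerProductSpace ℝ H]
  {M : ℕ} {D : Submodule ℝ H}

/-- An operator bounded relative to the closed operator `L_0` extends from the graph of `L_0` to
a bounded operator on the product space. -/
theorem exists_clm_extension [CompleteSpace H] (L : (Fin M → ℕ) → D →ₗ[ℝ] H)
    (hcl : IsClosed ((op L 0).graph : Set (H × H))) {k : Fin M → ℕ} {C : ℝ}
    (hC : ∀ v : D, ‖L k v‖ ≤ C * (‖(v : H)‖ + ‖L 0 v‖)) :
    ∃ Λ : H × H →L[ℝ] H, ∀ z ∈ (op L 0).graph, Λ z = opApply (op L k) z.1 := by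
  -- The Hilbert norm on the product provides the orthogonal projection onto the closed graph,
  -- through which the operator is extended.
  let e := WithLp.prodContinuousLinearEquiv 2 ℝ H H
  let Γ : Submodule ℝ (WithLp 2 (H × H)) := (op L 0).graph.comap (e.toLinearEquiv : WithLp 2 (H × H) →ₗ[ℝ] H × H)
  have hΓ : IsClosed (Γ : Set (WithLp 2 (H × H))) := hcl.preimage e.continuous
  have : CompleteSpace Γ := hΓ.completeSpace_coe
  have hmem : ∀ g : Γ, (e g).1 ∈ D := fun g =>
    LinearPMap.mem_domain_of_mem_graph (f := op L 0) (y := (e g).2) g.2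
  have hsnd : ∀ g : Γ, (e g).2 = L 0 ⟨(e g).1, hmem g⟩ := fun g => by
    have h := opApply_eq_of_mem_graph (A := op L 0) (x := (e g).1) (y := (e g).2) g.2
    rw [← h.2, opApply_op (hmem g)]
  let B : Γ →ₗ[ℝ] H := (L k).comp (LinearMap.codRestrict D
    ((LinearMap.fst ℝ H H).comp ((e.toLinearEquiv : WithLp 2 (H × H) →ₗ[ℝ] H × H).comp Γ.subtype)) hmem)
  let Bc : Γ →L[ℝ] H := B.mkContinuous (|C| * (1 + 1)) fun g => by
    have h1 : ‖(e g).1‖ ≤ ‖g‖ := WithLp.norm_fst_le _ (g : WithLp 2 (H × H))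
    have h2 : ‖(e g).2‖ ≤ ‖g‖ := WithLp.norm_snd_le _ (g : WithLp 2 (H × H))
    have h3 : ‖B g‖ ≤ C * (‖(e g).1‖ + ‖(e g).2‖) := by
      rw [hsnd g]; exact hC ⟨(e g).1, hmem g⟩
    calc ‖B g‖ ≤ C * (‖(e g).1‖ + ‖(e g).2‖) := h3
      _ ≤ |C| * (‖(e g).1‖ + ‖(e g).2‖) := by gcongr; exact le_abs_self C
      _ ≤ |C| * (‖g‖ + ‖g‖) := by gcongr
      _ = |C| * (1 + 1) * ‖g‖ := by ring
  refine ⟨Bc.comp (Γ.orthogonalProjectionOnto.comp (e.symm : H × H →L[ℝ] _)), fun z hz => ?_⟩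
  have hz' : e.symm z ∈ Γ := by
    rw [Submodule.mem_comap]
    exact hz
  have hp : Γ.orthogonalProjectionOnto (e.symm z) = ⟨e.symm z, hz'⟩ :=
    Submodule.orthogonalProjectionOnto_mem_subspace_eq_self (K := Γ) ⟨e.symm z, hz'⟩
  have h1 : z.1 ∈ D := (opApply_eq_of_mem_graph (A := op L 0) (x := z.1) (y := z.2) hz).1
  rw [opApply_op h1]
  change Bc (Γ.orthogonalProjectionOnto (e.symm z)) = _
  rw [hp]
  rfl

namespace IsSolution

variable {L : (Fin M → ℕ) → D →ₗ[ℝ] H} {K p : ℕ} {Ω : Set (EuclideanSpace ℝ (Fin M))} {t₀ : ℝ}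
  {u : EuclideanSpace ℝ (Fin M) → ℝ → H}

theorem isOpen_prod (hΩ : IsOpen Ω) :
    IsOpen (Ω ×ˢ Set.Ioi t₀ : Set (EuclideanSpace ℝ (Fin M) × ℝ)) := hΩ.prod isOpen_Ioi

theorem contDiffOn_slice (hu : IsSolution K p L Ω t₀ u) {t : ℝ} (ht : t₀ < t) :
    ContDiffOn ℝ p (fun x => u x t) Ω :=
  hu.smooth.comp (contDiff_id.prodMk contDiff_const).contDiffOn fun _ hx => ⟨hx, ht⟩

theorem mixedDeriv_macroField (hu : IsSolution K p L Ω t₀ u) (hΩ : IsOpen Ω) {m : ℕ}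
    (Z₀ : Fin m → H) {n : Fin M → ℕ} (hn : order n ≤ p) {X : EuclideanSpace ℝ (Fin M)}
    (hX : X ∈ Ω) {t : ℝ} (ht : t₀ < t) :
    mixedDeriv n (fun x => macroField Z₀ u x t) X
      = innerVec Z₀ (mixedDeriv n (fun x => u x t) X) := by
  have h := dirDeriv_clm_comp hΩ (directions n) (f := fun x => u x t)
    ((hu.contDiffOn_slice ht).of_le (by rw [length_directions]; exact_mod_cast hn))
    (innerVec Z₀) hX
  rw [mixedDeriv_eq_dirDeriv, mixedDeriv_eq_dirDeriv]
  exact h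

variable (L u) in
/-- The pair `(u, L_0 u)` as a function on space-time. -/
def graphField (q : EuclideanSpace ℝ (Fin M) × ℝ) : H × H :=
  (u q.1 q.2, opApply (op L 0) (u q.1 q.2))

/-- The directions of a spatial mixed derivative as vectors of space-time. -/
def spaceDirections (n : Fin M → ℕ) : List (EuclideanSpace ℝ (Fin M) × ℝ) :=
  (directions n).map fun v => (v, (0 : ℝ))

theorem contDiffOn_graphField (hu : IsSolution K p L Ω t₀ u) :
    ContDiffOn ℝ p (graphField L u) (Ω ×ˢ Set.Ioi t₀) :=
  hu.smooth.prodMk hu.smooth_op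

theorem graphField_mem (hu : IsSolution K p L Ω t₀ u) :
    ∀ q ∈ Ω ×ˢ Set.Ioi t₀, graphField L u q ∈ (op L 0).graph := fun q hq =>
  mk_opApply_mem_graph (A := op L 0) (hu.mem q.1 hq.1 q.2 hq.2)

theorem mixedDeriv_eq_fst (hu : IsSolution K p L Ω t₀ u) (hΩ : IsOpen Ω) {n : Fin M → ℕ}
    (hn : order n ≤ p) {q : EuclideanSpace ℝ (Fin M) × ℝ} (hq : q ∈ Ω ×ˢ Set.Ioi t₀) :
    mixedDeriv n (fun x => u x q.2) q.1 = (dirDeriv (spaceDirections n) (graphField L u) q).1 := by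
  have h := dirDeriv_clm_comp (isOpen_prod (t₀ := t₀) hΩ) (spaceDirections n)
    (f := graphField L u) (hu.contDiffOn_graphField.of_le
      (by simp only [spaceDirections, List.length_map, length_directions]; exact_mod_cast hn))
    (ContinuousLinearMap.fst ℝ H H) hq
  rw [mixedDeriv_eq_dirDeriv]
  exact (dirDeriv_slice (directions n) (fun q : _ × ℝ => u q.1 q.2) q.1 q.2).trans h

theorem exists_clm (hfam : IsOperatorFamily K L) [CompleteSpace H]
    (hcl : IsClosed ((op L 0).graph : Set (H × H))) :
    ∃ Λ : (Fin M → ℕ) → H × H →L[ℝ] H,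
      ∀ k, ∀ z ∈ (op L 0).graph, Λ k z = opApply (op L k) z.1 := by
  choose C hC using hfam.relBounded
  choose Λ hΛ using fun k => exists_clm_extension L hcl (hC k)
  exact ⟨Λ, hΛ⟩

theorem dirDeriv_graphField_mem (hu : IsSolution K p L Ω t₀ u) (hΩ : IsOpen Ω)
    (hcl : IsClosed ((op L 0).graph : Set (H × H))) (n : Fin M → ℕ) :
    ∀ q ∈ Ω ×ˢ Set.Ioi t₀, dirDeriv (spaceDirections n) (graphField L u) q ∈ (op L 0).graph :=
  dirDeriv_mem (isOpen_prod hΩ) hcl hu.graphField_mem _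

theorem mixedDeriv_mem (hu : IsSolution K p L Ω t₀ u) (hΩ : IsOpen Ω)
    (hcl : IsClosed ((op L 0).graph : Set (H × H))) {n : Fin M → ℕ} (hn : order n ≤ p)
    {X : EuclideanSpace ℝ (Fin M)} (hX : X ∈ Ω) {t : ℝ} (ht : t₀ < t) :
    mixedDeriv n (fun x => u x t) X ∈ D := by
  rw [hu.mixedDeriv_eq_fst hΩ hn (q := (X, t)) ⟨hX, ht⟩]
  exact (opApply_eq_of_mem_graph (A := op L 0)
    (hu.dirDeriv_graphField_mem hΩ hcl n (X, t) ⟨hX, ht⟩)).1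

theorem opApply_mixedDeriv (hu : IsSolution K p L Ω t₀ u) (hΩ : IsOpen Ω)
    (hcl : IsClosed ((op L 0).graph : Set (H × H))) {Λ : (Fin M → ℕ) → H × H →L[ℝ] H}
    (hΛ : ∀ k, ∀ z ∈ (op L 0).graph, Λ k z = opApply (op L k) z.1) {n : Fin M → ℕ}
    (hn : order n ≤ p) (k : Fin M → ℕ) {q : EuclideanSpace ℝ (Fin M) × ℝ}
    (hq : q ∈ Ω ×ˢ Set.Ioi t₀) :
    opApply (op L k) (mixedDeriv n (fun x => u x q.2) q.1)
      = Λ k (dirDeriv (spaceDirections n) (graphField L u) q) := by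
  rw [hu.mixedDeriv_eq_fst hΩ hn hq, hΛ k _ (hu.dirDeriv_graphField_mem hΩ hcl n q hq)]

theorem contDiffOn_dirDeriv_graphField (hu : IsSolution K p L Ω t₀ u) (hΩ : IsOpen Ω)
    {n : Fin M → ℕ} {q : ℕ} (hn : order n + q ≤ p) :
    ContDiffOn ℝ q (dirDeriv (spaceDirections n) (graphField L u)) (Ω ×ˢ Set.Ioi t₀) := by
  refine contDiffOn_dirDeriv (isOpen_prod hΩ) _ (hu.contDiffOn_graphField.of_le ?_)
  simp only [spaceDirections, List.length_map, length_directions]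
  exact_mod_cast hn

theorem continuousOn_opApply_mixedDeriv [CompleteSpace H] (hfam : IsOperatorFamily K L)
    (hu : IsSolution K p L Ω t₀ u) (hΩ : IsOpen Ω)
    (hcl : IsClosed ((op L 0).graph : Set (H × H))) {n : Fin M → ℕ} (hn : order n ≤ p)
    (k : Fin M → ℕ) {X : EuclideanSpace ℝ (Fin M)} (hX : X ∈ Ω) :
    ContinuousOn (fun t => opApply (op L k) (mixedDeriv n (fun x => u x t) X)) (Set.Ioi t₀) := by
  obtain ⟨Λ, hΛ⟩ := exists_clm hfam hcl
  have h : ContinuousOn (dirDeriv (spaceDirections n) (graphField L u)) (Ω ×ˢ Set.Ioi t₀) :=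
    (hu.contDiffOn_dirDeriv_graphField hΩ (n := n) (q := 0) (by simpa using hn)).continuousOn
  refine ((Λ k).continuous.comp_continuousOn
    (h.comp (Continuous.prodMk_right X).continuousOn fun t ht => ⟨hX, ht⟩)).congr fun t ht => ?_
  exact hu.opApply_mixedDeriv hΩ hcl hΛ hn k (q := (X, t)) ⟨hX, ht⟩

theorem hasDerivAt_mixedDeriv [CompleteSpace H] {N : ℕ} (hfam : IsOperatorFamily K L)
    (hu : IsSolution K (N + max K 1) L Ω t₀ u) (hΩ : IsOpen Ω)
    (hcl : IsClosed ((op L 0).graph : Set (H × H))) {n : Fin M → ℕ} (hn : order n ≤ N)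
    {X : EuclideanSpace ℝ (Fin M)} (hX : X ∈ Ω) {t : ℝ} (ht : t₀ < t) :
    HasDerivAt (fun t => mixedDeriv n (fun x => u x t) X)
      (∑ k ∈ multiIndices M K,
        opApply (op L k) (mixedDeriv (n + k) (fun x => u x t) X)) t := by
  obtain ⟨Λ, hΛ⟩ := exists_clm hfam hcl
  have hK1 : 1 ≤ max K 1 := le_max_right _ _
  have hKK : K ≤ max K 1 := le_max_left _ _
  set U : Set (EuclideanSpace ℝ (Fin M) × ℝ) := Ω ×ˢ Set.Ioi t₀ with hU'
  have hU : IsOpen U := isOpen_prod hΩ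
  have hXt : (X, t) ∈ U := ⟨hX, ht⟩
  set v := graphField L u
  set τ : EuclideanSpace ℝ (Fin M) × ℝ := (0, 1)
  have hpde : Set.EqOn (fun q => lineDeriv ℝ (fun q => (v q).1) q τ)
      (fun q => ∑ k ∈ multiIndices M K, Λ k (dirDeriv (spaceDirections k) v q)) U := by
    intro q hq
    have h1 := hasDerivAt_time hU (f := fun q => (v q).1)
      (hu.smooth.of_le (by exact_mod_cast hK1.trans (Nat.le_add_left _ _))) (x := q.1) (t := q.2) hq
    have h2 := hu.pde q.1 hq.1 q.2 hq.2
    change lineDeriv ℝ (fun q => (v q).1) (q.1, q.2) (0, 1) = _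
    rw [← h1.deriv]
    refine Eq.trans h2 (Finset.sum_congr rfl fun k hk => ?_)
    exact hu.opApply_mixedDeriv hΩ hcl hΛ
      ((mem_multiIndices.mp hk).trans (hKK.trans (Nat.le_add_left _ _))) k hq
  have hlen : (spaceDirections n).length = order n := by simp [spaceDirections]
  have hv1 : ContDiffOn ℝ (order n + 1 : ℕ) (fun q => (v q).1) U :=
    hu.smooth.of_le (by exact_mod_cast add_le_add hn hK1)
  have h1 := hasDerivAt_time hU (f := dirDeriv (spaceDirections n) fun q => (v q).1)
    (contDiffOn_dirDeriv hU _ (q := 1) (by rwa [hlen])) hXt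
  have h2 : lineDeriv ℝ (dirDeriv (spaceDirections n) fun q => (v q).1) (X, t) τ
      = dirDeriv (spaceDirections n)
        (fun q => ∑ k ∈ multiIndices M K, Λ k (dirDeriv (spaceDirections k) v q)) (X, t) := by
    rw [← eqOn_dirDeriv hU hpde (spaceDirections n) hXt]
    have h3 := dirDeriv_perm hU (l := τ :: spaceDirections n) (l' := spaceDirections n ++ [τ])
      (List.perm_append_singleton τ (spaceDirections n)).symm (f := fun q => (v q).1)
      (by rwa [List.length_cons, hlen]) hXt
    rw [dirDeriv_append] at h3
    exact h3
  have hΛk : ∀ k ∈ multiIndices M K, ContDiffOn ℝ (spaceDirections n).length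
      (dirDeriv (spaceDirections k) v) U := by
    intro k hk
    refine hu.contDiffOn_dirDeriv_graphField hΩ ?_
    rw [hlen, add_comm]
    exact add_le_add hn ((mem_multiIndices.mp hk).trans hKK)
  rw [h2, dirDeriv_sum (multiIndices M K) hU (spaceDirections n)
    (f := fun k q => Λ k (dirDeriv (spaceDirections k) v q))
    (fun k hk => (Λ k).contDiff.comp_contDiffOn (hΛk k hk)) hXt] at h1
  refine (h1.congr_deriv (Finset.sum_congr rfl fun k hk => ?_)).congr_of_eventuallyEq ?_
  · have hnk : order (n + k) ≤ N + max K 1 := by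
      rw [order_add]; exact add_le_add hn ((mem_multiIndices.mp hk).trans hKK)
    rw [hu.opApply_mixedDeriv hΩ hcl hΛ hnk k hXt,
      dirDeriv_clm_comp hU _ (hΛk k hk) (Λ k) hXt, ← dirDeriv_append]
    refine congrArg (Λ k) (dirDeriv_perm hU ?_ ?_ hXt).symm
    · simpa [spaceDirections] using (directions_add_perm n k).map
        fun v : EuclideanSpace ℝ (Fin M) => (v, (0 : ℝ))
    · refine hu.contDiffOn_graphField.of_le ?_
      simp only [spaceDirections, List.length_map, length_directions]
      exact_mod_cast hnk
  · filter_upwards [Ioi_mem_nhds ht] with s hs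
    rw [mixedDeriv_eq_dirDeriv]
    exact dirDeriv_slice (directions n) (fun q : _ × ℝ => u q.1 q.2) X s

open scoped Classical in
/-- The coupling consists of the terms of the equation for the derivatives of order at most `N`
in which derivatives of a higher order occur. -/
theorem coupling_apply [CompleteSpace H] {N : ℕ} (hN : 1 ≤ N)
    (hu : IsSolution K (N + max K 1) L Ω t₀ u) (hΩ : IsOpen Ω)
    (hcl : IsClosed ((op L 0).graph : Set (H × H)))
    {X : EuclideanSpace ℝ (Fin M)} (hX : X ∈ Ω) {t : ℝ} (ht : t₀ < t) (n : multiIndices M N) :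
    coupling K N L u X t n = ∑ k ∈ multiIndices M K, if N < order (n.1 + k) then
      opApply (op L k) (mixedDeriv (n.1 + k) (fun x => u x t) X) else 0 := by
  have hn : order n.1 ≤ N := mem_multiIndices.mp n.2
  rw [coupling, ← Finset.sum_erase (multiIndices M K) (a := 0)
    (by rw [add_zero, if_neg hn.not_gt])]
  refine Finset.sum_congr rfl fun k hk => ?_
  have hnk : order (n.1 + k) ≤ N + max K 1 := by
    rw [order_add]
    exact add_le_add hn ((mem_multiIndices.mp (Finset.mem_of_mem_erase hk)).trans
      (le_max_left _ _))
  have hD : mixedDeriv (n.1 + k) (fun x => u x t) X ∈ D := hu.mixedDeriv_mem hΩ hcl hnk hX ht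
  split_ifs with h
  -- Every l contributes the same derivative, with weight binom(n+k, l) / binom(|n+k|, N); by
  -- Vandermonde the weights sum to one. The strictness of l < n + k excludes nothing because |n +
  -- k| > N.
  · have hterm : ∀ l ∈ (multiIndices M N).filter (fun l => order l = N ∧ l < n.1 + k),
        opApply (op L k) ((multiChoose (n.1 + k) l : ℝ) •
          mixedDeriv (n.1 + k - l) (taylorCoeff N l (fun x' => u x' t) X) X)
        = ((multiChoose (n.1 + k) l : ℝ) * ((order (n.1 + k)).choose N : ℝ)⁻¹) •
          opApply (op L k) (mixedDeriv (n.1 + k) (fun x => u x t) X) := by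
      intro l hl
      obtain ⟨_, hl, hlt⟩ := Finset.mem_filter.mp hl
      rw [mixedDeriv_taylorCoeff hΩ hX hN hl hlt.le
        ((hu.contDiffOn_slice ht).of_le (by exact_mod_cast hnk)), smul_smul, opApply_smul]
      exact hD
    rw [Finset.sum_congr rfl hterm, ← Finset.sum_smul, ← Finset.sum_mul, ← Nat.cast_sum]
    have hsum : ∑ l ∈ (multiIndices M N).filter (fun l => order l = N ∧ l < n.1 + k),
        multiChoose (n.1 + k) l = (order (n.1 + k)).choose N := by
      rw [← sum_multiChoose (n.1 + k) N]
      refine Finset.sum_subset (fun l hl => ?_) fun l hl hl' => ?_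
      · rw [Finset.mem_filter] at hl ⊢
        exact ⟨hl.1, hl.2.1⟩
      · refine multiChoose_eq_zero fun hle => hl' ?_
        rw [Finset.mem_filter] at hl ⊢
        refine ⟨hl.1, hl.2, lt_of_le_of_ne hle ?_⟩
        rintro rfl
        exact h.ne' hl.2
    rw [hsum, mul_inv_cancel₀ (by exact_mod_cast (Nat.choose_pos h.le).ne'), one_smul]
  · refine Finset.sum_eq_zero fun l hl => ?_
    obtain ⟨_, hl, hlt⟩ := Finset.mem_filter.mp hl
    have := order_lt_of_ne hlt.le hlt.ne
    omega

end IsSolution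

end Solutions

/-! ### The closure of the macroscale field -/

section Commuting

variable {E : Type*} [NormedAddCommGroup E] [NormedSpace ℝ E] {A : E →ₗ.[ℝ] E} {S : ℝ → E →L[ℝ] E}

theorem GeneratesSemigroup.map_graph_of_commute (hS : GeneratesSemigroup A S) {Q : E →L[ℝ] E}
    (hQ : ∀ t, 0 ≤ t → ∀ x, Q (S t x) = S t (Q x)) {x y : E} (hxy : (x, y) ∈ A.graph) :
    (Q x, Q y) ∈ A.graph := by
  rw [hS.generator] at hxy ⊢
  refine ((Q.continuous.tendsto y).comp hxy).congr' ?_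
  filter_upwards [self_mem_nhdsWithin] with t ht
  simp [hQ t (le_of_lt ht)]

theorem GeneratesSemigroup.map_eq_add_convolution [CompleteSpace E] (hS : GeneratesSemigroup A S)
    {Q : E →L[ℝ] E} (hQ : ∀ t, 0 ≤ t → ∀ x, Q (S t x) = S t (Q x)) {g r : ℝ → E} {t₀ : ℝ}
    (ht₀ : t₀ < 0) (hr : ContinuousOn r (Set.Ioi t₀)) (hdom : ∀ t, t₀ < t → g t ∈ A.domain)
    (hd : ∀ t, t₀ < t → HasDerivAt g (opApply A (g t) + r t) t) {t : ℝ} (ht : 0 ≤ t) :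
    Q (g t) = S t (Q (g 0)) + convolution S (fun τ => Q (r τ)) t := by
  have hsub : Set.Icc 0 t ⊆ Set.Ioi t₀ := fun s hs => ht₀.trans_le hs.1
  refine hS.variation_of_constants ht (g := fun τ => Q (g τ)) (r := fun τ => Q (r τ))
    (g' := fun τ => Q (opApply A (g τ) + r τ)) ?_ ?_ ?_ ?_
  · exact Q.continuous.comp_continuousOn
      fun s hs => (hd s (hsub hs)).continuousAt.continuousWithinAt
  · exact Q.continuous.comp_continuousOn (hr.mono hsub)
  · intro τ hτ
    exact (Q.hasFDerivAt.comp_hasDerivAt τ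
      (hd τ (hsub (Set.Ioo_subset_Icc_self hτ)))).hasDerivWithinAt
  · intro τ hτ
    simp only [map_add, add_sub_cancel_right]
    exact hS.map_graph_of_commute hQ
      (mk_opApply_mem_graph (hdom τ (hsub (Set.Ioo_subset_Icc_self hτ))))

end Commuting

section Closure

variable {H : Type*} [NormedAddCommGroup H] [InnerProductSpace ℝ H]
  {M N K m : ℕ} {D : Submodule ℝ H} {L : (Fin M → ℕ) → D →ₗ[ℝ] H}
  {Ω : Set (EuclideanSpace ℝ (Fin M))} {t₀ : ℝ} {u : EuclideanSpace ℝ (Fin M) → ℝ → H}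

theorem mixedDeriv_zero {F : Type*} [NormedAddCommGroup F] [NormedSpace ℝ F]
    (f : EuclideanSpace ℝ (Fin M) → F) : mixedDeriv 0 f = f := by
  have : directions (0 : Fin M → ℕ) = [] :=
    List.eq_nil_of_length_eq_zero (by simp [order])
  rw [mixedDeriv_eq_dirDeriv, this, dirDeriv_nil]

/-- The Taylor multinomial of degree `N` of `u` at the station `X`. -/
def stationJet (N : ℕ) (u : EuclideanSpace ℝ (Fin M) → ℝ → H) (X : EuclideanSpace ℝ (Fin M))
    (t : ℝ) : Jet M N H :=
  fun n => mixedDeriv n.1 (fun x => u x t) X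

namespace IsSolution

theorem stationJet_mem_domain (hu : IsSolution K (N + max K 1) L Ω t₀ u) (hΩ : IsOpen Ω)
    (hcl : IsClosed ((op L 0).graph : Set (H × H))) {X : EuclideanSpace ℝ (Fin M)} (hX : X ∈ Ω)
    {t : ℝ} (ht : t₀ < t) : stationJet N u X t ∈ (jetOperator N L).domain :=
  mem_jetOperator_domain.2 fun n => hu.mixedDeriv_mem hΩ hcl
    ((mem_multiIndices.1 n.2).trans (Nat.le_add_right _ _)) hX ht

/-- In the differentiated equation, terms with |n + k| ≤ N form L̃ applied to the Taylor
multinomial, and those with |n + k| > N are the coupling. -/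
theorem hasDerivAt_stationJet [CompleteSpace H] (hfam : IsOperatorFamily K L) (hN : 1 ≤ N)
    (hu : IsSolution K (N + max K 1) L Ω t₀ u) (hΩ : IsOpen Ω)
    (hcl : IsClosed ((op L 0).graph : Set (H × H))) {X : EuclideanSpace ℝ (Fin M)} (hX : X ∈ Ω)
    {t : ℝ} (ht : t₀ < t) :
    HasDerivAt (stationJet N u X)
      (opApply (jetOperator N L) (stationJet N u X t) + coupling K N L u X t) t := by
  classical
  rw [hasDerivAt_pi]
  intro n
  refine (hu.hasDerivAt_mixedDeriv hfam hΩ hcl (mem_multiIndices.1 n.2) hX ht).congr_deriv ?_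
  rw [Pi.add_apply, hu.coupling_apply hN hΩ hcl hX ht,
    opApply_jetOperator (mem_jetOperator_domain.1 (hu.stationJet_mem_domain hΩ hcl hX ht))]
  set y : (Fin M → ℕ) → H := fun k =>
    opApply (op L k) (mixedDeriv (n.1 + k) (fun x => u x t) X)
  have hy : ∀ k, k ∉ multiIndices M K → y k = 0 := by
    intro k hk
    rw [mem_multiIndices, not_le] at hk
    simp only [y, opApply]
    split_ifs
    · exact DFunLike.congr_fun (hfam.eq_zero k hk) _
    · rfl
  have h1 : ∀ k ∈ multiIndices M N, (if h : n.1 + k ∈ multiIndices M N then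
      opApply (op L k) (stationJet N u X t ⟨n.1 + k, h⟩) else 0)
      = if N < order (n.1 + k) then 0 else y k := by
    intro k _
    by_cases h : n.1 + k ∈ multiIndices M N
    · rw [dif_pos h, if_neg (mem_multiIndices.1 h).not_gt]
      rfl
    · rw [dif_neg h, if_pos (by rwa [mem_multiIndices, not_le] at h)]
  -- The ranges |k| ≤ N and |k| ≤ K may be interchanged: beyond N the condition on |n + k| removes
  -- the term, beyond K the operator is zero.
  have h2 : ∑ k ∈ multiIndices M N, (if N < order (n.1 + k) then 0 else y k)
      = ∑ k ∈ multiIndices M K, if N < order (n.1 + k) then 0 else y k := by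
    refine (Finset.sum_subset (Finset.subset_union_left (s₂ := multiIndices M K)) ?_).trans
      (Finset.sum_subset (Finset.subset_union_right (s₁ := multiIndices M N)) ?_).symm
    · intro k _ hk
      rw [mem_multiIndices, not_le] at hk
      rw [if_pos (by rw [order_add]; omega)]
    · intro k _ hk
      rw [hy k hk, ite_self]
  rw [Finset.sum_congr rfl h1, h2, ← Finset.sum_add_distrib]
  refine Finset.sum_congr rfl fun k _ => ?_
  split_ifs <;> simp [y]

theorem continuousOn_coupling [CompleteSpace H] (hfam : IsOperatorFamily K L) (hN : 1 ≤ N)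
    (hu : IsSolution K (N + max K 1) L Ω t₀ u) (hΩ : IsOpen Ω)
    (hcl : IsClosed ((op L 0).graph : Set (H × H))) {X : EuclideanSpace ℝ (Fin M)} (hX : X ∈ Ω) :
    ContinuousOn (coupling K N L u X) (Set.Ioi t₀) := by
  classical
  refine continuousOn_pi.2 fun n => ?_
  refine ContinuousOn.congr ?_ fun t ht => hu.coupling_apply hN hΩ hcl hX ht n
  refine continuousOn_finsetSum _ fun k hk => ?_
  split_ifs
  · refine hu.continuousOn_opApply_mixedDeriv hfam hΩ hcl ?_ k hX
    rw [order_add]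
    exact add_le_add (mem_multiIndices.1 n.2) ((mem_multiIndices.1 hk).trans (le_max_left _ _))
  · exact continuousOn_const

theorem deriv_macroField [CompleteSpace H] (hfam : IsOperatorFamily K L) (hN : 1 ≤ N)
    (hu : IsSolution K (N + max K 1) L Ω t₀ u) (hΩ : IsOpen Ω)
    (hcl : IsClosed ((op L 0).graph : Set (H × H))) {X : EuclideanSpace ℝ (Fin M)} (hX : X ∈ Ω)
    {t : ℝ} (ht : t₀ < t) (Z₀ : Fin m → H) :
    deriv (fun s => macroField Z₀ u X s) t = innerVec Z₀
      ((opApply (jetOperator N L) (stationJet N u X t) + coupling K N L u X t) (jetZero M N)) := by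
  have h1 := hasDerivAt_pi.1 (hu.hasDerivAt_stationJet hfam hN hΩ hcl hX ht) (jetZero M N)
  have h2 : (fun s => macroField Z₀ u X s)
      = fun s => innerVec Z₀ (stationJet N u X s (jetZero M N)) := by
    funext s
    change _ = innerVec Z₀ (mixedDeriv 0 (fun x => u x s) X)
    rw [mixedDeriv_zero]
    rfl
  rw [h2]
  exact ((innerVec Z₀).hasFDerivAt.comp_hasDerivAt t h1).deriv

end IsSolution

variable {S : ℝ → Jet M N H →L[ℝ] Jet M N H} {V₀ Z₀ : Fin m → H} {α γ C : ℝ}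
  {A : (Fin M → ℕ) → Matrix (Fin m) (Fin m) ℝ} {V : (Fin M → ℕ) → Fin m → H}
  {P : Jet M N H →L[ℝ] Jet M N (Fin m → ℝ)}

/-- The range of 𝒱 and the decaying subspace are both invariant, so the projection along the
decomposition commutes with the semigroup. -/
theorem CentreRecursion.projection_semigroup [CompleteSpace H] (hrec : CentreRecursion N L V₀ Z₀ A V)
    (hS : GeneratesSemigroup (jetOperator N L) S) (hPV : ∀ c, P (centreMap N V c) = c)
    (hPd : ∀ f, f ∈ decayingSubspace S α ↔ P f = 0) {t : ℝ} (ht : 0 ≤ t) (f : Jet M N H) :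
    (1 - (centreMap N V).comp P) (S t f) = S t ((1 - (centreMap N V).comp P) f) := by
  have h1 : P (f - centreMap N V (P f)) = 0 := by rw [map_sub, hPV, sub_self]
  have h2 := (hPd _).1 (hS.map_decayingSubspace ((hPd _).2 h1) ht)
  rw [map_sub, map_sub, hrec.semigroup_centreMap hS _ ht, hPV, sub_eq_zero] at h2
  simp only [sub_apply, one_apply_eq_self, ContinuousLinearMap.comp_apply, map_sub]
  rw [h2, hrec.semigroup_centreMap hS _ ht]

theorem isCompl_jetCentreSubspace (hPV : ∀ c, P (centreMap N V c) = c)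
    (hPd : ∀ f, f ∈ decayingSubspace S α ↔ P f = 0) :
    IsCompl (jetCentreSubspace N V) (decayingSubspace S α) := by
  rw [jetCentreSubspace_eq_range]
  refine IsCompl.of_eq ?_ ?_
  · rw [Submodule.eq_bot_iff]
    rintro _ ⟨⟨c, rfl⟩, hf⟩
    have h1 : P (centreMap N V c) = 0 := (hPd _).1 hf
    rw [hPV] at h1
    change centreMap N V c = 0
    rw [h1, map_zero]
  · rw [Submodule.eq_top_iff']
    intro f
    rw [← add_sub_cancel (centreMap N V (P f)) f]
    refine Submodule.add_mem_sup ⟨P f, rfl⟩ ((hPd _).2 ?_)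
    rw [map_sub, hPV, sub_self]

/-- Here c is the centre part of the state s, w its history convolution and e its transient. The
contributions of c cancel, since ⟨Z⁰, 𝒱c⟩ has coefficients c_n and the zeroth coefficient of 𝒜c is ∑
A_n c_n; those of w and of the coupling make up ρ. -/
theorem closure_error_eq [CompleteSpace H] {Z₀ : Fin m → H} {L₀ : H →ₗ.[ℝ] H} (hb : CentreBases L₀ α V₀ Z₀)
    (hrec : CentreRecursion N L V₀ Z₀ A V) {c rc : Jet M N (Fin m → ℝ)} {w s e : Jet M N H}
    (hw : w ∈ (jetOperator N L).domain) (he : e ∈ (jetOperator N L).domain)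
    {r rs : Jet M N H} (hr : r = centreMap N V rc + rs)
    (hf : s = centreMap N V c + (e + w)) :
    innerVec Z₀ ((opApply (jetOperator N L) s + r) (jetZero M N))
      - ∑ n : multiIndices M N, A n.1 *ᵥ innerVec Z₀ (s n)
      - (innerVec Z₀ (centreMap N V rc (jetZero M N))
        + innerVec Z₀ (opApply (jetOperator N L) w (jetZero M N))
        + innerVec Z₀ (rs (jetZero M N))
        - ∑ n : multiIndices M N, A n.1 *ᵥ innerVec Z₀ (w n))
      = innerVec Z₀ (opApply (jetOperator N L) e (jetZero M N))
        - ∑ n : multiIndices M N, A n.1 *ᵥ innerVec Z₀ (e n) := by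
  have h1 : opApply (jetOperator N L) s = centreMap N V (centreOp N A c)
      + (opApply (jetOperator N L) e + opApply (jetOperator N L) w) := by
    rw [hf, opApply_add (hrec.centreMap_mem_domain c) (Submodule.add_mem _ he hw),
      opApply_add he hw, hrec.opApply_centreMap]
  have h2 : ∀ c n, innerVec Z₀ (centreMap N V c n) = c n := fun c n =>
    congrFun (hrec.innerVec_centreMap hb c) n
  have h3 : centreOp N A c (jetZero M N) = ∑ n : multiIndices M N, A n.1 *ᵥ c n := by
    classical
    rw [centreOp_apply]
    refine Finset.sum_congr rfl fun n _ => ?_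
    rw [if_pos (show (jetZero M N).1 ≤ n.1 from fun i => Nat.zero_le _)]
    rfl
  rw [h1, hr, hf]
  simp only [Pi.add_apply, map_add, h2, h3, Matrix.mulVec_add, Finset.sum_add_distrib]
  abel

theorem exists_closure_error [CompleteSpace H] {L₀ : H →ₗ.[ℝ] H} (hb : CentreBases L₀ α V₀ Z₀)
    (hfam : IsOperatorFamily K L) (hN : 1 ≤ N) (hcl : IsClosed ((op L 0).graph : Set (H × H)))
    (hS : GeneratesSemigroup (jetOperator N L) S) (hrec : CentreRecursion N L V₀ Z₀ A V)
    (hPV : ∀ c, P (centreMap N V c) = c) (hPd : ∀ f, f ∈ decayingSubspace S α ↔ P f = 0)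
    (hΩ : IsOpen Ω) (ht₀ : t₀ < 0) (hu : IsSolution K (N + max K 1) L Ω t₀ u)
    {X : EuclideanSpace ℝ (Fin M)} (hX : X ∈ Ω) {rc : ℝ → multiIndices M N → Fin m → ℝ}
    {rs : ℝ → Jet M N H} (hr : ∀ t, 0 ≤ t → rs t ∈ decayingSubspace S α ∧
      coupling K N L u X t = centreCombination N V (rc t) + rs t) :
    ∃ s₀ ∈ (jetOperator N L).domain, s₀ ∈ decayingSubspace S α ∧ ∀ t, 0 ≤ t →
      IntervalIntegrable (fun τ => S (t - τ) (rs τ)) MeasureTheory.volume 0 t ∧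
      convolution S rs t ∈ (jetOperator N L).domain ∧
      deriv (fun s => macroField Z₀ u X s) t
        - ∑ n ∈ multiIndices M N, A n *ᵥ mixedDeriv n (fun x => macroField Z₀ u x t) X
        - closureRemainder N L S Z₀ A V rc rs t
      = innerVec Z₀ (S t (opApply (jetOperator N L) s₀) (jetZero M N))
        - ∑ n : multiIndices M N, A n.1 *ᵥ innerVec Z₀ (S t s₀ n) := by
  set Q : Jet M N H →L[ℝ] Jet M N H := 1 - (centreMap N V).comp P with hQ
  set g := stationJet N u X
  set r := coupling K N L u X
  have hQapply : ∀ f, Q f = f - centreMap N V (P f) := fun f => rfl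
  have hQS : ∀ t, 0 ≤ t → ∀ f, Q (S t f) = S t (Q f) := fun t ht f =>
    hrec.projection_semigroup hS hPV hPd ht f
  have hQd : ∀ f, Q f ∈ decayingSubspace S α := fun f => by
    rw [hPd, hQapply, map_sub, hPV, sub_self]
  -- Uniqueness of the decomposition identifies the given stable part with the projected coupling,
  -- which supplies its continuity in time.
  have hrQ : ∀ t, 0 ≤ t → rs t = Q (r t) := by
    intro t ht
    obtain ⟨h1, h2⟩ := hr t ht
    rw [hQapply, h2, ← centreMap_apply, map_add, hPV, (hPd _).1 h1, add_zero,
      add_sub_cancel_left]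
  have hdom : ∀ t, t₀ < t → g t ∈ (jetOperator N L).domain := fun t ht =>
    hu.stationJet_mem_domain hΩ hcl hX ht
  have hrc : ContinuousOn r (Set.Ioi t₀) := hu.continuousOn_coupling hfam hN hΩ hcl hX
  have hQdom : ∀ f ∈ (jetOperator N L).domain, Q f ∈ (jetOperator N L).domain := fun f hf =>
    (opApply_eq_of_mem_graph (hS.map_graph_of_commute hQS (mk_opApply_mem_graph hf))).1
  have hs₀ : Q (g 0) ∈ (jetOperator N L).domain := hQdom _ (hdom 0 ht₀)
  refine ⟨Q (g 0), hs₀, hQd _, fun t ht => ?_⟩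
  have hconv : convolution S rs t = convolution S (fun τ => Q (r τ)) t := by
    refine intervalIntegral.integral_congr fun τ hτ => ?_
    rw [Set.uIcc_of_le ht] at hτ
    simp only [hrQ τ hτ.1]
  have hvar : Q (g t) = S t (Q (g 0)) + convolution S rs t := by
    rw [hconv]
    exact hS.map_eq_add_convolution hQS ht₀ hrc hdom
      (fun t ht => hu.hasDerivAt_stationJet hfam hN hΩ hcl hX ht) ht
  have hev := opApply_eq_of_mem_graph (hS.map_graph (mk_opApply_mem_graph hs₀) ht)
  -- The convolution is the difference of Q (g t) and S t (Q (g 0)), both in the domain.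
  have hcdom : convolution S rs t ∈ (jetOperator N L).domain := by
    rw [eq_sub_of_add_eq' hvar.symm]
    exact Submodule.sub_mem _ (hQdom _ (hdom t (ht₀.trans_le ht))) hev.1
  refine ⟨hS.stronglyContinuous.intervalIntegrable ht ?_, hcdom, ?_⟩
  · refine (Q.continuous.comp_continuousOn (hrc.mono fun τ hτ => ?_)).congr fun τ hτ => hrQ τ hτ.1
    exact ht₀.trans_le hτ.1
  have hmix : ∑ n ∈ multiIndices M N, A n *ᵥ mixedDeriv n (fun x => macroField Z₀ u x t) X
      = ∑ n : multiIndices M N, A n.1 *ᵥ innerVec Z₀ (g t n) := by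
    rw [← Finset.sum_coe_sort]
    refine Finset.sum_congr rfl fun n _ => ?_
    rw [hu.mixedDeriv_macroField hΩ Z₀ ((mem_multiIndices.1 n.2).trans (Nat.le_add_right _ _)) hX
      (ht₀.trans_le ht)]
    rfl
  rw [hmix, hu.deriv_macroField hfam hN hΩ hcl hX (ht₀.trans_le ht), ← hev.2]
  refine closure_error_eq hb hrec hcdom hev.1 (hr t ht).2 (c := P (g t)) ?_
  rw [← hvar, hQapply, add_sub_cancel]

theorem isBigO_closure_error {Z₀ : Fin m → H}
    (hC : ∀ f, f ∈ decayingSubspace S α → ∀ t, 0 ≤ t → ‖S t f‖ ≤ C * Real.exp (-γ * t) * ‖f‖)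
    (A : (Fin M → ℕ) → Matrix (Fin m) (Fin m) ℝ)
    {e f : Jet M N H} (he : e ∈ decayingSubspace S α) (hf : f ∈ decayingSubspace S α) :
    (fun t => innerVec Z₀ (S t e (jetZero M N))
      - ∑ n : multiIndices M N, A n.1 *ᵥ innerVec Z₀ (S t f n))
      =O[atTop] fun t : ℝ => Real.exp (-γ * t) := by
  have key : ∀ f ∈ decayingSubspace S α, ∀ B : Jet M N H →L[ℝ] Fin m → ℝ,
      (fun t => B (S t f)) =O[atTop] fun t : ℝ => Real.exp (-γ * t) := by
    intro f hf B
    refine (B.isBigO_comp _ _).trans (IsBigO.of_bound (C * ‖f‖) ?_)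
    filter_upwards [eventually_ge_atTop 0] with t ht
    rw [Real.norm_eq_abs, Real.abs_exp]
    calc _ ≤ C * Real.exp (-γ * t) * ‖f‖ := hC f hf t ht
      _ = _ := by ring
  refine (key e he ((innerVec Z₀).comp (ContinuousLinearMap.proj (jetZero M N)))).sub
    (IsBigO.fun_sum fun n _ => ?_)
  exact key f hf ((matrixOp (A n.1)).comp ((innerVec Z₀).comp (ContinuousLinearMap.proj n)))

end Closure

end SlowlyVarying

end

theorem proposition1 {H : Type*} [NormedAddCommGroup H] [InnerProductSpace ℝ H] [CompleteSpace H]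
    {M N K m : ℕ} (hN : 1 ≤ N) {D : Submodule ℝ H} (L : (Fin M → ℕ) → D →ₗ[ℝ] H)
    (hL : SlowlyVarying.IsOperatorFamily K L)
    {α β : ℝ} (hα : 0 ≤ α) (hβ : N * α < β) (T : ℝ → H →L[ℝ] H)
    (hT : SlowlyVarying.SpectralSplitting (SlowlyVarying.op L 0) T α β)
    (hgen : (∀ k, k ≠ 0 → ∃ C : ℝ, ∀ v : D, ‖L k v‖ ≤ C * ‖(v : H)‖) ∨
      ∃ S, SlowlyVarying.GeneratesSemigroup (SlowlyVarying.jetOperator N L) S)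
    (V₀ Z₀ : Fin m → H) (hVZ : SlowlyVarying.CentreBases (SlowlyVarying.op L 0) α V₀ Z₀) :
    ∃ S : ℝ → SlowlyVarying.Jet M N H →L[ℝ] SlowlyVarying.Jet M N H,
      SlowlyVarying.GeneratesSemigroup (SlowlyVarying.jetOperator N L) S ∧
      IsClosed (SlowlyVarying.decayingSubspace S α : Set (SlowlyVarying.Jet M N H)) ∧
      (∀ lam w, SlowlyVarying.IsGenEigenvector (SlowlyVarying.jetOperator N L) lam w →
        (w.1 ∈ SlowlyVarying.decayingSubspace S α ∧ w.2 ∈ SlowlyVarying.decayingSubspace S α ↔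
          lam.re ≤ -β)) ∧
      (∃ A V, SlowlyVarying.CentreRecursion N L V₀ Z₀ A V) ∧
      ∃ γ : ℝ, α < γ ∧ γ < β ∧
        (∃ C : ℝ, ∀ t, 0 ≤ t → ∀ f ∈ SlowlyVarying.decayingSubspace S α,
          ‖S t f‖ ≤ C * Real.exp (-γ * t) * ‖f‖) ∧
        ∀ A V, SlowlyVarying.CentreRecursion N L V₀ Z₀ A V →
          IsCompl (SlowlyVarying.jetCentreSubspace N V) (SlowlyVarying.decayingSubspace S α) ∧
          ∀ (Ω : Set (EuclideanSpace ℝ (Fin M))) (t₀ : ℝ)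
            (u : EuclideanSpace ℝ (Fin M) → ℝ → H), IsOpen Ω → t₀ < 0 →
            SlowlyVarying.IsSolution K (N + max K 1) L Ω t₀ u →
            ∀ X ∈ Ω, ∀ (rc : ℝ → SlowlyVarying.multiIndices M N → Fin m → ℝ)
              (rs : ℝ → SlowlyVarying.Jet M N H),
              (∀ t, 0 ≤ t → rs t ∈ SlowlyVarying.decayingSubspace S α ∧
                SlowlyVarying.coupling K N L u X t =
                  SlowlyVarying.centreCombination N V (rc t) + rs t) →
              (∀ t, 0 ≤ t →
                IntervalIntegrable (fun τ => S (t - τ) (rs τ)) MeasureTheory.volume 0 t ∧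
                SlowlyVarying.convolution S rs t ∈ (SlowlyVarying.jetOperator N L).domain) ∧
              (fun t : ℝ => deriv (fun s => SlowlyVarying.macroField Z₀ u X s) t
                - ∑ n ∈ SlowlyVarying.multiIndices M N,
                    A n *ᵥ SlowlyVarying.mixedDeriv n
                      (fun x => SlowlyVarying.macroField Z₀ u x t) X
                - SlowlyVarying.closureRemainder N L S Z₀ A V rc rs t)
                =O[atTop] (fun t : ℝ => Real.exp (-γ * t)) := by
  open SlowlyVarying in
  have hN' : (1 : ℝ) ≤ N := by exact_mod_cast hN
  have hαβ : α < β := lt_of_le_of_lt (le_mul_of_one_le_left hα hN') hβ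
  obtain ⟨S, hS⟩ : ∃ S, GeneratesSemigroup (jetOperator N L) S :=
    hgen.elim (exists_generatesSemigroup_jetOperator hT.semigroup) id
  have hcl := hT.semigroup.isClosed_graph
  obtain ⟨γ₀, C₀, hγ₀, hγ₀β, -, hC₀⟩ := hT.exists_decay hαβ
  obtain ⟨γ, hγ, hγγ₀⟩ := exists_between hγ₀
  have hproj : ∀ A V, CentreRecursion N L V₀ Z₀ A V → _ := fun A V hrec =>
    hVZ.exists_jet_projection hT hα hαβ hS hrec hC₀ hγ hγγ₀
  -- One solution of the recursion fixes closedness and the decay constant, since the decaying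
  -- subspace does not depend on it; any other solution only yields another projection with the same
  -- kernel.
  obtain ⟨A₁, V₁, hrec₁⟩ := hVZ.exists_centreRecursion (N := N) hT hαβ
  obtain ⟨P₁, hPV₁, hPd₁, C, hC⟩ := hproj A₁ V₁ hrec₁
  have hclosed : IsClosed (decayingSubspace S α : Set (Jet M N H)) := by
    have h : (decayingSubspace S α : Set (Jet M N H)) = P₁ ⁻¹' {0} := by
      ext f
      exact hPd₁ f
    rw [h]
    exact isClosed_singleton.preimage P₁.continuous
  have hdecay : ∀ f, f ∈ decayingSubspace S α → ∀ t, 0 ≤ t →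
      ‖S t f‖ ≤ C * Real.exp (-γ * t) * ‖f‖ := fun f hf => hC f ((hPd₁ f).1 hf)
  refine ⟨S, hS, hclosed, fun lam w hw => hw.mem_decayingSubspace_iff hT hαβ hS hclosed,
    ⟨A₁, V₁, hrec₁⟩, γ, hγ, hγγ₀.trans hγ₀β, ⟨C, fun t ht f hf => hdecay f hf t ht⟩, ?_⟩
  intro A V hrec
  obtain ⟨P, hPV, hPd, -⟩ := hproj A V hrec
  refine ⟨isCompl_jetCentreSubspace hPV hPd, ?_⟩
  intro Ω t₀ u hΩ ht₀ hu X hX rc rs hr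
  obtain ⟨s₀, hs₀, hs₀d, h⟩ :=
    exists_closure_error hVZ hL hN hcl hS hrec hPV hPd hΩ ht₀ hu hX hr
  refine ⟨fun t ht => ⟨(h t ht).1, (h t ht).2.1⟩, ?_⟩
  refine IsBigO.congr' (isBigO_closure_error (Z₀ := Z₀) hdecay A
    (hS.opApply_mem_decayingSubspace hclosed hs₀d hs₀) hs₀d) ?_ EventuallyEq.rfl
  filter_upwards [eventually_ge_atTop 0] with t ht
  exact (h t ht).2.2.symm
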